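/- Let $1\le q_1\le q_2\le\cdots$ be an infinite sequence of real numbers such that $\mathcal A(x):=\#\{n\ge 1: q_n\le x\}$ is finite for every $x$ and, for some constants $\alpha,\beta>0$, $A\ge 0$, $B>\max\{A,1\}$ and with $\beta'=(2+\beta)^2$, $$\mathcal A(x)=\alpha\int_{\beta'}^x(\log(t/\beta))^{A-1}\Big(1+O\Big(\frac1{(\log t)^{B}}\Big)\Big)dt\qquad(x\ge 2\beta'),$$ that is, $\big|\mathcal A(x)-\alpha\int_{\beta'}^x(\log(t/\beta))^{A-1}dt\big|\le K_0\int_{\beta'}^x(\log(t/\beta))^{A-1}(\log t)^{-B}dt$ for some constant $K_0$ and all $x\ge 2\beta'$. Then there is a constant $C_{\mathcal A}$ such that, as $y\to\infty$, $H(y):=\sum_{q_n\le y}1/q_n$ equals $\frac{\alpha}{A}(\log(y/\beta))^A+C_{\mathcal A}+o(1)$ if $A>0$, and $\alpha\log\log(y/\beta)+C_{\mathcal A}+o(1)$ if $A=0$. For $V\ge 1+C_{\mathcal A}$ put $$W=W(V)=\Big(\frac A\alpha(V-C_{\mathcal A})\Big)^{1/A}\ \text{ if }A>0,\qquad W=W(V)=\exp\Big(\frac{V-C_{\mathcal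 A}}{\alpha}\Big)\ \text{ if }A=0 .$$ For real $Q$ and real random variables $\mathbb X(n)$ put $H_{\mathbb X}(Q)=\sum_{q_n\le Q}\mathbb X(n)/q_n$ and $\Phi_Q(\mathbb X,V)=\mathbb P(H_{\mathbb X}(Q)>V)$. *AIH$(L,Q)$.* The random variables $\{\mathbb X(n)\}_{q_n\le Q}$ satisfy AIH$(L,Q)$, approximated by independent random variables $\{\mathbb Y(n)\}_{q_n\le Q}$ (possibly on another probability space), if for all integers $0\le\ell\le L$ and all $n_1,\dots,n_\ell\le\mathcal A(Q)$ the expectations below exist and $$\mathbb E(\mathbb X(n_1)\cdots\mathbb X(n_\ell))=\mathbb E(\mathbb Y(n_1)\cdots\mathbb Y(n_\ell))+O(e^{-L}).$$ *CRVH$(\mathbb Y)$.* The independent random variables $\{\mathbb Y(n)\}_{n\ge1}$ satisfy CRVH$(\mathbb Y)$ if (i) each $\mathbb Y(n)$ is supported on $[-1,1]$ and has mean $0$; (ii) there is a constant $c_0>0$ with $\mathbb P(\mathbb Y(n)>1-1/t)\gg\exp(-c_0e^{\sqrt t})$ uniformly for $n\ge1$ and $t\ge1$; (iii) there are independent random variables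 $\mathbb Y_n$ $(n\ge1)$, each distributed as $\mathbb Y$, on the same probability space as the $\mathbb Y(n)$, with $\mathbb Y(n)=\mathbb Y_n+O(1/(\log n)^2)$ almost surely, uniformly for $n\ge2$. Let $f_{\mathbb Y}(t)=\log\mathbb E(e^{t\mathbb Y})$ for $0\le t<1$, $f_{\mathbb Y}(t)=\log\mathbb E(e^{t\mathbb Y})-t$ for $t\ge1$, and $\eta_{\mathbb Y}=\int_0^\infty f_{\mathbb Y}(u)u^{-2}du$. **Theorem.** Fix the sequence $(q_n)$ and $\alpha,\beta,A,B$ as above. There are $Q_0$, $c\ge1$, $\Theta'>0$ and an implied constant in the final $O$-term, all depending only on these data, on $c_0$ and on the implied constants in AIH and CRVH, such that the following holds for all $Q\ge Q_0$. Suppose that $\{\mathbb X(n)\}_{q_n\le Q}$ satisfy AIH$(L,Q)$, approximated by $\{\mathbb Y(n)\}_{q_n\le Q}$, where $(\log Q)^{2A^2}\le L\le\mathcal A(Q)$ and the independent random variables $\{\mathbb Y(n)\}_{n\ge1}$ satisfy CRVH$(\mathbb Y)$. Then the integral defining $\eta_{\mathbb Y}$ converges absolutely, and $$\Phi_Q(\mathbb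 X,V)=\exp\left(-\alpha\beta e^{-\eta_{\mathbb Y}-1}W^{A-1}e^{W}\left(1+O\left(\frac{\sqrt{\log W}}{W^{1/2}}+\frac1{W^{(B-1)/2}}\right)\right)\right)$$ for all $V\ge 1+C_{\mathcal A}$ for which $$c\le W=W(V)\le\log L-A\log\log Q-\mathbf 1_{A=0}\cdot\log\log\log Q-\Theta' .$$ -/

import Mathlib

open MeasureTheory ProbabilityTheory Filter Topology

noncomputable section

namespace LargeDev

/-- The indices `n ≥ 1` with `q n ≤ x`. -/
def idx (q : ℕ+ → ℝ) (x : ℝ) : Set ℕ+ := {n | q n ≤ x}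

/-- The counting function `𝒜(x) = #{n : q n ≤ x}`. -/
def count (q : ℕ+ → ℝ) (x : ℝ) : ℕ := (idx q x).ncard

/-- The harmonic sum `H(x) = ∑_{q n ≤ x} 1 / q n`. -/
def harmonicSum (q : ℕ+ → ℝ) (x : ℝ) : ℝ := ∑ᶠ n ∈ idx q x, 1 / q n

/-- The weighted sum `H_X(Q) = ∑_{q n ≤ Q} X n / q n`. -/
def weightedSum {Ω : Type*} (q : ℕ+ → ℝ) (X : ℕ+ → Ω → ℝ) (Q : ℝ) (ω : Ω) : ℝ :=
  ∑ᶠ n ∈ idx q Q, X n ω / q n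

/-- The tail probability `Φ_Q(X, V) = ℙ(H_X(Q) > V)`. -/
def tailProb {Ω : Type*} [MeasurableSpace Ω] (P : Measure Ω) (q : ℕ+ → ℝ)
    (X : ℕ+ → Ω → ℝ) (Q V : ℝ) : ℝ :=
  P.real {ω | V < weightedSum q X Q ω}

/-- A nondecreasing sequence `1 ≤ q 1 ≤ q 2 ≤ ⋯` whose counting function satisfies, for
`x ≥ 2 β'` with `β' = (2 + β) ^ 2`,
`𝒜(x) = α ∫_{β'}^x (log (t / β)) ^ (A - 1) (1 + O(1 / (log t) ^ B)) dt`. As the left-hand side is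
a step function, the error is allowed to depend on `x` as well as on `t`, i.e. the total
error is at most a constant times `∫_{β'}^x (log (t / β)) ^ (A - 1) / (log t) ^ B dt`. -/
structure WellBehaved (q : ℕ+ → ℝ) (α β A B : ℝ) : Prop where
  one_le : ∀ n, 1 ≤ q n
  mono : Monotone q
  finite : ∀ x, (idx q x).Finite
  asymp : ∃ K : ℝ, ∀ x : ℝ, 2 * (2 + β) ^ 2 ≤ x →
    |(count q x : ℝ) - α * ∫ t in ((2 + β) ^ 2)..x, (Real.log (t / β)) ^ (A - 1)| ≤
      K * ∫ t in ((2 + β) ^ 2)..x, (Real.log (t / β)) ^ (A - 1) / (Real.log t) ^ B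

/-- The main term of `H(y)`. -/
def harmonicMain (α β A y : ℝ) : ℝ :=
  if A = 0 then α * Real.log (Real.log (y / β)) else α / A * (Real.log (y / β)) ^ A

/-- The parameter `W(V)`, where `C` is the constant term of `H(y)`; used only for `V ≥ 1 + C`. -/
def paramW (α A C V : ℝ) : ℝ :=
  if A = 0 then Real.exp ((V - C) / α) else (A / α * (V - C)) ^ (1 / A)

/-- The random variables `X n`, `q n ≤ Q`, satisfy the approximate independence
hypothesis `AIH(L, Q)` with implied constant `K`, and are approximated by the independent
random variables `Y n`, `q n ≤ Q`, which may live on another probability space. -/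
structure AIH {Ω Ω' : Type*} [MeasurableSpace Ω] [MeasurableSpace Ω'] (q : ℕ+ → ℝ)
    (L Q K : ℝ) (P : Measure Ω) (X : ℕ+ → Ω → ℝ) (P' : Measure Ω') (Y : ℕ+ → Ω' → ℝ) :
    Prop where
  measurable_left : ∀ n ∈ idx q Q, Measurable (X n)
  measurable_right : ∀ n ∈ idx q Q, Measurable (Y n)
  indep : iIndepFun (fun (n : idx q Q) => Y n) P'
  integrable_left : ∀ ℓ : ℕ, (ℓ : ℝ) ≤ L → ∀ n : Fin ℓ → ℕ+, (∀ i, n i ∈ idx q Q) →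
    Integrable (fun ω => ∏ i, X (n i) ω) P
  integrable_right : ∀ ℓ : ℕ, (ℓ : ℝ) ≤ L → ∀ n : Fin ℓ → ℕ+, (∀ i, n i ∈ idx q Q) →
    Integrable (fun ω => ∏ i, Y (n i) ω) P'
  approx : ∀ ℓ : ℕ, (ℓ : ℝ) ≤ L → ∀ n : Fin ℓ → ℕ+, (∀ i, n i ∈ idx q Q) →
    |(∫ ω, ∏ i, X (n i) ω ∂P) - ∫ ω, ∏ i, Y (n i) ω ∂P'| ≤ K * Real.exp (-L)

/-- The independent random variables `Y n`, `n ≥ 1`, satisfy `CRVH(𝕐)`: `c` and `κ` are the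
constant in the exponent and the implied constant of the lower bound for the tails, and `K`
is the implied constant of the approximation by copies of `𝕐`. -/
structure CRVH {Ω Ω' : Type*} [MeasurableSpace Ω] [MeasurableSpace Ω'] (c κ K : ℝ)
    (P : Measure Ω) (Y : ℕ+ → Ω → ℝ) (P' : Measure Ω') (𝕐 : Ω' → ℝ) : Prop where
  measurable : ∀ n, Measurable (Y n)
  indep : iIndepFun Y P
  support : ∀ n, ∀ᵐ ω ∂P, Y n ω ∈ Set.Icc (-1 : ℝ) 1
  mean_zero : ∀ n, ∫ ω, Y n ω ∂P = 0
  lower : ∀ n, ∀ t : ℝ, 1 ≤ t →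
    κ * Real.exp (-(c * Real.exp (√t))) ≤ P.real {ω | 1 - 1 / t < Y n ω}
  coupling : ∃ Z : ℕ+ → Ω → ℝ, iIndepFun Z P ∧ (∀ n, IdentDistrib (Z n) 𝕐 P P') ∧
    ∀ n : ℕ+, 2 ≤ n → ∀ᵐ ω ∂P, |Y n ω - Z n ω| ≤ K / (Real.log (n : ℕ)) ^ 2

/-- `f_𝕐(t)` for `t ≥ 0`; `cgf 𝕐 P t` is `log 𝔼(exp (t 𝕐))`. -/
def fFun {Ω : Type*} [MeasurableSpace Ω] (P : Measure Ω) (𝕐 : Ω → ℝ) (t : ℝ) : ℝ :=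
  if t < 1 then cgf 𝕐 P t else cgf 𝕐 P t - t

/-- `η_𝕐 = ∫_0^∞ f_𝕐(u) / u ^ 2 du`. -/
def eta {Ω : Type*} [MeasurableSpace Ω] (P : Measure Ω) (𝕐 : Ω → ℝ) : ℝ :=
  ∫ u in Set.Ioi (0 : ℝ), fFun P 𝕐 u / u ^ 2

end LargeDev

end

/-!
The tail probability is computed by the saddle point method, applied to the random variable
`H = ∑ X n / q n` as if the `X n` were the independent variables `Y n`.

*Independent variables.* For independent `Y n` the logarithm of `𝔼 exp (s H)` is
`Λ(s) = ∑ g n (s / q n)`, where `g n` is the cumulant generating function of `Y n`. By `CRVH`, `g n`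
is close to the cumulant generating function of `𝕐`, which is `O(u ^ 2)` for small `u` and
`u + O(u / (log u) ^ 2)` for large `u`; the lower bound for the tails is what makes the second
estimate true. Splitting `Λ(s)` at `q n = √s` and `q n = s` and summing by parts against the
counting function gives `Λ(s) = s (H(s) + α η (log (s / β)) ^ (A - 1))` up to a relatively small error
(`exists_sum_cgf_sub_le`), where the harmonic sum `H(s)` has its own asymptotic formula
(`exists_harmonic_const`). With `s = β e ^ y` and `y` near `W = W(V)` this linearizes to
`Λ(s) ≈ s (V + ω (y - W + η))`, `ω = α W ^ (A - 1)` (`exists_sum_cgf_sub_linear_le`).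
Hence `Λ(s) - s V` has its minimum near `y = W - η - 1`, with the value `-s ω`, and this is the
exponent in the theorem.

*Tail bounds by tilting.* The upper bound is Markov's inequality. For the lower bound, the part of
`𝔼 exp (s H)` from `H` outside of a window `[a, b]` of length `4 ω τ` just above `V` is negligible,
because `Λ` at the neighbouring points `s e ^ (±τ)` drops by about `s ω τ ^ 2` below its
tangent (`drops_of_linear`, `tail_bounds_of_saddle`). For this the drop has to beat the error
`s ω r ^ 2` in the linearization, `r` being the relative error of the theorem, so `τ` is a large
multiple of `r`; this loss in `τ` is the relative error in the result (`exists_relative_error`).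

*Dependent variables.* `AIH` controls only moments of order at most `L`, so `exp (s H)` is replaced
by its Taylor polynomial of an even degree `N` close to `L` (`truncExp`). A Taylor polynomial of even
degree is positive, so Markov's inequality and tilting work with it, and the moments of the
dependent and independent sums differ by `O(e ^ (-L))` times those of the constant `H(Q)`. The sum of
these differences is small as long as `6 s H(Q) ≤ N` (`AIH.abs_truncExp_moment_sub_le`). As
`s` is of order `e ^ W` and `H(Q)` of order `(log Q) ^ A` (`log log Q` if `A = 0`), this is
exactly the upper limit for `W` in the theorem.
-/

noncomputable section

namespace LargeDev

/-! ### Cumulant generating functions of variables in `[-1, 1]` -/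

section Cgf

variable {Ω : Type*} [MeasurableSpace Ω] {μ : Measure Ω} [IsProbabilityMeasure μ] {Z Z' : Ω → ℝ}

lemma integrable_exp_mul_of_abs_le_one (hm : AEMeasurable Z μ) (hb : ∀ᵐ ω ∂μ, |Z ω| ≤ 1)
    (t : ℝ) : Integrable (fun ω => Real.exp (t * Z ω)) μ := by
  refine integrable_exp_mul_of_mem_Icc (a := -1) (b := 1) hm ?_
  filter_upwards [hb] with ω h using abs_le.1 h

lemma integrable_of_abs_le_one (hm : AEMeasurable Z μ) (hb : ∀ᵐ ω ∂μ, |Z ω| ≤ 1) :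
    Integrable Z μ :=
  Integrable.of_bound hm.aestronglyMeasurable 1 (by simpa using hb)

/-- Jensen's inequality for centred variables. -/
lemma one_le_mgf (hm : AEMeasurable Z μ) (hb : ∀ᵐ ω ∂μ, |Z ω| ≤ 1) (h0 : ∫ ω, Z ω ∂μ = 0)
    (t : ℝ) : 1 ≤ mgf Z μ t := by
  have hi := integrable_of_abs_le_one hm hb
  have h1 : ∫ ω, (t * Z ω + 1) ∂μ = 1 := by
    rw [integral_add (hi.const_mul t) (integrable_const _), integral_const_mul, h0]; simp
  rw [← h1]
  exact integral_mono ((hi.const_mul t).add (integrable_const _))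
    (integrable_exp_mul_of_abs_le_one hm hb t) (fun ω => Real.add_one_le_exp _)

lemma cgf_nonneg_of_centered (hm : AEMeasurable Z μ) (hb : ∀ᵐ ω ∂μ, |Z ω| ≤ 1)
    (h0 : ∫ ω, Z ω ∂μ = 0) (t : ℝ) : 0 ≤ cgf Z μ t :=
  Real.log_nonneg (one_le_mgf hm hb h0 t)

lemma cgf_le_self (hm : AEMeasurable Z μ) (hb : ∀ᵐ ω ∂μ, |Z ω| ≤ 1) {t : ℝ} (ht : 0 ≤ t) :
    cgf Z μ t ≤ t := by
  have hi := integrable_exp_mul_of_abs_le_one hm hb t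
  rw [cgf, Real.log_le_iff_le_exp (mgf_pos hi)]
  calc mgf Z μ t ≤ ∫ _, Real.exp t ∂μ := by
        refine integral_mono_ae hi (integrable_const _) ?_
        filter_upwards [hb] with ω h
        exact Real.exp_le_exp.2 (by nlinarith [(abs_le.1 h).2])
    _ = Real.exp t := by simp

lemma exp_le_one_add_add_sq {y : ℝ} (hy : |y| ≤ 1) : Real.exp y ≤ 1 + y + y ^ 2 := by
  have := abs_le.1 (Real.abs_exp_sub_one_sub_id_le hy)
  linarith [this.2]

lemma cgf_le_sq (hm : AEMeasurable Z μ) (hb : ∀ᵐ ω ∂μ, |Z ω| ≤ 1) (h0 : ∫ ω, Z ω ∂μ = 0)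
    {t : ℝ} (ht : 0 ≤ t) (ht1 : t ≤ 1) : cgf Z μ t ≤ t ^ 2 := by
  have hi := integrable_exp_mul_of_abs_le_one hm hb t
  have hi1 := integrable_of_abs_le_one hm hb
  rw [cgf, Real.log_le_iff_le_exp (mgf_pos hi)]
  calc mgf Z μ t ≤ ∫ ω, (t * Z ω + (1 + t ^ 2)) ∂μ := by
        refine integral_mono_ae hi ((hi1.const_mul t).add (integrable_const _)) ?_
        filter_upwards [hb] with ω h
        have h2 : |t * Z ω| ≤ 1 := by
          rw [abs_mul, abs_of_nonneg ht]; nlinarith [abs_nonneg (Z ω)]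
        have h3 : Z ω ^ 2 ≤ 1 := by rw [← sq_abs]; nlinarith [abs_nonneg (Z ω)]
        have := exp_le_one_add_add_sq h2
        show Real.exp _ ≤ _
        nlinarith [sq_nonneg t, mul_le_mul_of_nonneg_left h3 (sq_nonneg t)]
    _ = 1 + t ^ 2 := by
        rw [integral_add (hi1.const_mul t) (integrable_const _), integral_const_mul, h0]; simp
    _ ≤ Real.exp (t ^ 2) := by linarith [Real.add_one_le_exp (t ^ 2)]

lemma sqrt_le_div_one_add_log_sq {u : ℝ} (hu : 1 ≤ u) :
    √u ≤ 16 * (u / (1 + Real.log u) ^ 2) := by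
  have hu0 : 0 < u := by linarith
  have hl : 0 ≤ Real.log u := Real.log_nonneg hu
  -- with `v = u ^ (1 / 4)`, the bound `log v ≤ v - 1` gives `1 + log u ≤ 4 v`
  have hv : 0 < √(√u) := by positivity
  have h1 : Real.log u = 4 * Real.log (√(√u)) := by
    rw [Real.log_sqrt (by positivity), Real.log_sqrt hu0.le]; ring
  have h2 := Real.log_le_sub_one_of_pos hv
  have h3 : 1 + Real.log u ≤ 4 * √(√u) := by linarith
  have h4 : (1 + Real.log u) ^ 2 ≤ 16 * √u := by
    calc (1 + Real.log u) ^ 2 ≤ (4 * √(√u)) ^ 2 := by gcongr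
      _ = 16 * √u := by rw [mul_pow, Real.sq_sqrt (by positivity)]; norm_num
  have h5 : 0 < (1 + Real.log u) ^ 2 := by positivity
  rw [← mul_div_assoc, le_div_iff₀ h5]
  calc √u * (1 + Real.log u) ^ 2 ≤ √u * (16 * √u) := by gcongr
    _ = 16 * u := by rw [mul_left_comm, Real.mul_self_sqrt hu0.le]

/-- If the tail of `Z` near `1` is not too thin, then `log 𝔼 exp (u Z)` falls short of `u` by at
most `O(u / (log u) ^ 2)`. -/
lemma le_cgf_of_tail (hm : AEMeasurable Z μ) (hb : ∀ᵐ ω ∂μ, |Z ω| ≤ 1) {c κ : ℝ} (hc : 0 < c)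
    (hκ : 0 < κ)
    (ht : ∀ t : ℝ, 1 ≤ t → κ * Real.exp (-(c * Real.exp (√t))) ≤ μ.real {ω | 1 - 1 / t < Z ω})
    {u : ℝ} (hu : 1 ≤ u) :
    u - (4 + 16 * (c * Real.exp 1 + |Real.log κ|)) * (u / (1 + Real.log u) ^ 2) ≤ cgf Z μ u := by
  have hu0 : 0 < u := by linarith
  have hl : 0 ≤ Real.log u := Real.log_nonneg hu
  have hi := integrable_exp_mul_of_abs_le_one hm hb u
  -- the choice of `t` makes `exp √t = e √u`
  set t : ℝ := (1 + Real.log u / 2) ^ 2 with htdef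
  have ht1 : 1 ≤ t := by rw [htdef]; nlinarith
  have hst : Real.exp (√t) = Real.exp 1 * √u := by
    rw [htdef, Real.sqrt_sq (by positivity), Real.exp_add, ← Real.log_sqrt hu0.le,
      Real.exp_log (by positivity)]
  have hmarkov := measure_ge_le_exp_mul_mgf (μ := μ) (X := Z) (1 - 1 / t) hu0.le hi
  have h1 : μ.real {ω | 1 - 1 / t < Z ω} ≤ μ.real {ω | 1 - 1 / t ≤ Z ω} :=
    measureReal_mono (fun ω (h : 1 - 1 / t < Z ω) => h.le)
  have h2 := (ht t ht1).trans (h1.trans hmarkov)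
  have h3 : κ * Real.exp (-(c * Real.exp (√t))) * Real.exp (u * (1 - 1 / t)) ≤ mgf Z μ u := by
    calc _ ≤ Real.exp (-u * (1 - 1 / t)) * mgf Z μ u * Real.exp (u * (1 - 1 / t)) := by gcongr
      _ = mgf Z μ u * (Real.exp (-u * (1 - 1 / t)) * Real.exp (u * (1 - 1 / t))) := by ring
      _ = mgf Z μ u := by rw [← Real.exp_add]; simp
  have h4 : Real.log κ - c * Real.exp (√t) + u * (1 - 1 / t) ≤ cgf Z μ u := by
    rw [cgf, Real.le_log_iff_exp_le (mgf_pos hi), Real.exp_add, Real.exp_sub, Real.exp_log hκ]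
    rwa [Real.exp_neg, ← div_eq_mul_inv] at h3
  rw [hst] at h4
  have h5 := sqrt_le_div_one_add_log_sq hu
  have h6 : u / t ≤ 4 * (u / (1 + Real.log u) ^ 2) := by
    rw [← mul_div_assoc, div_le_div_iff₀ (by positivity) (by positivity), htdef]
    nlinarith [mul_nonneg hu0.le hl, sq_nonneg (Real.log u), mul_nonneg hu0.le (sq_nonneg (Real.log u))]
  have h7 : -(|Real.log κ| * √u) ≤ Real.log κ := by
    have : 1 ≤ √u := Real.one_le_sqrt.2 hu
    have h8 := neg_abs_le (Real.log κ)
    nlinarith [abs_nonneg (Real.log κ)]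
  have h8 : (c * Real.exp 1 + |Real.log κ|) * √u ≤
      (c * Real.exp 1 + |Real.log κ|) * (16 * (u / (1 + Real.log u) ^ 2)) := by gcongr
  have h9 : u * (1 - 1 / t) = u - u / t := by ring
  rw [h9] at h4
  linarith

lemma abs_cgf_sub_le (hm : AEMeasurable Z μ) (hm' : AEMeasurable Z' μ)
    (hb : ∀ᵐ ω ∂μ, |Z ω| ≤ 1) (hb' : ∀ᵐ ω ∂μ, |Z' ω| ≤ 1) {ε : ℝ}
    (hε : ∀ᵐ ω ∂μ, |Z ω - Z' ω| ≤ ε) {u : ℝ} (hu : 0 ≤ u) :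
    |cgf Z μ u - cgf Z' μ u| ≤ u * ε := by
  have key : ∀ Z Z' : Ω → ℝ, AEMeasurable Z μ → AEMeasurable Z' μ → (∀ᵐ ω ∂μ, |Z ω| ≤ 1) →
      (∀ᵐ ω ∂μ, |Z' ω| ≤ 1) → (∀ᵐ ω ∂μ, |Z ω - Z' ω| ≤ ε) → cgf Z μ u ≤ cgf Z' μ u + u * ε := by
    intro Z Z' hm hm' hb hb' hε
    have hi := integrable_exp_mul_of_abs_le_one hm hb u
    have hi' := integrable_exp_mul_of_abs_le_one hm' hb' u
    rw [cgf, cgf, Real.log_le_iff_le_exp (mgf_pos hi), Real.exp_add, Real.exp_log (mgf_pos hi')]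
    rw [mgf, mgf, ← integral_mul_const]
    refine integral_mono_ae hi (hi'.mul_const _) ?_
    filter_upwards [hε] with ω h
    show Real.exp _ ≤ _ * _
    rw [← Real.exp_add]
    exact Real.exp_le_exp.2 (by nlinarith [(abs_le.1 h).2])
  rw [abs_le]
  have h1 := key Z Z' hm hm' hb hb' hε
  have h2 := key Z' Z hm' hm hb' hb (by filter_upwards [hε] with ω h; rwa [abs_sub_comm])
  constructor <;> linarith

lemma exp_sub_linear_lipschitz {u y z : ℝ} (hu : 0 ≤ u) (hu1 : u ≤ 1) (hy : |y| ≤ 1)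
    (hz : |z| ≤ 1) :
    (Real.exp (u * y) - u * y) - (Real.exp (u * z) - u * z) ≤ 2 * u ^ 2 * |y - z| := by
  have hd : ∀ x ∈ Set.Icc (-1 : ℝ) 1, HasDerivWithinAt (fun x => Real.exp (u * x) - u * x)
      (Real.exp (u * x) * u - u) (Set.Icc (-1 : ℝ) 1) x := by
    intro x _
    have h1 : HasDerivAt (fun x => u * x) u x := by simpa using (hasDerivAt_id x).const_mul u
    exact (h1.exp.sub h1).hasDerivWithinAt
  have hbd : ∀ x ∈ Set.Icc (-1 : ℝ) 1, ‖Real.exp (u * x) * u - u‖ ≤ 2 * u ^ 2 := by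
    intro x hx
    have hx' : |u * x| ≤ 1 := by
      rw [abs_mul, abs_of_nonneg hu]; nlinarith [abs_nonneg x, abs_le.2 hx]
    have h2 := Real.abs_exp_sub_one_le hx'
    have h3 : Real.exp (u * x) * u - u = u * (Real.exp (u * x) - 1) := by ring
    rw [Real.norm_eq_abs, h3, abs_mul, abs_of_nonneg hu]
    rw [abs_mul, abs_of_nonneg hu] at h2
    have := abs_le.2 hx
    calc u * |Real.exp (u * x) - 1| ≤ u * (2 * (u * |x|)) := by gcongr
      _ ≤ u * (2 * (u * 1)) := by gcongr
      _ = 2 * u ^ 2 := by ring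
  have := (convex_Icc (-1 : ℝ) 1).norm_image_sub_le_of_norm_hasDerivWithin_le hd hbd
    (abs_le.1 hz) (abs_le.1 hy)
  exact (le_abs_self _).trans this

/-- For centred variables the linear terms cancel, so the difference is quadratic in `u`. -/
lemma abs_cgf_sub_le_sq (hm : AEMeasurable Z μ) (hm' : AEMeasurable Z' μ)
    (hb : ∀ᵐ ω ∂μ, |Z ω| ≤ 1) (hb' : ∀ᵐ ω ∂μ, |Z' ω| ≤ 1) (h0 : ∫ ω, Z ω ∂μ = 0)
    (h0' : ∫ ω, Z' ω ∂μ = 0) {ε : ℝ} (hε : ∀ᵐ ω ∂μ, |Z ω - Z' ω| ≤ ε) {u : ℝ} (hu : 0 ≤ u)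
    (hu1 : u ≤ 1) : |cgf Z μ u - cgf Z' μ u| ≤ 2 * u ^ 2 * ε := by
  have key : ∀ Z Z' : Ω → ℝ, AEMeasurable Z μ → AEMeasurable Z' μ → (∀ᵐ ω ∂μ, |Z ω| ≤ 1) →
      (∀ᵐ ω ∂μ, |Z' ω| ≤ 1) → ∫ ω, Z ω ∂μ = 0 → ∫ ω, Z' ω ∂μ = 0 →
      (∀ᵐ ω ∂μ, |Z ω - Z' ω| ≤ ε) → cgf Z μ u - cgf Z' μ u ≤ 2 * u ^ 2 * ε := by
    intro Z Z' hm hm' hb hb' h0 h0' hε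
    have hi := integrable_exp_mul_of_abs_le_one hm hb u
    have hi' := integrable_exp_mul_of_abs_le_one hm' hb' u
    have hj := (integrable_of_abs_le_one hm hb).const_mul u
    have hj' := (integrable_of_abs_le_one hm' hb').const_mul u
    have h1 : mgf Z μ u ≤ mgf Z' μ u + 2 * u ^ 2 * ε := by
      have e1 : mgf Z μ u = ∫ ω, (Real.exp (u * Z ω) - u * Z ω) ∂μ := by
        rw [integral_sub hi hj, integral_const_mul, h0]; simp [mgf]
      have e2 : mgf Z' μ u + 2 * u ^ 2 * ε =
          ∫ ω, ((Real.exp (u * Z' ω) - u * Z' ω) + 2 * u ^ 2 * ε) ∂μ := by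
        have e3 : ∫ ω, (Real.exp (u * Z' ω) - u * Z' ω) ∂μ = mgf Z' μ u := by
          rw [integral_sub hi' hj', integral_const_mul, h0']; simp [mgf]
        have hs : Integrable (fun ω => Real.exp (u * Z' ω) - u * Z' ω) μ := hi'.sub hj'
        rw [integral_add hs (integrable_const _), e3]; simp
      rw [e1, e2]
      refine integral_mono_ae (hi.sub hj) ((hi'.sub hj').add (integrable_const _)) ?_
      filter_upwards [hε, hb, hb'] with ω h h2 h3
      have h4 := exp_sub_linear_lipschitz hu hu1 h2 h3
      have h5 : 2 * u ^ 2 * |Z ω - Z' ω| ≤ 2 * u ^ 2 * ε := by gcongr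
      show _ - _ ≤ (_ - _) + _
      linarith
    have h2 := one_le_mgf hm' hb' h0' u
    have h3 := mgf_pos hi
    have hε0 : 0 ≤ 2 * u ^ 2 * ε := by
      have : 0 ≤ ε := by
        obtain ⟨ω, h⟩ := hε.exists
        exact (abs_nonneg _).trans h
      positivity
    rw [cgf, cgf, ← Real.log_div h3.ne' (by positivity)]
    calc Real.log (mgf Z μ u / mgf Z' μ u) ≤ mgf Z μ u / mgf Z' μ u - 1 :=
          Real.log_le_sub_one_of_pos (by positivity)
      _ ≤ 2 * u ^ 2 * ε := by
          rw [sub_le_iff_le_add, div_le_iff₀ (by positivity)]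
          nlinarith
  rw [abs_le]
  have h1 := key Z Z' hm hm' hb hb' h0 h0' hε
  have h2 := key Z' Z hm' hm hb' hb h0' h0 (by filter_upwards [hε] with ω h; rwa [abs_sub_comm])
  constructor <;> linarith

lemma mem_interior_integrableExpSet (hm : AEMeasurable Z μ) (hb : ∀ᵐ ω ∂μ, |Z ω| ≤ 1) (u : ℝ) :
    u ∈ interior (integrableExpSet Z μ) := by
  have : integrableExpSet Z μ = Set.univ :=
    Set.eq_univ_of_forall fun t => integrable_exp_mul_of_abs_le_one hm hb t
  simp [this]

lemma hasDerivAt_cgf_deriv (hm : AEMeasurable Z μ) (hb : ∀ᵐ ω ∂μ, |Z ω| ≤ 1) (u : ℝ) :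
    HasDerivAt (cgf Z μ) (deriv (cgf Z μ) u) u :=
  (analyticAt_cgf (mem_interior_integrableExpSet hm hb u)).differentiableAt.hasDerivAt

lemma continuous_deriv_cgf (hm : AEMeasurable Z μ) (hb : ∀ᵐ ω ∂μ, |Z ω| ≤ 1) :
    Continuous (deriv (cgf Z μ)) :=
  continuous_iff_continuousAt.2 fun u =>
    (analyticAt_cgf (mem_interior_integrableExpSet hm hb u)).deriv.continuousAt

lemma abs_deriv_cgf_le_one (hm : AEMeasurable Z μ) (hb : ∀ᵐ ω ∂μ, |Z ω| ≤ 1) (u : ℝ) :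
    |deriv (cgf Z μ) u| ≤ 1 := by
  have hi := integrable_exp_mul_of_abs_le_one hm hb u
  rw [deriv_cgf (mem_interior_integrableExpSet hm hb u), abs_div, abs_of_pos (mgf_pos hi),
    div_le_one (mgf_pos hi)]
  calc |∫ ω, Z ω * Real.exp (u * Z ω) ∂μ| ≤ ∫ ω, Real.exp (u * Z ω) ∂μ := by
        rw [← Real.norm_eq_abs]
        refine norm_integral_le_of_norm_le hi ?_
        filter_upwards [hb] with ω h
        rw [norm_mul, Real.norm_eq_abs, Real.norm_eq_abs, Real.abs_exp]
        exact mul_le_of_le_one_left (Real.exp_pos _).le h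
    _ = mgf Z μ u := rfl

lemma abs_deriv_cgf_le (hm : AEMeasurable Z μ) (hb : ∀ᵐ ω ∂μ, |Z ω| ≤ 1)
    (h0 : ∫ ω, Z ω ∂μ = 0) {u : ℝ} (hu : 0 ≤ u) (hu1 : u ≤ 1) :
    |deriv (cgf Z μ) u| ≤ 2 * u := by
  have hi := integrable_exp_mul_of_abs_le_one hm hb u
  have hj := integrable_of_abs_le_one hm hb
  have h1 := one_le_mgf hm hb h0 u
  have hij : Integrable (fun ω => Z ω * Real.exp (u * Z ω)) μ := by
    refine hi.mono (hm.aestronglyMeasurable.mul hi.aestronglyMeasurable) ?_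
    filter_upwards [hb] with ω h
    rw [norm_mul, Real.norm_eq_abs, Real.norm_eq_abs, Real.abs_exp]
    exact mul_le_of_le_one_left (Real.exp_pos _).le h
  rw [deriv_cgf (mem_interior_integrableExpSet hm hb u), abs_div,
    abs_of_pos (mgf_pos hi), div_le_iff₀ (mgf_pos hi)]
  have h2 : ∫ ω, Z ω * Real.exp (u * Z ω) ∂μ = ∫ ω, (Z ω * Real.exp (u * Z ω) - Z ω) ∂μ := by
    rw [integral_sub hij hj, h0, sub_zero]
  calc |∫ ω, Z ω * Real.exp (u * Z ω) ∂μ| ≤ ∫ _, 2 * u ∂μ := by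
        rw [h2, ← Real.norm_eq_abs]
        refine norm_integral_le_of_norm_le (integrable_const _) ?_
        filter_upwards [hb] with ω h
        have hx' : |u * Z ω| ≤ 1 := by
          rw [abs_mul, abs_of_nonneg hu]; nlinarith [abs_nonneg (Z ω)]
        have h2 := Real.abs_exp_sub_one_le hx'
        rw [abs_mul, abs_of_nonneg hu] at h2
        have h3 : Z ω * Real.exp (u * Z ω) - Z ω = Z ω * (Real.exp (u * Z ω) - 1) := by ring
        rw [h3, norm_mul, Real.norm_eq_abs, Real.norm_eq_abs]
        calc |Z ω| * |Real.exp (u * Z ω) - 1| ≤ 1 * (2 * (u * |Z ω|)) := by gcongr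
          _ ≤ 1 * (2 * (u * 1)) := by gcongr
          _ = 2 * u := by ring
    _ = 2 * u := by simp
    _ ≤ 2 * u * mgf Z μ u := by nlinarith

end Cgf

/-- The analytic information about the cumulant generating functions `g n` of the `Y n` and `g₀` of
`𝕐` on which the estimates rest; all implied constants are `K`, and `g₀'` is the derivative of `g₀`.
The quadratic bounds for `u ≤ 1` are needed for the `q n > s`, where `u = s / q n` and only
`∑ (s / q n) ^ 2` is bounded uniformly in the range of summation. -/
structure CgfFamily (K : ℝ) (g : ℕ+ → ℝ → ℝ) (g₀ g₀' : ℝ → ℝ) : Prop where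
  small_limit : ∀ u, 0 ≤ u → u ≤ 1 → |g₀ u| ≤ K * u ^ 2
  large : ∀ n u, 1 ≤ u → |g n u - u| ≤ K * (u / (1 + Real.log u) ^ 2)
  large_limit : ∀ u, 1 ≤ u → |g₀ u - u| ≤ K * (u / (1 + Real.log u) ^ 2)
  close : ∀ n : ℕ+, 2 ≤ n → ∀ u, 0 ≤ u → |g n u - g₀ u| ≤ K * (u / Real.log (n : ℕ) ^ 2)
  close_sq : ∀ n : ℕ+, 2 ≤ n → ∀ u, 0 ≤ u → u ≤ 1 →
    |g n u - g₀ u| ≤ K * (u ^ 2 / Real.log (n : ℕ) ^ 2)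
  hasDerivAt : ∀ u, HasDerivAt g₀ (g₀' u) u
  continuous_deriv : Continuous g₀'
  abs_deriv_le : ∀ u, |g₀' u| ≤ K
  abs_deriv_le_mul : ∀ u, 0 ≤ u → u ≤ 1 → |g₀' u| ≤ K * u

/-- The constant for which the cumulant generating functions of variables with `CRVH` form a
`CgfFamily`. -/
def cgfConst (c κ K : ℝ) : ℝ := 4 + 16 * (c * Real.exp 1 + |Real.log κ|) + 2 * K

lemma tendsto_const_div_log_sq (K : ℝ) :
    Tendsto (fun n : ℕ+ => K / Real.log (n : ℕ) ^ 2) atTop (𝓝 0) :=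
  ((tendsto_pow_atTop two_ne_zero).comp (Real.tendsto_log_atTop.comp
    (tendsto_natCast_atTop_atTop.comp tendsto_PNat_val_atTop_atTop))).const_div_atTop K

/-- The limit variable `𝕐` of the hypothesis `CRVH` inherits the bound `|𝕐| ≤ 1` and the mean
zero. -/
lemma CRVH.limit_bounded_centered {Ω Ω' : Type*} [MeasurableSpace Ω] [MeasurableSpace Ω']
    {c κ K : ℝ} {P : Measure Ω} [IsProbabilityMeasure P] {P' : Measure Ω'}
    [IsProbabilityMeasure P'] {Y : ℕ+ → Ω → ℝ} {𝕐 : Ω' → ℝ} (h : CRVH c κ K P Y P' 𝕐) :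
    (∀ᵐ ω ∂P', |𝕐 ω| ≤ 1) ∧ ∫ ω, 𝕐 ω ∂P' = 0 := by
  obtain ⟨Z, -, hZ, hYZ⟩ := h.coupling
  have hb : ∀ n : ℕ+, 2 ≤ n → ∀ᵐ ω ∂P', |𝕐 ω| ≤ 1 + K / Real.log (n : ℕ) ^ 2 := by
    intro n hn
    have h1 := hYZ n hn
    have h2 : ∀ᵐ ω ∂P, Z n ω ∈ {x : ℝ | |x| ≤ 1 + K / Real.log (n : ℕ) ^ 2} := by
      filter_upwards [h1, h.support n] with ω h3 h4
      have h5 := abs_le.2 h4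
      have h6 := abs_sub_abs_le_abs_sub (Z n ω) (Y n ω)
      rw [abs_sub_comm] at h3
      show |Z n ω| ≤ _
      linarith
    exact (hZ n).ae_snd
      (measurableSet_le continuous_abs.measurable measurable_const) h2
  have hb1 : ∀ᵐ ω ∂P', |𝕐 ω| ≤ 1 := by
    have h1 : ∀ᵐ ω ∂P', ∀ n : ℕ+, 2 ≤ n → |𝕐 ω| ≤ 1 + K / Real.log (n : ℕ) ^ 2 := by
      rw [ae_all_iff]; intro n
      by_cases hn : 2 ≤ n
      · filter_upwards [hb n hn] with ω h _ using h
      · exact Filter.Eventually.of_forall fun _ h => absurd h hn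
    filter_upwards [h1] with ω h2
    have h3 := (tendsto_const_div_log_sq K).const_add 1
    rw [add_zero] at h3
    exact ge_of_tendsto h3 (eventually_atTop.2 ⟨2, h2⟩)
  refine ⟨hb1, ?_⟩
  have hZb : ∀ n, ∀ᵐ ω ∂P, |Z n ω| ≤ 1 := fun n =>
    (hZ n).symm.ae_snd (p := fun x => |x| ≤ 1)
      (measurableSet_le continuous_abs.measurable measurable_const) hb1
  have hm : ∀ n : ℕ+, 2 ≤ n → |∫ ω, 𝕐 ω ∂P'| ≤ K / Real.log (n : ℕ) ^ 2 := by
    intro n hn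
    have h1 := hYZ n hn
    rw [← (hZ n).integral_eq]
    have hiY := integrable_of_abs_le_one (h.measurable n).aemeasurable
      ((h.support n).mono fun ω h => abs_le.2 h)
    have hiZ := integrable_of_abs_le_one (hZ n).aemeasurable_fst (hZb _)
    have h2 : ∫ ω, Z n ω ∂P = -∫ ω, (Y n ω - Z n ω) ∂P := by
      rw [integral_sub hiY hiZ, h.mean_zero]; ring
    rw [h2, abs_neg, ← Real.norm_eq_abs]
    refine (norm_integral_le_of_norm_le (g := fun _ => K / Real.log (n : ℕ) ^ 2)
      (integrable_const _) ?_).trans (by simp)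
    filter_upwards [h1] with ω h3 using h3
  have := ge_of_tendsto (tendsto_const_div_log_sq K) (eventually_atTop.2 ⟨2, hm⟩)
  exact abs_nonpos_iff.1 this

lemma div_one_add_log_sq_nonneg {u : ℝ} (hu : 0 ≤ u) : 0 ≤ u / (1 + Real.log u) ^ 2 := by
  positivity

theorem CRVH.cgfFamily {Ω Ω' : Type*} [MeasurableSpace Ω] [MeasurableSpace Ω']
    {c κ K : ℝ} {P : Measure Ω} [IsProbabilityMeasure P] {P' : Measure Ω'}
    [IsProbabilityMeasure P'] {Y : ℕ+ → Ω → ℝ} {𝕐 : Ω' → ℝ} (h : CRVH c κ K P Y P' 𝕐)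
    (hc : 0 < c) (hκ : 0 < κ) (hK : 0 < K) :
    CgfFamily (cgfConst c κ K) (fun n => cgf (Y n) P) (cgf 𝕐 P') (deriv (cgf 𝕐 P')) := by
  obtain ⟨hb, h0⟩ := h.limit_bounded_centered
  obtain ⟨Z, -, hZ, hYZ⟩ := h.coupling
  have hm := (hZ 1).aemeasurable_snd
  have hmY := fun n => (h.measurable n).aemeasurable (μ := P)
  have hbY : ∀ n, ∀ᵐ ω ∂P, |Y n ω| ≤ 1 := fun n => (h.support n).mono fun ω h => abs_le.2 h
  have hmZ := fun n => (hZ n).aemeasurable_fst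
  have hbZ : ∀ n, ∀ᵐ ω ∂P, |Z n ω| ≤ 1 := fun n =>
    (hZ n).symm.ae_snd (p := fun x => |x| ≤ 1)
      (measurableSet_le continuous_abs.measurable measurable_const) hb
  have h0Z : ∀ n, ∫ ω, Z n ω ∂P = 0 := fun n => by rw [(hZ n).integral_eq, h0]
  have hcgf : ∀ n u, cgf (Z n) P u = cgf 𝕐 P' u := fun n u => by
    rw [cgf, cgf, mgf_congr_identDistrib (hZ n)]
  have he : 0 < c * Real.exp 1 := by positivity
  have hC : 4 + 16 * (c * Real.exp 1 + |Real.log κ|) ≤ cgfConst c κ K := by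
    unfold cgfConst; linarith
  have hC2 : 2 ≤ cgfConst c κ K := by
    unfold cgfConst; have := abs_nonneg (Real.log κ); linarith
  have hCK : 2 * K ≤ cgfConst c κ K := by
    unfold cgfConst; have := abs_nonneg (Real.log κ); linarith
  have hclose : ∀ n : ℕ+, 2 ≤ n → ∀ u, 0 ≤ u →
      |cgf (Y n) P u - cgf 𝕐 P' u| ≤ K * (u / Real.log (n : ℕ) ^ 2) := by
    intro n hn u hu
    rw [← hcgf n u]
    refine (abs_cgf_sub_le (hmY n) (hmZ n) (hbY n) (hbZ n) (hYZ n hn) hu).trans (le_of_eq ?_)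
    ring
  have hlarge : ∀ n u, 1 ≤ u → |cgf (Y n) P u - u| ≤
      (4 + 16 * (c * Real.exp 1 + |Real.log κ|)) * (u / (1 + Real.log u) ^ 2) := by
    intro n u hu
    have h1 := le_cgf_of_tail (hmY n) (hbY n) hc hκ (h.lower n) hu
    have h2 := cgf_le_self (hmY n) (hbY n) (show 0 ≤ u by linarith)
    have h3 : 0 ≤ (4 + 16 * (c * Real.exp 1 + |Real.log κ|)) * (u / (1 + Real.log u) ^ 2) := by
      positivity
    rw [abs_le]; constructor <;> linarith
  refine ⟨?_, ?_, ?_, ?_, ?_, ?_, ?_, ?_, ?_⟩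
  · intro u hu hu1
    rw [abs_of_nonneg (cgf_nonneg_of_centered hm hb h0 u)]
    have := cgf_le_sq hm hb h0 hu hu1
    nlinarith [sq_nonneg u]
  · intro n u hu
    exact (hlarge n u hu).trans
      (mul_le_mul_of_nonneg_right hC (div_one_add_log_sq_nonneg (by linarith)))
  · intro u hu
    -- the lower bound for the tails is only assumed for the `Y n`; let `n → ∞` in `hclose`
    refine le_trans ?_
      (mul_le_mul_of_nonneg_right hC (div_one_add_log_sq_nonneg (show 0 ≤ u by linarith)))
    have h1 : ∀ n : ℕ+, 2 ≤ n → |cgf 𝕐 P' u - u| ≤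
        (4 + 16 * (c * Real.exp 1 + |Real.log κ|)) * (u / (1 + Real.log u) ^ 2)
          + (K * u) / Real.log (n : ℕ) ^ 2 := by
      intro n hn
      have h2 := hclose n hn u (by linarith)
      have h3 := hlarge n u hu
      rw [abs_sub_comm] at h2
      have h4 := abs_sub_le (cgf 𝕐 P' u) (cgf (Y n) P u) u
      rw [mul_div_assoc]
      linarith
    have h2 := (tendsto_const_div_log_sq (K * u)).const_add
      ((4 + 16 * (c * Real.exp 1 + |Real.log κ|)) * (u / (1 + Real.log u) ^ 2))
    rw [add_zero] at h2
    exact ge_of_tendsto h2 (eventually_atTop.2 ⟨2, h1⟩)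
  · intro n hn u hu
    refine (hclose n hn u hu).trans ?_
    gcongr
    linarith
  · intro n hn u hu hu1
    rw [← hcgf n u]
    refine (abs_cgf_sub_le_sq (hmY n) (hmZ n) (hbY n) (hbZ n) (h.mean_zero n) (h0Z n)
      (hYZ n hn) hu hu1).trans ?_
    rw [show 2 * u ^ 2 * (K / Real.log (n : ℕ) ^ 2) = 2 * K * (u ^ 2 / Real.log (n : ℕ) ^ 2) by ring]
    gcongr
  · exact fun u => hasDerivAt_cgf_deriv hm hb u
  · exact continuous_deriv_cgf hm hb
  · exact fun u => (abs_deriv_cgf_le_one hm hb u).trans (by linarith)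
  · intro u hu hu1
    exact (abs_deriv_cgf_le hm hb h0 hu hu1).trans (by gcongr)

/-! ### Slowly varying functions -/

lemma one_add_rpow_le_exp {q : ℝ} (hq : 1 ≤ q) {v : ℝ} (hv : 0 ≤ v) :
    (1 + v) ^ q ≤ (4 * q) ^ q * Real.exp (v / 4) := by
  have h1 : 1 + v ≤ 4 * q * Real.exp (v / (4 * q)) := by
    have h2 := Real.add_one_le_exp (v / (4 * q))
    have h3 : 4 * q * (v / (4 * q) + 1) = v + 4 * q := by field_simp
    nlinarith
  calc (1 + v) ^ q ≤ (4 * q * Real.exp (v / (4 * q))) ^ q :=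
        Real.rpow_le_rpow (by linarith) h1 (by linarith)
    _ = (4 * q) ^ q * Real.exp (v / 4) := by
        rw [Real.mul_rpow (by linarith) (Real.exp_pos _).le, ← Real.exp_mul]
        congr 2; field_simp

lemma le_mul_one_add_abs_sub {x y : ℝ} (hy : 1 ≤ y) : x ≤ y * (1 + |x - y|) := by
  nlinarith [le_abs_self (x - y), abs_nonneg (x - y)]

/-- Powers vary slowly: a Potter-type bound. For `x = log s`, `y = log t` the exponential factor is
`(s / t) ^ (1 / 4)` or its inverse, which the integrals below absorb. -/
lemma exists_rpow_le_mul_exp (p : ℝ) : ∃ C : ℝ, 1 ≤ C ∧ ∀ x y : ℝ, 1 ≤ x → 1 ≤ y →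
    x ^ p ≤ C * y ^ p * Real.exp (|x - y| / 4) := by
  set q := max |p| 1 with hq
  have hq1 : 1 ≤ q := le_max_right _ _
  refine ⟨(4 * q) ^ q, Real.one_le_rpow (by linarith) (by linarith), fun x y hx hy => ?_⟩
  have hx0 : 0 < x := by linarith
  have hy0 : 0 < y := by linarith
  have key : (x / y) ^ p ≤ (1 + |x - y|) ^ q := by
    have hv : 1 ≤ 1 + |x - y| := by linarith [abs_nonneg (x - y)]
    have h1 : (x / y) ^ p ≤ (1 + |x - y|) ^ |p| := by
      rcases le_total 0 p with hp | hp
      · rw [abs_of_nonneg hp]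
        refine Real.rpow_le_rpow (by positivity) ?_ hp
        rw [div_le_iff₀ hy0, mul_comm]
        exact le_mul_one_add_abs_sub hy
      · rw [abs_of_nonpos hp, ← inv_div, Real.inv_rpow (by positivity), ← Real.rpow_neg (by positivity)]
        refine Real.rpow_le_rpow (by positivity) ?_ (by linarith)
        rw [div_le_iff₀ hx0, mul_comm, abs_sub_comm]
        exact le_mul_one_add_abs_sub hx
    exact h1.trans (Real.rpow_le_rpow_of_exponent_le hv (le_max_left _ _))
  have h2 := key.trans (one_add_rpow_le_exp hq1 (abs_nonneg (x - y)))
  rw [Real.div_rpow hx0.le hy0.le, div_le_iff₀ (by positivity)] at h2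
  linarith

/-- Increments of powers, in the same shape. -/
lemma exists_abs_rpow_sub_rpow_le (p : ℝ) : ∃ C : ℝ, 0 < C ∧ ∀ x y : ℝ, 1 ≤ x → 1 ≤ y →
    |x ^ p - y ^ p| ≤ C * y ^ (p - 1) * |x - y| * Real.exp (|x - y| / 4) := by
  obtain ⟨C, hC, h⟩ := exists_rpow_le_mul_exp (p - 1)
  refine ⟨(|p| + 1) * C, by positivity, fun x y hx hy => ?_⟩
  have hsub : ∀ z ∈ Set.uIcc y x, 1 ≤ z ∧ |z - y| ≤ |x - y| := by
    intro z hz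
    refine ⟨(le_min hy hx).trans hz.1, Set.abs_sub_left_of_mem_uIcc hz⟩
  have hd : ∀ z ∈ Set.uIcc y x, HasDerivWithinAt (fun z : ℝ => z ^ p) (p * z ^ (p - 1))
      (Set.uIcc y x) z := fun z hz =>
    (Real.hasDerivAt_rpow_const (Or.inl (by linarith [(hsub z hz).1]))).hasDerivWithinAt
  have hb : ∀ z ∈ Set.uIcc y x, ‖p * z ^ (p - 1)‖ ≤
      (|p| + 1) * C * y ^ (p - 1) * Real.exp (|x - y| / 4) := by
    intro z hz
    obtain ⟨h1, h2⟩ := hsub z hz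
    have h3 : 0 ≤ z ^ (p - 1) := by positivity
    rw [norm_mul, Real.norm_eq_abs, Real.norm_eq_abs, abs_of_nonneg h3]
    calc |p| * z ^ (p - 1) ≤ (|p| + 1) * (C * y ^ (p - 1) * Real.exp (|z - y| / 4)) :=
          mul_le_mul (by linarith) (h z y h1 hy) h3 (by positivity)
      _ ≤ (|p| + 1) * (C * y ^ (p - 1) * Real.exp (|x - y| / 4)) := by gcongr
      _ = _ := by ring
  have := (convex_uIcc y x).norm_image_sub_le_of_norm_hasDerivWithin_le hd hb
    Set.left_mem_uIcc Set.right_mem_uIcc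
  rw [Real.norm_eq_abs, Real.norm_eq_abs] at this
  linarith

/-! ### The density `(log (t / β)) ^ (A - 1)` and its primitive -/

/-- The logarithmic scale `log (t / β)`. -/
def ell (β t : ℝ) : ℝ := Real.log (t / β)

/-- The main term of `H` as a function of `x = log (y / β)`, a primitive of `α x ^ (A - 1)`. -/
def mainFun (α A x : ℝ) : ℝ := if A = 0 then α * Real.log x else α / A * x ^ A

lemma harmonicMain_eq (α β A y : ℝ) : harmonicMain α β A y = mainFun α A (ell β y) := rfl

lemma hasDerivAt_mainFun (α A : ℝ) {x : ℝ} (hx : 0 < x) :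
    HasDerivAt (mainFun α A) (α * x ^ (A - 1)) x := by
  unfold mainFun
  split_ifs with hA
  · subst hA
    refine ((Real.hasDerivAt_log hx.ne').const_mul α).congr_deriv ?_
    rw [zero_sub, Real.rpow_neg_one]
  · refine ((Real.hasDerivAt_rpow_const (p := A) (Or.inl hx.ne')).const_mul (α / A)).congr_deriv ?_
    field_simp

variable {β : ℝ}

lemma hasDerivAt_ell (hβ : 0 < β) {t : ℝ} (ht : 0 < t) : HasDerivAt (ell β) (1 / t) t := by
  have h1 : HasDerivAt (fun t => t / β) (1 / β) t := by
    simpa using (hasDerivAt_id t).div_const β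
  refine (h1.log (by positivity)).congr_deriv ?_
  field_simp

lemma continuousOn_ell (hβ : 0 < β) : ContinuousOn (ell β) (Set.Ioi 0) := fun _ ht =>
  (hasDerivAt_ell hβ ht).continuousAt.continuousWithinAt

lemma ell_sub (hβ : 0 < β) {s t : ℝ} (hs : 0 < s) (ht : 0 < t) :
    ell β t - ell β s = Real.log (t / s) := by
  unfold ell
  rw [Real.log_div ht.ne' hβ.ne', Real.log_div hs.ne' hβ.ne', Real.log_div ht.ne' hs.ne']; ring

lemma ell_eq (hβ : 0 < β) {t : ℝ} (ht : 0 < t) : ell β t = Real.log t - Real.log β := by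
  unfold ell
  rw [Real.log_div ht.ne' hβ.ne']

lemma ell_mono (hβ : 0 < β) {s t : ℝ} (hs : 0 < s) (h : s ≤ t) : ell β s ≤ ell β t := by
  unfold ell; gcongr

lemma four_le_threshold (hβ : 0 < β) : 4 ≤ (2 + β) ^ 2 := by nlinarith

lemma one_le_log {t : ℝ} (ht : 3 ≤ t) : 1 ≤ Real.log t := by
  rw [Real.le_log_iff_exp_le (by linarith)]; linarith [Real.exp_one_lt_d9]

lemma one_le_ell (hβ : 0 < β) {t : ℝ} (ht : (2 + β) ^ 2 ≤ t) : 1 ≤ ell β t := by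
  refine one_le_log ?_
  rw [le_div_iff₀ hβ]; nlinarith

lemma tendsto_ell (hβ : 0 < β) : Tendsto (ell β) atTop atTop :=
  Real.tendsto_log_atTop.comp (tendsto_id.atTop_div_const hβ)

lemma ell_le_mul_log (hβ : 0 < β) {t : ℝ} (ht : (2 + β) ^ 2 ≤ t) :
    ell β t ≤ (1 + |Real.log β|) * Real.log t := by
  have h4 := four_le_threshold hβ
  have h1 : 1 ≤ Real.log t := one_le_log (by linarith)
  rw [ell_eq hβ (by linarith)]
  nlinarith [neg_abs_le (Real.log β), abs_nonneg (Real.log β)]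

lemma exp_abs_ell_sub (hβ : 0 < β) {s t : ℝ} (hs : 0 < s) (hst : s ≤ t) :
    Real.exp (|ell β s - ell β t| / 4) = t ^ (1 / 4 : ℝ) * s ^ (-(1 / 4) : ℝ) := by
  have ht : 0 < t := by linarith
  have h1 : 0 ≤ Real.log (t / s) := Real.log_nonneg ((one_le_div hs).2 hst)
  rw [abs_sub_comm, ell_sub hβ hs ht, abs_of_nonneg h1, Real.rpow_def_of_pos ht,
    Real.rpow_def_of_pos hs, ← Real.exp_add, Real.log_div ht.ne' hs.ne']
  congr 1; ring

lemma continuousOn_ell_rpow (hβ : 0 < β) (p : ℝ) :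
    ContinuousOn (fun t => ell β t ^ p) (Set.Ici ((2 + β) ^ 2)) := by
  have h4 := four_le_threshold hβ
  refine ContinuousOn.rpow_const ((continuousOn_ell hβ).mono fun t ht => ?_) fun t ht => Or.inl ?_
  · exact lt_of_lt_of_le (by linarith : (0 : ℝ) < (2 + β) ^ 2) ht
  · exact (lt_of_lt_of_le one_pos (one_le_ell hβ ht)).ne'

lemma intervalIntegrable_ell_rpow (hβ : 0 < β) (p : ℝ) {a b : ℝ} (ha : (2 + β) ^ 2 ≤ a)
    (hab : a ≤ b) : IntervalIntegrable (fun t => ell β t ^ p) volume a b :=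
  ((continuousOn_ell_rpow hβ p).mono fun t ht => by
    rw [Set.uIcc_of_le hab] at ht; exact ha.trans ht.1).intervalIntegrable

lemma exists_integral_ell_rpow_le (hβ : 0 < β) (p : ℝ) : ∃ C : ℝ, 0 < C ∧ ∀ t,
    (2 + β) ^ 2 ≤ t → ∫ u in ((2 + β) ^ 2)..t, ell β u ^ p ≤ C * (t * ell β t ^ p) := by
  obtain ⟨C, hC, h⟩ := exists_rpow_le_mul_exp p
  refine ⟨C * (4 / 3), by positivity, fun t ht => ?_⟩
  have h4 := four_le_threshold hβ
  have ht0 : 0 < t := by linarith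
  have hl := one_le_ell hβ ht
  have h1 : ∫ u in ((2 + β) ^ 2)..t, ell β u ^ p ≤
      ∫ u in ((2 + β) ^ 2)..t, C * ell β t ^ p * t ^ (1 / 4 : ℝ) * u ^ (-(1 / 4) : ℝ) := by
    refine intervalIntegral.integral_mono_on ht (intervalIntegrable_ell_rpow hβ p le_rfl ht)
      ((intervalIntegral.intervalIntegrable_rpow' (by norm_num)).const_mul _) fun u hu => ?_
    have hu0 : 0 < u := by linarith [hu.1]
    have := h (ell β u) (ell β t) (one_le_ell hβ hu.1) hl
    rw [exp_abs_ell_sub hβ hu0 hu.2] at this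
    linarith
  refine h1.trans ?_
  rw [intervalIntegral.integral_const_mul, integral_rpow (Or.inl (by norm_num))]
  have h5 : t ^ (1 / 4 : ℝ) * t ^ (-(1 / 4) + 1 : ℝ) = t := by
    rw [← Real.rpow_add ht0]; norm_num
  have h6 : 0 ≤ ((2 + β) ^ 2) ^ (-(1 / 4) + 1 : ℝ) := by positivity
  have h7 : 0 < ell β t ^ p := by positivity
  have h8 : 0 < t ^ (1 / 4 : ℝ) := by positivity
  calc C * ell β t ^ p * t ^ (1 / 4 : ℝ) *
        ((t ^ (-(1 / 4) + 1 : ℝ) - ((2 + β) ^ 2) ^ (-(1 / 4) + 1 : ℝ)) / (-(1 / 4) + 1))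
      ≤ C * ell β t ^ p * t ^ (1 / 4 : ℝ) * ((t ^ (-(1 / 4) + 1 : ℝ) - 0) / (-(1 / 4) + 1)) := by
        gcongr
    _ = C * (4 / 3) * ((t ^ (1 / 4 : ℝ) * t ^ (-(1 / 4) + 1 : ℝ)) * ell β t ^ p) := by
        ring
    _ = _ := by rw [h5]

lemma exists_le_integral_ell_rpow (hβ : 0 < β) (p : ℝ) : ∃ C : ℝ, 0 < C ∧ ∀ t,
    2 * (2 + β) ^ 2 ≤ t → C * (t * ell β t ^ p) ≤ ∫ u in ((2 + β) ^ 2)..t, ell β u ^ p := by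
  obtain ⟨C, hC, h⟩ := exists_rpow_le_mul_exp p
  have he : 0 < Real.exp (Real.log 2 / 4) := Real.exp_pos _
  refine ⟨(C * Real.exp (Real.log 2 / 4))⁻¹ / 2, by positivity, fun t ht => ?_⟩
  have h4 := four_le_threshold hβ
  have ht0 : 0 < t := by linarith
  have hl := one_le_ell hβ (show (2 + β) ^ 2 ≤ t by linarith)
  have h0 : 0 ≤ ∫ u in ((2 + β) ^ 2)..(t / 2), ell β u ^ p := by
    refine intervalIntegral.integral_nonneg (by linarith) fun u hu => ?_
    have := one_le_ell hβ hu.1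
    positivity
  have h1 : ∫ _u in (t / 2)..t, (C * Real.exp (Real.log 2 / 4))⁻¹ * ell β t ^ p ≤
      ∫ u in (t / 2)..t, ell β u ^ p := by
    refine intervalIntegral.integral_mono_on (by linarith) intervalIntegrable_const
      (intervalIntegrable_ell_rpow hβ p (by linarith) (by linarith)) fun u hu => ?_
    have hu1 : (2 + β) ^ 2 ≤ u := by linarith [hu.1]
    have hu0 : 0 < u := by linarith
    have h2 := h (ell β t) (ell β u) hl (one_le_ell hβ hu1)
    have h3 : |ell β t - ell β u| ≤ Real.log 2 := by
      rw [ell_sub hβ hu0 ht0, abs_of_nonneg (Real.log_nonneg ((one_le_div hu0).2 hu.2))]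
      exact Real.log_le_log (by positivity) ((div_le_iff₀ hu0).2 (by linarith [hu.1]))
    have h5 := one_le_ell hβ hu1
    rw [inv_mul_le_iff₀ (by positivity)]
    calc ell β t ^ p ≤ C * ell β u ^ p * Real.exp (|ell β t - ell β u| / 4) := h2
      _ ≤ C * ell β u ^ p * Real.exp (Real.log 2 / 4) := by gcongr
      _ = _ := by ring
  rw [← intervalIntegral.integral_add_adjacent_intervals (b := t / 2)
    (intervalIntegrable_ell_rpow hβ p le_rfl (by linarith))
    (intervalIntegrable_ell_rpow hβ p (by linarith) (by linarith))]
  rw [intervalIntegral.integral_const, smul_eq_mul] at h1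
  calc _ = (t - t / 2) * ((C * Real.exp (Real.log 2 / 4))⁻¹ * ell β t ^ p) := by ring
    _ ≤ _ := by linarith

/-! ### Counting and partial summation -/

variable {q : ℕ+ → ℝ} {α A B : ℝ}

/-- The remainder in the asymptotic formula for the counting function. -/
def remainder (q : ℕ+ → ℝ) (α β A t : ℝ) : ℝ :=
  (count q t : ℝ) - α * ∫ u in ((2 + β) ^ 2)..t, ell β u ^ (A - 1)

lemma WellBehaved.exists_abs_remainder_le (hq : WellBehaved q α β A B) (hβ : 0 < β)
    (hB : 0 < B) : ∃ K : ℝ, 0 < K ∧ ∀ t, 2 * (2 + β) ^ 2 ≤ t →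
      |remainder q α β A t| ≤ K * (t * ell β t ^ (A - 1 - B)) := by
  obtain ⟨K, hK⟩ := hq.asymp
  obtain ⟨C, hC, h⟩ := exists_integral_ell_rpow_le hβ (A - 1 - B)
  set M := (1 + |Real.log β|) ^ B with hM
  have hM0 : 0 < M := by positivity
  refine ⟨(|K| + 1) * (M * C), by positivity, fun t ht => (hK t ht).trans ?_⟩
  have h4 := four_le_threshold hβ
  have htt : (2 + β) ^ 2 ≤ t := by linarith
  have hcont : ContinuousOn (fun u => Real.log (u / β) ^ (A - 1) / Real.log u ^ B)
      (Set.uIcc ((2 + β) ^ 2) t) := by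
    rw [Set.uIcc_of_le htt]
    refine ((continuousOn_ell_rpow hβ (A - 1)).mono fun u hu => hu.1).div
      (ContinuousOn.rpow_const (Real.continuousOn_log.mono fun u hu => ?_) fun u hu => Or.inr hB.le)
      fun u hu => ?_
    · have := hu.1
      exact (show u ≠ 0 by linarith)
    · have := one_le_log (show 3 ≤ u by linarith [hu.1])
      positivity
  have h1 : ∫ u in ((2 + β) ^ 2)..t, Real.log (u / β) ^ (A - 1) / Real.log u ^ B ≤
      ∫ u in ((2 + β) ^ 2)..t, M * ell β u ^ (A - 1 - B) := by
    refine intervalIntegral.integral_mono_on htt hcont.intervalIntegrable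
      ((intervalIntegrable_ell_rpow hβ _ le_rfl htt).const_mul _) fun u hu => ?_
    have h2 := one_le_ell hβ hu.1
    have h3 := one_le_log (show 3 ≤ u by linarith [hu.1])
    have h5 := ell_le_mul_log hβ hu.1
    rw [Real.rpow_sub (by linarith) (A - 1) B]
    change ell β u ^ (A - 1) / Real.log u ^ B ≤ _
    rw [← mul_div_assoc, div_le_div_iff₀ (by positivity) (by positivity)]
    calc ell β u ^ (A - 1) * ell β u ^ B ≤
          ell β u ^ (A - 1) * ((1 + |Real.log β|) * Real.log u) ^ B := by gcongr
      _ = _ := by rw [Real.mul_rpow (by positivity) (by positivity)]; ring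
  have h0 : 0 ≤ ∫ u in ((2 + β) ^ 2)..t, Real.log (u / β) ^ (A - 1) / Real.log u ^ B := by
    refine intervalIntegral.integral_nonneg htt fun u hu => ?_
    have h2 : 1 ≤ Real.log (u / β) := one_le_ell hβ hu.1
    have h3 := one_le_log (show 3 ≤ u by linarith [hu.1])
    positivity
  rw [intervalIntegral.integral_const_mul] at h1
  calc K * ∫ u in ((2 + β) ^ 2)..t, Real.log (u / β) ^ (A - 1) / Real.log u ^ B
      ≤ (|K| + 1) * ∫ u in ((2 + β) ^ 2)..t, Real.log (u / β) ^ (A - 1) / Real.log u ^ B := by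
        gcongr; linarith [le_abs_self K]
    _ ≤ (|K| + 1) * (M * (C * (t * ell β t ^ (A - 1 - B)))) := by
        gcongr
        exact h1.trans (by gcongr; exact h t htt)
    _ = _ := by ring

/-- The indices with `a < q n ≤ b`. -/
def idxBetween (q : ℕ+ → ℝ) (a b : ℝ) : Set ℕ+ := {n | a < q n ∧ q n ≤ b}

lemma WellBehaved.finite_between (hq : WellBehaved q α β A B) (a b : ℝ) :
    (idxBetween q a b).Finite := (hq.finite b).subset fun _ h => h.2

/-- The indices with `a < q n ≤ b`, as a finset. -/
def WellBehaved.between (hq : WellBehaved q α β A B) (a b : ℝ) : Finset ℕ+ :=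
  (hq.finite_between a b).toFinset

lemma WellBehaved.mem_between (hq : WellBehaved q α β A B) {a b : ℝ} {n : ℕ+} :
    n ∈ hq.between a b ↔ a < q n ∧ q n ≤ b := by
  simp [WellBehaved.between, idxBetween]

lemma WellBehaved.count_mono (hq : WellBehaved q α β A B) : Monotone (count q) := fun _ b h =>
  Set.ncard_le_ncard (fun _ hn => le_trans hn h) (hq.finite b)

lemma WellBehaved.card_between (hq : WellBehaved q α β A B) {a b : ℝ} (hab : a ≤ b) :
    ((hq.between a b).card : ℝ) = count q b - count q a := by
  have h1 : (idxBetween q a b).ncard = (hq.between a b).card :=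
    Set.ncard_eq_toFinset_card _ _
  have h2 : idxBetween q a b ∪ idx q a = idx q b := by
    ext n
    simp only [idxBetween, idx, Set.mem_union, Set.mem_ofPred_eq]
    constructor
    · rintro (h | h)
      · exact h.2
      · exact le_trans h hab
    · intro h
      by_cases h3 : q n ≤ a
      · exact Or.inr h3
      · exact Or.inl ⟨not_le.1 h3, h⟩
  have h3 : Disjoint (idxBetween q a b) (idx q a) := by
    rw [Set.disjoint_left]
    exact fun n h h' => absurd h' (not_le.2 h.1)
  have h4 := Set.ncard_union_eq h3 (hq.finite_between a b) (hq.finite a)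
  rw [h2, h1] at h4
  unfold count
  rw [h4]; push_cast; ring

/-- Abel summation against the counting function. -/
lemma WellBehaved.sum_between_eq (hq : WellBehaved q α β A B) {a b : ℝ} (hab : a ≤ b)
    {g g' : ℝ → ℝ} (hg : ∀ t ∈ Set.Icc a b, HasDerivAt g (g' t) t)
    (hg' : ContinuousOn g' (Set.Icc a b)) :
    ∑ n ∈ hq.between a b, g (q n) =
      count q b * g b - count q a * g a - ∫ t in a..b, (count q t : ℝ) * g' t := by
  have hint : IntervalIntegrable g' volume a b := by
    rw [← Set.uIcc_of_le hab] at hg'; exact hg'.intervalIntegrable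
  have hone : ∀ n ∈ hq.between a b,
      ∫ t in a..b, (if q n ≤ t then g' t else 0) = g b - g (q n) := by
    intro n hn
    obtain ⟨h1, h2⟩ := hq.mem_between.1 hn
    have h3 : ∫ t in (q n)..b, g' t = g b - g (q n) := by
      refine intervalIntegral.integral_eq_sub_of_hasDerivAt (fun t ht => hg t ?_)
        (hint.mono_set ?_)
      · rw [Set.uIcc_of_le h2] at ht; exact ⟨h1.le.trans ht.1, ht.2⟩
      · rw [Set.uIcc_of_le h2, Set.uIcc_of_le hab]; exact Set.Icc_subset_Icc_left h1.le
    have h4 : ∀ t, (if q n ≤ t then g' t else 0) = Set.indicator (Set.Ici (q n)) g' t := by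
      intro t; simp [Set.indicator_apply]
    simp_rw [h4]
    rw [← h3, intervalIntegral.integral_of_le hab, intervalIntegral.integral_of_le h2,
      setIntegral_indicator measurableSet_Ici, ← integral_Icc_eq_integral_Ioc]
    congr 2
    ext t
    simp only [Set.mem_inter_iff, Set.mem_Ioc, Set.mem_Ici, Set.mem_Icc]
    constructor
    · rintro ⟨⟨_, h6⟩, h7⟩; exact ⟨h7, h6⟩
    · rintro ⟨h6, h7⟩; exact ⟨⟨by linarith, h7⟩, h6⟩
  have hcount : ∀ t ∈ Set.Icc a b, ∑ n ∈ hq.between a b, (if q n ≤ t then g' t else 0) =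
      (count q t - count q a : ℝ) * g' t := by
    intro t ht
    rw [← Finset.sum_filter, Finset.sum_const, nsmul_eq_mul, ← hq.card_between ht.1]
    congr 3
    ext n
    simp only [Finset.mem_filter, hq.mem_between]
    constructor
    · rintro ⟨⟨h1, _⟩, h3⟩; exact ⟨h1, h3⟩
    · rintro ⟨h1, h3⟩; exact ⟨⟨h1, h3.trans ht.2⟩, h3⟩
  have hmono : Monotone fun t => (count q t : ℝ) := fun x y h =>
    Nat.cast_le.2 (hq.count_mono h)
  have hint2 : IntervalIntegrable (fun t => (count q t : ℝ) * g' t) volume a b :=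
    hmono.intervalIntegrable.mul_continuousOn (by rwa [Set.uIcc_of_le hab])
  have hsum : ∑ n ∈ hq.between a b, (g b - g (q n)) =
      (∫ t in a..b, (count q t : ℝ) * g' t) - count q a * (g b - g a) := by
    rw [← Finset.sum_congr rfl hone, ← intervalIntegral.integral_finsetSum]
    · rw [intervalIntegral.integral_congr (g := fun t => (count q t : ℝ) * g' t - count q a * g' t)]
      · rw [intervalIntegral.integral_sub hint2 (hint.const_mul _),
          intervalIntegral.integral_const_mul,
          intervalIntegral.integral_eq_sub_of_hasDerivAt (f := g) (fun t ht => hg t ?_) hint]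
        rwa [Set.uIcc_of_le hab] at ht
      · intro t ht
        rw [Set.uIcc_of_le hab] at ht
        simp only
        rw [hcount t ht]; ring
    · intro n _
      have h4 : (fun t => (if q n ≤ t then g' t else 0)) = Set.indicator (Set.Ici (q n)) g' := by
        ext t; simp [Set.indicator_apply]
      rw [h4, intervalIntegrable_iff]
      rw [intervalIntegrable_iff] at hint
      exact hint.indicator measurableSet_Ici
  rw [Finset.sum_sub_distrib, Finset.sum_const, nsmul_eq_mul, hq.card_between hab] at hsum
  linarith

/-- Partial summation: sums over the `q n` against integrals with density `α (log (t/β)) ^ (A-1)`. -/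
lemma WellBehaved.sum_between_sub_integral (hq : WellBehaved q α β A B) (hβ : 0 < β) {a b : ℝ}
    (ha : (2 + β) ^ 2 ≤ a) (hab : a ≤ b)
    {g g' : ℝ → ℝ} (hg : ∀ t ∈ Set.Icc a b, HasDerivAt g (g' t) t)
    (hg' : ContinuousOn g' (Set.Icc a b)) :
    ∑ n ∈ hq.between a b, g (q n) - α * ∫ t in a..b, g t * ell β t ^ (A - 1) =
      remainder q α β A b * g b - remainder q α β A a * g a -
        ∫ t in a..b, remainder q α β A t * g' t := by
  have hg'u : ContinuousOn g' (Set.uIcc a b) := by rwa [Set.uIcc_of_le hab]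
  have hint : IntervalIntegrable g' volume a b := hg'u.intervalIntegrable
  have hmono : Monotone fun t => (count q t : ℝ) := fun x y h =>
    Nat.cast_le.2 (hq.count_mono h)
  have hint2 : IntervalIntegrable (fun t => (count q t : ℝ) * g' t) volume a b :=
    hmono.intervalIntegrable.mul_continuousOn hg'u
  set I : ℝ → ℝ := fun t => ∫ u in ((2 + β) ^ 2)..t, ell β u ^ (A - 1) with hI
  have hIab : ∀ t, a ≤ t → I t = I a + ∫ u in a..t, ell β u ^ (A - 1) := fun t ht =>
    (intervalIntegral.integral_add_adjacent_intervals
      (intervalIntegrable_ell_rpow hβ _ le_rfl ha)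
      (intervalIntegrable_ell_rpow hβ _ ha ht)).symm
  have hcont : ContinuousOn (fun t => ell β t ^ (A - 1)) (Set.uIcc a b) :=
    (continuousOn_ell_rpow hβ _).mono fun t ht => by
      rw [Set.uIcc_of_le hab] at ht; exact ha.trans ht.1
  have hIcont : ContinuousOn I (Set.uIcc a b) := by
    have h1 : ContinuousOn (fun t => I a + ∫ u in a..t, ell β u ^ (A - 1)) (Set.uIcc a b) :=
      continuousOn_const.add (intervalIntegral.continuousOn_primitive_interval
        (hcont.integrableOn_compact isCompact_uIcc))
    refine h1.congr fun t ht => ?_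
    rw [Set.uIcc_of_le hab] at ht
    exact hIab t ht.1
  have hId : ∀ t ∈ Set.Ioo (min a b) (max a b), HasDerivAt I (ell β t ^ (A - 1)) t := by
    intro t ht
    rw [min_eq_left hab, max_eq_right hab] at ht
    have htt : (2 + β) ^ 2 < t := lt_of_le_of_lt ha ht.1
    have hnb : Set.Ici ((2 + β) ^ 2) ∈ 𝓝 t := Ici_mem_nhds htt
    refine intervalIntegral.integral_hasDerivAt_right
      (intervalIntegrable_ell_rpow hβ _ le_rfl htt.le)
      ((continuousOn_ell_rpow hβ (A - 1)).stronglyMeasurableAtFilter_nhdsWithin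
        measurableSet_Ici t |>.filter_mono ?_) ((continuousOn_ell_rpow hβ (A - 1)).continuousAt hnb)
    exact le_of_eq (nhdsWithin_eq_nhds.2 hnb).symm
  have hgcont : ContinuousOn g (Set.uIcc a b) := fun t ht => by
    rw [Set.uIcc_of_le hab] at ht
    exact (hg t ht).continuousAt.continuousWithinAt
  have hparts := intervalIntegral.integral_mul_deriv_eq_deriv_mul_of_hasDerivAt (u := g) (v := I)
    (u' := g') (v' := fun t => ell β t ^ (A - 1)) hgcont hIcont
    (fun t ht => hg t (by rw [min_eq_left hab, max_eq_right hab] at ht; exact ⟨ht.1.le, ht.2.le⟩))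
    hId hint hcont.intervalIntegrable
  have hrem : ∫ t in a..b, remainder q α β A t * g' t =
      (∫ t in a..b, (count q t : ℝ) * g' t) - α * ∫ t in a..b, g' t * I t := by
    have hint3 : IntervalIntegrable (fun t => α * (g' t * I t)) volume a b :=
      (hg'u.mul hIcont).intervalIntegrable.const_mul α
    rw [← intervalIntegral.integral_const_mul, ← intervalIntegral.integral_sub hint2 hint3]
    refine intervalIntegral.integral_congr fun t _ => ?_
    simp only [remainder, hI]; ring
  rw [hrem, hq.sum_between_eq hab hg hg', hparts]
  simp only [remainder, hI]
  ring

section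

variable {β : ℝ} {q : ℕ+ → ℝ} {α A B : ℝ}

/-- Partial summation, with the bound for the remainder inserted. -/
lemma WellBehaved.exists_abs_sum_sub_integral_le (hq : WellBehaved q α β A B) (hβ : 0 < β)
    (hB : 0 < B) : ∃ K : ℝ, 0 < K ∧ ∀ a b : ℝ, ∀ g g' : ℝ → ℝ, 2 * (2 + β) ^ 2 ≤ a → a ≤ b →
      (∀ t ∈ Set.Icc a b, HasDerivAt g (g' t) t) → ContinuousOn g' (Set.Icc a b) →
      |∑ n ∈ hq.between a b, g (q n) - α * ∫ t in a..b, g t * ell β t ^ (A - 1)| ≤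
        K * (b * ell β b ^ (A - 1 - B) * |g b| + a * ell β a ^ (A - 1 - B) * |g a| +
          ∫ t in a..b, t * ell β t ^ (A - 1 - B) * |g' t|) := by
  obtain ⟨K, hK, h⟩ := hq.exists_abs_remainder_le hβ hB
  refine ⟨K, hK, fun a b g g' ha hab hg hg' => ?_⟩
  have h4 := four_le_threshold hβ
  rw [hq.sum_between_sub_integral hβ (by linarith) hab hg hg']
  have h1 : |∫ t in a..b, remainder q α β A t * g' t| ≤
      ∫ t in a..b, K * (t * ell β t ^ (A - 1 - B) * |g' t|) := by
    rw [← Real.norm_eq_abs]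
    refine intervalIntegral.norm_integral_le_of_norm_le hab (Eventually.of_forall fun t ht => ?_)
      (ContinuousOn.intervalIntegrable ?_)
    · rw [norm_mul, Real.norm_eq_abs, Real.norm_eq_abs, ← mul_assoc]
      exact mul_le_mul_of_nonneg_right (h t (ha.trans ht.1.le)) (abs_nonneg _)
    · rw [Set.uIcc_of_le hab]
      exact continuousOn_const.mul ((continuousOn_id.mul ((continuousOn_ell_rpow hβ _).mono
        fun t ht => (show (2 + β) ^ 2 ≤ t by linarith [ht.1]))).mul hg'.abs)
  rw [intervalIntegral.integral_const_mul] at h1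
  have h2 : |remainder q α β A b * g b| ≤ K * (b * ell β b ^ (A - 1 - B) * |g b|) := by
    rw [abs_mul, ← mul_assoc]
    exact mul_le_mul_of_nonneg_right (h b (ha.trans hab)) (abs_nonneg _)
  have h3 : |remainder q α β A a * g a| ≤ K * (a * ell β a ^ (A - 1 - B) * |g a|) := by
    rw [abs_mul, ← mul_assoc]
    exact mul_le_mul_of_nonneg_right (h a ha) (abs_nonneg _)
  have h5 := abs_sub (remainder q α β A b * g b - remainder q α β A a * g a)
    (∫ t in a..b, remainder q α β A t * g' t)
  have h6 := abs_sub (remainder q α β A b * g b) (remainder q α β A a * g a)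
  linarith

/-- The indices with `q n ≤ b`, as a finset. -/
def WellBehaved.upTo (hq : WellBehaved q α β A B) (b : ℝ) : Finset ℕ+ := (hq.finite b).toFinset

lemma WellBehaved.mem_upTo (hq : WellBehaved q α β A B) {b : ℝ} {n : ℕ+} :
    n ∈ hq.upTo b ↔ q n ≤ b := by
  rw [WellBehaved.upTo, Set.Finite.mem_toFinset]; rfl

lemma WellBehaved.pos (hq : WellBehaved q α β A B) (n : ℕ+) : 0 < q n :=
  lt_of_lt_of_le one_pos (hq.one_le n)

lemma WellBehaved.sum_upTo (hq : WellBehaved q α β A B) {a b : ℝ} (hab : a ≤ b) (f : ℕ+ → ℝ) :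
    ∑ n ∈ hq.upTo b, f n = ∑ n ∈ hq.upTo a, f n + ∑ n ∈ hq.between a b, f n := by
  rw [← Finset.sum_union]
  · congr 1
    ext n
    simp only [Finset.mem_union, hq.mem_upTo, hq.mem_between]
    constructor
    · intro h
      by_cases h3 : q n ≤ a
      · exact Or.inl h3
      · exact Or.inr ⟨not_le.1 h3, h⟩
    · rintro (h | h)
      · exact h.trans hab
      · exact h.2
  · rw [Finset.disjoint_left]
    intro n h h'
    exact absurd (hq.mem_upTo.1 h) (not_le.2 (hq.mem_between.1 h').1)

lemma WellBehaved.harmonicSum_eq (hq : WellBehaved q α β A B) (y : ℝ) :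
    harmonicSum q y = ∑ n ∈ hq.upTo y, 1 / q n :=
  finsum_mem_eq_finite_toFinset_sum _ _

lemma WellBehaved.harmonicSum_nonneg (hq : WellBehaved q α β A B) (y : ℝ) :
    0 ≤ harmonicSum q y := by
  rw [hq.harmonicSum_eq]
  exact Finset.sum_nonneg fun n _ => by have := hq.pos n; positivity

lemma WellBehaved.harmonicSum_mono (hq : WellBehaved q α β A B) : Monotone (harmonicSum q) := by
  intro a b hab
  rw [hq.harmonicSum_eq, hq.harmonicSum_eq, hq.sum_upTo hab]
  have : 0 ≤ ∑ n ∈ hq.between a b, 1 / q n :=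
    Finset.sum_nonneg fun n _ => by have := hq.pos n; positivity
  linarith

/-! ### Asymptotics of the harmonic sum and of the counting function -/

/-- The Cauchy criterion for `H(y)` minus its main term, with a rate. -/
lemma WellBehaved.exists_abs_harmonicSum_sub_le (hq : WellBehaved q α β A B) (hβ : 0 < β)
    (hB : 0 < B) (hAB : A < B) : ∃ K : ℝ, 0 < K ∧ ∀ z y : ℝ, 2 * (2 + β) ^ 2 ≤ z → z ≤ y →
      |(harmonicSum q y - harmonicMain α β A y) - (harmonicSum q z - harmonicMain α β A z)| ≤
        K * ell β z ^ (A - B) := by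
  obtain ⟨K, hK, h⟩ := hq.exists_abs_sum_sub_integral_le hβ hB
  refine ⟨K * (2 + (B - A)⁻¹), by have : 0 < B - A := by linarith
                                  positivity, fun z y hz hzy => ?_⟩
  have hBA : 0 < B - A := by linarith
  have h4 := four_le_threshold hβ
  have hz0 : 0 < z := by linarith
  have hlz : 1 ≤ ell β z := one_le_ell hβ (by linarith)
  have hly : ell β z ≤ ell β y := ell_mono hβ hz0 hzy
  have hmem : ∀ t ∈ Set.uIcc z y, 0 < t ∧ 1 ≤ ell β t := fun t ht => by
    rw [Set.uIcc_of_le hzy] at ht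
    exact ⟨by linarith [ht.1], one_le_ell hβ (by linarith [ht.1])⟩
  have h1 := h z y (fun t => t⁻¹) (fun t => -(t ^ 2)⁻¹) hz hzy
    (fun t ht => hasDerivAt_inv (by linarith [ht.1]))
    (((continuousOn_pow 2).inv₀ fun t ht => by
      have : 0 < t := by linarith [ht.1]
      positivity).neg)
  have hint1 : ∫ t in z..y, t⁻¹ * ell β t ^ (A - 1) = (∫ t in z..y, ell β t ^ (A - 1) * (1 / t)) := by
    congr 1; ext t; ring
  have hcontE : ∀ p : ℝ, ContinuousOn (fun t => ell β t ^ p * (1 / t)) (Set.uIcc z y) := fun p =>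
    ((continuousOn_ell_rpow hβ p).mono fun t ht => by
      rw [Set.uIcc_of_le hzy] at ht
      exact (show (2 + β) ^ 2 ≤ t by linarith [ht.1])).mul
      (continuousOn_const.div continuousOn_id fun t ht => (hmem t ht).1.ne')
  have hint2 : α * ∫ t in z..y, ell β t ^ (A - 1) * (1 / t) =
      harmonicMain α β A y - harmonicMain α β A z := by
    rw [← intervalIntegral.integral_const_mul, harmonicMain_eq, harmonicMain_eq]
    refine intervalIntegral.integral_eq_sub_of_hasDerivAt (f := fun t => mainFun α A (ell β t))
      (fun t ht => ?_) (((hcontE (A - 1)).intervalIntegrable).const_mul α)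
    obtain ⟨h5, h6⟩ := hmem t ht
    have := (hasDerivAt_mainFun α A (show 0 < ell β t by linarith)).comp t (hasDerivAt_ell hβ h5)
    exact this.congr_deriv (by ring)
  have hint3 : ∫ t in z..y, t * ell β t ^ (A - 1 - B) * |-(t ^ 2)⁻¹| =
      (ell β y ^ (A - B) - ell β z ^ (A - B)) / (A - B) := by
    have : ∫ t in z..y, ell β t ^ (A - 1 - B) * (1 / t) =
        ell β y ^ (A - B) / (A - B) - ell β z ^ (A - B) / (A - B) := by
      refine intervalIntegral.integral_eq_sub_of_hasDerivAt
        (f := fun t => ell β t ^ (A - B) / (A - B)) (fun t ht => ?_)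
        ((hcontE (A - 1 - B)).intervalIntegrable)
      obtain ⟨h5, h6⟩ := hmem t ht
      have h7 := (((hasDerivAt_ell hβ h5).rpow_const (p := A - B)
        (Or.inl (by linarith))).div_const (A - B))
      refine h7.congr_deriv ?_
      have : A - B ≠ 0 := by linarith
      rw [show A - 1 - B = A - B - 1 by ring]
      field_simp
    rw [sub_div, ← this]
    refine intervalIntegral.integral_congr fun t ht => ?_
    obtain ⟨h5, h6⟩ := hmem t ht
    rw [abs_neg, abs_of_nonneg (by positivity)]
    field_simp
  rw [hint1, hint2, hint3, abs_of_pos (inv_pos.2 hz0),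
    abs_of_pos (inv_pos.2 (by linarith : 0 < y))] at h1
  have e1 : ∑ n ∈ hq.between z y, (q n)⁻¹ = harmonicSum q y - harmonicSum q z := by
    rw [hq.harmonicSum_eq, hq.harmonicSum_eq, hq.sum_upTo hzy]
    simp only [one_div]; ring
  rw [e1] at h1
  have e2 : y * ell β y ^ (A - 1 - B) * y⁻¹ ≤ ell β z ^ (A - B) := by
    rw [mul_right_comm, mul_inv_cancel₀ (by linarith : y ≠ 0), one_mul]
    calc ell β y ^ (A - 1 - B) ≤ ell β z ^ (A - 1 - B) :=
          Real.rpow_le_rpow_of_nonpos (by linarith) hly (by linarith)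
      _ ≤ ell β z ^ (A - B) := Real.rpow_le_rpow_of_exponent_le hlz (by linarith)
  have e3 : z * ell β z ^ (A - 1 - B) * z⁻¹ ≤ ell β z ^ (A - B) := by
    rw [mul_right_comm, mul_inv_cancel₀ hz0.ne', one_mul]
    exact Real.rpow_le_rpow_of_exponent_le hlz (by linarith)
  have e4 : (ell β y ^ (A - B) - ell β z ^ (A - B)) / (A - B) ≤ (B - A)⁻¹ * ell β z ^ (A - B) := by
    have h0 : 0 ≤ ell β y ^ (A - B) := by have : 0 ≤ ell β y := by linarith
                                          positivity
    rw [← neg_div_neg_eq, neg_sub, neg_sub, div_eq_inv_mul]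
    gcongr
    linarith
  have e5 : harmonicSum q y - harmonicSum q z - (harmonicMain α β A y - harmonicMain α β A z) =
    (harmonicSum q y - harmonicMain α β A y) - (harmonicSum q z - harmonicMain α β A z) := by ring
  rw [e5] at h1
  refine h1.trans ?_
  rw [mul_assoc K]
  exact mul_le_mul_of_nonneg_left (by linarith) hK.le

lemma tendsto_ell_rpow_neg (hβ : 0 < β) {p : ℝ} (hp : p < 0) :
    Tendsto (fun t => ell β t ^ p) atTop (𝓝 0) := by
  have := (tendsto_rpow_neg_atTop (y := -p) (by linarith)).comp (tendsto_ell hβ)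
  simpa [Function.comp_def] using this

theorem WellBehaved.exists_harmonic_const (hq : WellBehaved q α β A B) (hβ : 0 < β)
    (hB : 0 < B) (hAB : A < B) : ∃ C K : ℝ, 0 < K ∧
      Tendsto (fun y => harmonicSum q y - harmonicMain α β A y) atTop (𝓝 C) ∧
      ∀ y : ℝ, 2 * (2 + β) ^ 2 ≤ y →
        |harmonicSum q y - harmonicMain α β A y - C| ≤ K * ell β y ^ (A - B) := by
  obtain ⟨K, hK, h⟩ := hq.exists_abs_harmonicSum_sub_le hβ hB hAB
  have hlim : Tendsto (fun y => K * ell β y ^ (A - B)) atTop (𝓝 0) := by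
    simpa using (tendsto_ell_rpow_neg hβ (show A - B < 0 by linarith)).const_mul K
  have hc : CauchySeq fun y => harmonicSum q y - harmonicMain α β A y := by
    rw [Metric.cauchySeq_iff']
    intro ε hε
    obtain ⟨z, hz1, hz2⟩ := ((hlim.eventually_lt_const hε).and
      (eventually_ge_atTop (2 * (2 + β) ^ 2))).exists
    exact ⟨z, fun y hy => lt_of_le_of_lt (h z y hz2 hy) hz1⟩
  obtain ⟨C, hC⟩ := cauchySeq_tendsto_of_complete hc
  refine ⟨C, K, hK, hC, fun z hz => ?_⟩
  have h1 := (hC.sub_const (harmonicSum q z - harmonicMain α β A z)).abs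
  have h2 := le_of_tendsto h1 (eventually_atTop.2 ⟨z, fun y hy => h z y hz hy⟩)
  rwa [abs_sub_comm] at h2

lemma WellBehaved.exists_count_le (hq : WellBehaved q α β A B) (hα : 0 < α) (hβ : 0 < β)
    (hB : 0 < B) : ∃ K : ℝ, 0 < K ∧ ∀ t, 2 * (2 + β) ^ 2 ≤ t →
      (count q t : ℝ) ≤ K * (t * ell β t ^ (A - 1)) := by
  obtain ⟨K, hK, h⟩ := hq.exists_abs_remainder_le hβ hB
  obtain ⟨C, hC, h'⟩ := exists_integral_ell_rpow_le hβ (A - 1)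
  refine ⟨α * C + K, by positivity, fun t ht => ?_⟩
  have h4 := four_le_threshold hβ
  have hl : 1 ≤ ell β t := one_le_ell hβ (by linarith)
  have h1 := (abs_le.1 (h t ht)).2
  have h2 := h' t (by linarith)
  have h3 : ell β t ^ (A - 1 - B) ≤ ell β t ^ (A - 1) :=
    Real.rpow_le_rpow_of_exponent_le hl (by linarith)
  have h5 : K * (t * ell β t ^ (A - 1 - B)) ≤ K * (t * ell β t ^ (A - 1)) := by
    have : 0 ≤ t := by linarith
    gcongr
  have h6 := mul_le_mul_of_nonneg_left h2 hα.le
  unfold remainder at h1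
  linarith

/-- A crude lower bound for the counting function, which suffices to bound `log n` from below in
terms of `log (q n)`. -/
lemma WellBehaved.exists_sqrt_le_count (hq : WellBehaved q α β A B) (hα : 0 < α) (hβ : 0 < β)
    (hA : 0 ≤ A) (hB : 0 < B) : ∀ᶠ t in atTop, √t ≤ (count q t : ℝ) := by
  obtain ⟨K, hK, h⟩ := hq.exists_abs_remainder_le hβ hB
  obtain ⟨C, hC, h'⟩ := exists_le_integral_ell_rpow hβ (A - 1)
  have hlim : Tendsto (fun t => K * ell β t ^ (-B)) atTop (𝓝 0) := by
    simpa using (tendsto_ell_rpow_neg hβ (show -B < 0 by linarith)).const_mul K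
  have hlog := (isLittleO_log_rpow_atTop (r := 1 / 2) (by norm_num)).bound
    (show 0 < α * C / 2 / (1 + |Real.log β|) by positivity)
  filter_upwards [hlog, hlim.eventually_lt_const (show 0 < α * C / 2 by positivity),
    eventually_ge_atTop (2 * (2 + β) ^ 2)] with t h1 h2 ht
  have h4 := four_le_threshold hβ
  have ht0 : 0 < t := by linarith
  have hl : 1 ≤ ell β t := one_le_ell hβ (by linarith)
  have hl0 : 0 < ell β t := by linarith
  have h5 := (abs_le.1 (h t ht)).1
  have h6 := mul_le_mul_of_nonneg_left (h' t ht) hα.le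
  have h7 : ell β t ^ (A - 1 - B) = ell β t ^ (A - 1) * ell β t ^ (-B) := by
    rw [← Real.rpow_add hl0]; ring_nf
  have h8 : α * C / 2 * (t * ell β t ^ (A - 1)) ≤ count q t := by
    unfold remainder at h5
    rw [h7] at h5
    have h9 : 0 < t * ell β t ^ (A - 1) := by positivity
    nlinarith
  refine le_trans ?_ h8
  have h9 : ell β t ≤ α * C / 2 * √t := by
    have h10 := ell_le_mul_log hβ (show (2 + β) ^ 2 ≤ t by linarith)
    rw [Real.norm_of_nonneg (Real.log_nonneg (by linarith)),
      Real.norm_of_nonneg (by positivity), ← Real.sqrt_eq_rpow] at h1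
    calc ell β t ≤ (1 + |Real.log β|) * Real.log t := h10
      _ ≤ (1 + |Real.log β|) * (α * C / 2 / (1 + |Real.log β|) * √t) := by gcongr
      _ = _ := by field_simp
  have h10 : ell β t ^ (-1 : ℝ) ≤ ell β t ^ (A - 1) :=
    Real.rpow_le_rpow_of_exponent_le hl (by linarith)
  rw [Real.rpow_neg_one] at h10
  have h11 : √t * √t = t := Real.mul_self_sqrt ht0.le
  calc √t = √t * (ell β t * (ell β t)⁻¹) := by rw [mul_inv_cancel₀ hl0.ne', mul_one]
    _ ≤ √t * ((α * C / 2 * √t) * ell β t ^ (A - 1)) := by gcongr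
    _ = α * C / 2 * ((√t * √t) * ell β t ^ (A - 1)) := by ring
    _ = _ := by rw [h11]

/-- If `q n > √s` then `log n ≥ (log s) / 4`, for all sufficiently large `s`. -/
lemma WellBehaved.eventually_log_le_log_index (hq : WellBehaved q α β A B) (hα : 0 < α)
    (hβ : 0 < β) (hA : 0 ≤ A) (hB : 0 < B) :
    ∀ᶠ s in atTop, ∀ n : ℕ+, √s < q n → 2 ≤ n ∧ Real.log s / 4 ≤ Real.log (n : ℕ) := by
  have h1 := Real.tendsto_sqrt_atTop.eventually (hq.exists_sqrt_le_count hα hβ hA hB)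
  filter_upwards [h1, eventually_ge_atTop 16] with s h2 hs n hn
  have hcard : count q (√s) < (n : ℕ) := by
    -- all indices with `q m ≤ √s` are smaller than `n`
    have hsub : idx q (√s) ⊆ Set.Iio n := fun m hm => by
      by_contra h3
      exact absurd (le_trans (hq.mono (not_lt.1 h3)) hm) (not_le.2 hn)
    have h3 := Set.ncard_le_ncard hsub (Set.toFinite _)
    have h4 : (Set.Iio n).ncard = (n : ℕ) - 1 := by
      have : (Set.Iio n) = ((Finset.Ico 1 n : Finset ℕ+) : Set ℕ+) := by
        ext m; simp
      rw [this, Set.ncard_coe_finset, PNat.card_Ico]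
      rfl
    have := n.pos
    unfold count
    omega
  have hs4 : 2 ≤ √(√s) := by
    rw [Real.le_sqrt (by norm_num) (by positivity), Real.le_sqrt (by norm_num) (by linarith)]
    norm_num; linarith
  have h3 : √(√s) < (n : ℕ) := lt_of_le_of_lt h2 (by exact_mod_cast hcard)
  refine ⟨?_, ?_⟩
  · have h4 : (2 : ℝ) < (n : ℕ) := lt_of_le_of_lt hs4 h3
    have h5 : 2 < (n : ℕ) := by exact_mod_cast h4
    exact_mod_cast h5.le
  · have h4 : Real.log (√(√s)) = Real.log s / 4 := by
      rw [Real.log_sqrt (by positivity), Real.log_sqrt (by linarith)]; ring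
    rw [← h4]
    exact Real.log_le_log (by linarith) h3.le

end

section

variable {β : ℝ} {q : ℕ+ → ℝ} {α A B : ℝ}

/-! ### The integral `η` -/

/-- The function `f_𝕐` in terms of the cumulant generating function `g` of `𝕐`. -/
def fOf (g : ℝ → ℝ) (u : ℝ) : ℝ := if u < 1 then g u else g u - u

/-- The constant `η_𝕐` in terms of the cumulant generating function `g` of `𝕐`. -/
def etaOf (g : ℝ → ℝ) : ℝ := ∫ u in Set.Ioi (0 : ℝ), fOf g u / u ^ 2

lemma hasDerivAt_neg_inv_one_add_log {u : ℝ} (hu : 1 ≤ u) :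
    HasDerivAt (fun u => -(1 + Real.log u)⁻¹) (1 / (u * (1 + Real.log u) ^ 2)) u := by
  have hl : 0 ≤ Real.log u := Real.log_nonneg hu
  have hu0 : 0 < u := by linarith
  have h1 := (((Real.hasDerivAt_log hu0.ne').const_add 1).fun_inv
    (by positivity : 1 + Real.log u ≠ 0)).fun_neg
  refine h1.congr_deriv ?_
  field_simp

lemma tendsto_neg_inv_one_add_log :
    Tendsto (fun u => -(1 + Real.log u)⁻¹) atTop (𝓝 0) := by
  have := (tendsto_inv_atTop_zero.comp
    (tendsto_atTop_add_const_left _ (1 : ℝ) Real.tendsto_log_atTop)).neg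
  simpa [Function.comp_def] using this

lemma integrableOn_one_div_mul_log_sq {a : ℝ} (ha : 1 ≤ a) :
    IntegrableOn (fun u => 1 / (u * (1 + Real.log u) ^ 2)) (Set.Ioi a) :=
  integrableOn_Ioi_deriv_of_nonneg'
    (fun u hu => hasDerivAt_neg_inv_one_add_log (ha.trans (Set.mem_Ici.1 hu)))
    (fun u hu => by
      have : 0 < u := by linarith [Set.mem_Ioi.1 hu]
      positivity) tendsto_neg_inv_one_add_log

lemma integral_one_div_mul_log_sq {a : ℝ} (ha : 1 ≤ a) :
    ∫ u in Set.Ioi a, 1 / (u * (1 + Real.log u) ^ 2) = (1 + Real.log a)⁻¹ := by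
  rw [integral_Ioi_of_hasDerivAt_of_nonneg'
    (fun u hu => hasDerivAt_neg_inv_one_add_log (ha.trans (Set.mem_Ici.1 hu)))
    (fun u hu => by
      have : 0 < u := by linarith [Set.mem_Ioi.1 hu]
      positivity) tendsto_neg_inv_one_add_log]
  ring

section Family

variable {K₁ : ℝ} {g : ℕ+ → ℝ → ℝ} {g₀ g₀' : ℝ → ℝ}

lemma CgfFamily.continuous (h : CgfFamily K₁ g g₀ g₀') : Continuous g₀ :=
  continuous_iff_continuousAt.2 fun u => (h.hasDerivAt u).continuousAt

lemma CgfFamily.const_nonneg (h : CgfFamily K₁ g g₀ g₀') : 0 ≤ K₁ :=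
  (abs_nonneg _).trans (h.abs_deriv_le 0)

lemma CgfFamily.abs_fOf_div_le_small (h : CgfFamily K₁ g g₀ g₀') {u : ℝ} (hu : 0 < u)
    (hu1 : u < 1) : |fOf g₀ u / u ^ 2| ≤ K₁ := by
  rw [fOf, if_pos hu1, abs_div, abs_of_pos (by positivity : 0 < u ^ 2), div_le_iff₀ (by positivity)]
  exact h.small_limit u hu.le hu1.le

lemma CgfFamily.abs_fOf_div_le_large (h : CgfFamily K₁ g g₀ g₀') {u : ℝ} (hu1 : 1 ≤ u) :
    |fOf g₀ u / u ^ 2| ≤ K₁ * (1 / (u * (1 + Real.log u) ^ 2)) := by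
  have hu : 0 < u := by linarith
  have hl : 0 ≤ Real.log u := Real.log_nonneg hu1
  rw [fOf, if_neg (not_lt.2 hu1), abs_div, abs_of_pos (by positivity : 0 < u ^ 2),
    div_le_iff₀ (by positivity)]
  refine (h.large_limit u hu1).trans (le_of_eq ?_)
  field_simp

lemma CgfFamily.measurable_fOf_div (h : CgfFamily K₁ g g₀ g₀') :
    Measurable fun u => fOf g₀ u / u ^ 2 := by
  have h1 : Measurable (fOf g₀) := Measurable.ite measurableSet_Iio h.continuous.measurable
    (h.continuous.measurable.sub measurable_id)
  exact h1.div (measurable_id.pow_const 2)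

lemma CgfFamily.integrableOn_large (h : CgfFamily K₁ g g₀ g₀') {a : ℝ} (ha : 1 ≤ a) :
    IntegrableOn (fun u => fOf g₀ u / u ^ 2) (Set.Ioi a) := by
  refine Integrable.mono' ((integrableOn_one_div_mul_log_sq ha).const_mul K₁)
    h.measurable_fOf_div.aestronglyMeasurable ?_
  refine (ae_restrict_mem measurableSet_Ioi).mono fun u hu => ?_
  exact h.abs_fOf_div_le_large (ha.trans (Set.mem_Ioi.1 hu).le)

lemma CgfFamily.integrableOn_small (h : CgfFamily K₁ g g₀ g₀') {a : ℝ} (ha : a ≤ 1) :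
    IntegrableOn (fun u => fOf g₀ u / u ^ 2) (Set.Ioc 0 a) := by
  rw [integrableOn_Ioc_iff_integrableOn_Ioo]
  refine Measure.integrableOn_of_bounded (M := K₁) (by simp)
    h.measurable_fOf_div.aestronglyMeasurable ?_
  refine (ae_restrict_mem measurableSet_Ioo).mono fun u hu => ?_
  exact h.abs_fOf_div_le_small hu.1 (hu.2.trans_le ha)

theorem CgfFamily.integrableOn (h : CgfFamily K₁ g g₀ g₀') :
    IntegrableOn (fun u => fOf g₀ u / u ^ 2) (Set.Ioi 0) := by
  rw [← Set.Ioc_union_Ioi_eq_Ioi (zero_le_one' ℝ)]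
  exact (h.integrableOn_small le_rfl).union (h.integrableOn_large le_rfl)

lemma CgfFamily.abs_integral_large_le (h : CgfFamily K₁ g g₀ g₀') {a : ℝ} (ha : 1 ≤ a) :
    |∫ u in Set.Ioi a, fOf g₀ u / u ^ 2| ≤ K₁ * (1 + Real.log a)⁻¹ := by
  rw [← integral_one_div_mul_log_sq ha, ← integral_const_mul, ← Real.norm_eq_abs]
  refine norm_integral_le_of_norm_le ((integrableOn_one_div_mul_log_sq ha).const_mul K₁) ?_
  refine (ae_restrict_mem measurableSet_Ioi).mono fun u hu => ?_
  exact h.abs_fOf_div_le_large (ha.trans (Set.mem_Ioi.1 hu).le)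

lemma CgfFamily.abs_integral_small_le (h : CgfFamily K₁ g g₀ g₀') {a : ℝ} (ha0 : 0 ≤ a)
    (ha : a ≤ 1) : |∫ u in Set.Ioc 0 a, fOf g₀ u / u ^ 2| ≤ K₁ * a := by
  rw [integral_Ioc_eq_integral_Ioo, ← Real.norm_eq_abs]
  refine (norm_setIntegral_le_of_norm_le_const (C := K₁) (by simp) fun u hu => ?_).trans ?_
  · exact h.abs_fOf_div_le_small hu.1 (hu.2.trans_le ha)
  · simp [ha0]

lemma CgfFamily.abs_etaOf_le (h : CgfFamily K₁ g g₀ g₀') : |etaOf g₀| ≤ 2 * K₁ := by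
  rw [etaOf, ← Set.Ioc_union_Ioi_eq_Ioi (zero_le_one' ℝ),
    setIntegral_union (Set.Ioc_disjoint_Ioi le_rfl) measurableSet_Ioi
      (h.integrableOn_small le_rfl) (h.integrableOn_large le_rfl)]
  have h1 := h.abs_integral_small_le zero_le_one le_rfl
  have h2 := h.abs_integral_large_le le_rfl
  simp only [Real.log_one, add_zero, inv_one, mul_one] at h1 h2
  linarith [abs_add_le (∫ u in Set.Ioc 0 1, fOf g₀ u / u ^ 2) (∫ u in Set.Ioi 1, fOf g₀ u / u ^ 2)]

lemma integral_comp_const_div {φ : ℝ → ℝ} (hφ : Continuous φ) {s a b : ℝ} (hs : 0 < s)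
    (ha : 0 < a) (hab : a ≤ b) :
    ∫ t in a..b, φ (s / t) = s * ∫ u in (s / b)..(s / a), φ u / u ^ 2 := by
  have hpos : ∀ t ∈ Set.uIcc a b, 0 < t := fun t ht => by
    rw [Set.uIcc_of_le hab] at ht; linarith [ht.1]
  have h1 := intervalIntegral.integral_comp_mul_deriv' (a := a) (b := b) (f := fun t => s / t)
    (f' := fun t => -(s / t ^ 2)) (g := fun u => φ u / u ^ 2)
    (fun t ht => by
      have h0 := hpos t ht
      refine ((hasDerivAt_inv h0.ne').const_mul s).congr_deriv ?_
      field_simp)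
    (ContinuousOn.neg (continuousOn_const.div (continuousOn_pow 2) fun t ht => by
      have h0 := hpos t ht
      positivity))
    (hφ.continuousOn.div (continuousOn_pow 2) fun u hu => by
      obtain ⟨t, ht, rfl⟩ := hu
      have h0 := hpos t ht
      have : 0 < s / t := by positivity
      positivity)
  rw [intervalIntegral.integral_symm (s / a), ← h1, ← intervalIntegral.integral_neg,
    ← intervalIntegral.integral_const_mul]
  refine intervalIntegral.integral_congr fun t ht => ?_
  have h0 := hpos t ht
  simp only [Function.comp]
  field_simp

/-- The part of `η` seen by the `q n` with `√s < q n ≤ Q`. -/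
lemma CgfFamily.abs_integrals_sub_eta_le (h : CgfFamily K₁ g g₀ g₀') {s Q : ℝ} (hs : 1 ≤ s)
    (hQ : s ≤ Q) :
    |(∫ t in (√s)..s, (g₀ (s / t) - s / t)) + (∫ t in s..Q, g₀ (s / t)) - s * etaOf g₀| ≤
      K₁ * (s * (1 + Real.log (√s))⁻¹ + s * (s / Q)) := by
  have hs0 : 0 < s := by linarith
  have hr : 1 ≤ √s := Real.one_le_sqrt.2 hs
  have hr0 : 0 < √s := by linarith
  have hrs : √s ≤ s := by nlinarith [Real.mul_self_sqrt hs0.le]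
  have hsQ : s / Q ≤ 1 := (div_le_one (by linarith)).2 hQ
  have hsQ0 : 0 < s / Q := div_pos hs0 (by linarith)
  have h1 := integral_comp_const_div (φ := fun u => g₀ u - u) (h.continuous.sub continuous_id)
    hs0 hr0 hrs
  have h2 := integral_comp_const_div h.continuous hs0 hs0 hQ
  rw [div_self hs0.ne', Real.div_sqrt] at h1
  rw [div_self hs0.ne'] at h2
  rw [h1, h2]
  have e1 : ∫ u in (1 : ℝ)..(√s), (g₀ u - u) / u ^ 2 = ∫ u in Set.Ioc 1 (√s), fOf g₀ u / u ^ 2 := by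
    rw [intervalIntegral.integral_of_le hr]
    refine setIntegral_congr_fun measurableSet_Ioc fun u hu => ?_
    simp only [fOf, if_neg (not_lt.2 hu.1.le)]
  have e2 : ∫ u in (s / Q)..(1 : ℝ), g₀ u / u ^ 2 = ∫ u in Set.Ioc (s / Q) 1, fOf g₀ u / u ^ 2 := by
    rw [intervalIntegral.integral_of_le hsQ, integral_Ioc_eq_integral_Ioo,
      integral_Ioc_eq_integral_Ioo]
    refine setIntegral_congr_fun measurableSet_Ioo fun u hu => ?_
    simp only [fOf, if_pos hu.2]
  have hi := h.integrableOn
  have e3 : etaOf g₀ = (∫ u in Set.Ioc 0 (s / Q), fOf g₀ u / u ^ 2) +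
      (∫ u in Set.Ioc (s / Q) 1, fOf g₀ u / u ^ 2) +
      (∫ u in Set.Ioc 1 (√s), fOf g₀ u / u ^ 2) + ∫ u in Set.Ioi (√s), fOf g₀ u / u ^ 2 := by
    rw [etaOf, ← Set.Ioc_union_Ioi_eq_Ioi (zero_le_one' ℝ),
      setIntegral_union (Set.Ioc_disjoint_Ioi le_rfl) measurableSet_Ioi
        (h.integrableOn_small le_rfl) (h.integrableOn_large le_rfl),
      ← Set.Ioc_union_Ioi_eq_Ioi hr,
      setIntegral_union (Set.Ioc_disjoint_Ioi le_rfl) measurableSet_Ioi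
        ((h.integrableOn_large le_rfl).mono_set Set.Ioc_subset_Ioi_self)
        (h.integrableOn_large hr),
      ← Set.Ioc_union_Ioc_eq_Ioc hsQ0.le hsQ,
      setIntegral_union (Set.Ioc_disjoint_Ioc_of_le le_rfl) measurableSet_Ioc
        (h.integrableOn_small hsQ)
        (hi.mono_set (Set.Ioc_subset_Ioi_self.trans (Set.Ioi_subset_Ioi hsQ0.le)))]
    ring
  have h3 := h.abs_integral_small_le hsQ0.le hsQ
  have h4 := h.abs_integral_large_le hr
  rw [e1, e2, e3]
  have e4 : ∀ a b c d : ℝ, s * c + s * b - s * (a + b + c + d) = -(s * (a + d)) := by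
    intros; ring
  rw [e4, abs_neg, abs_mul, abs_of_pos hs0]
  have h5 := abs_add_le (∫ u in Set.Ioc 0 (s / Q), fOf g₀ u / u ^ 2)
    (∫ u in Set.Ioi (√s), fOf g₀ u / u ^ 2)
  calc _ ≤ s * (K₁ * (s / Q) + K₁ * (1 + Real.log (√s))⁻¹) := by gcongr; linarith
    _ = _ := by ring

end Family

end

section

variable {β : ℝ} {q : ℕ+ → ℝ} {α A B : ℝ}

/-! ### The cumulant generating function of the weighted sum -/

/-- Elementary comparisons between `s`, `√s` and their logarithms, valid for large `s`. -/
structure LargeScale (β s : ℝ) : Prop where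
  threshold_le : 2 * (2 + β) ^ 2 ≤ √s
  sqrt_le : √s ≤ s
  one_le_log_ell : 1 ≤ Real.log (ell β s)
  quarter_le : ell β s / 4 ≤ ell β (√s)
  half_le_log : ell β s / 2 ≤ Real.log s
  log_le : Real.log s ≤ 2 * ell β s

lemma eventually_largeScale (hβ : 0 < β) : ∀ᶠ s in atTop, LargeScale β s := by
  have h4 := four_le_threshold hβ
  filter_upwards [Real.tendsto_sqrt_atTop.eventually_ge_atTop (2 * (2 + β) ^ 2),
    (Real.tendsto_log_atTop.comp (tendsto_ell hβ)).eventually_ge_atTop 1,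
    Real.tendsto_log_atTop.eventually_ge_atTop (4 * |Real.log β|), eventually_ge_atTop 1]
    with s h1 h2 h3 h5
  have hs0 : 0 < s := by linarith
  have h6 := le_abs_self (Real.log β)
  have h7 := neg_abs_le (Real.log β)
  have h8 := abs_nonneg (Real.log β)
  have e1 := ell_eq hβ hs0
  have e2 := ell_eq hβ (show 0 < √s by positivity)
  rw [Real.log_sqrt hs0.le] at e2
  refine ⟨h1, ?_, h2, ?_, ?_, ?_⟩
  · nlinarith [Real.mul_self_sqrt hs0.le, Real.one_le_sqrt.2 h5]
  all_goals linarith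

lemma LargeScale.sqrt_pos (hβ : 0 < β) {s : ℝ} (h : LargeScale β s) : 0 < √s := by
  linarith [four_le_threshold hβ, h.threshold_le]

lemma LargeScale.pos (hβ : 0 < β) {s : ℝ} (h : LargeScale β s) : 0 < s := by
  linarith [h.sqrt_pos hβ, h.sqrt_le]

lemma LargeScale.threshold_le_self {s : ℝ} (h : LargeScale β s) : 2 * (2 + β) ^ 2 ≤ s :=
  h.threshold_le.trans h.sqrt_le

lemma LargeScale.one_le_ell (hβ : 0 < β) {s : ℝ} (h : LargeScale β s) : 1 ≤ ell β s :=
  LargeDev.one_le_ell hβ (by linarith [four_le_threshold hβ, h.threshold_le_self])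

lemma integral_tail_kernel_le {s Q : ℝ} (hs : 0 < s) (hQ : s ≤ Q) :
    ∫ t in s..Q, (s / t) ^ 2 * Real.exp (Real.log (t / s) / 2) ≤ 2 * s := by
  have hpos : ∀ t ∈ Set.uIcc s Q, 0 < t := fun t ht => by
    rw [Set.uIcc_of_le hQ] at ht; linarith [ht.1]
  have h1 : ∫ t in s..Q, (s / t) ^ 2 * Real.exp (Real.log (t / s) / 2) =
      ∫ t in s..Q, s ^ (3 / 2 : ℝ) * t ^ (-(3 / 2) : ℝ) := by
    refine intervalIntegral.integral_congr fun t ht => ?_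
    have h0 := hpos t ht
    have e1 : (s / t) ^ 2 = Real.exp (2 * (Real.log s - Real.log t)) := by
      rw [two_mul, Real.exp_add, ← Real.log_div hs.ne' h0.ne', Real.exp_log (by positivity)]; ring
    rw [e1, ← Real.exp_add, Real.rpow_def_of_pos hs, Real.rpow_def_of_pos h0, ← Real.exp_add,
      Real.log_div h0.ne' hs.ne']
    congr 1; ring
  rw [h1, intervalIntegral.integral_const_mul, integral_rpow]
  · have hQ0 : 0 < Q := by linarith
    have e2 : s ^ (3 / 2 : ℝ) * s ^ (-(3 / 2) + 1 : ℝ) = s := by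
      rw [← Real.rpow_add hs]; norm_num
    have e3 : 0 ≤ Q ^ (-(3 / 2) + 1 : ℝ) := by positivity
    have e4 : 0 < s ^ (3 / 2 : ℝ) := by positivity
    have e5 : (Q ^ (-(3 / 2) + 1 : ℝ) - s ^ (-(3 / 2) + 1 : ℝ)) / (-(3 / 2) + 1 : ℝ) =
      2 * s ^ (-(3 / 2) + 1 : ℝ) - 2 * Q ^ (-(3 / 2) + 1 : ℝ) := by ring
    rw [e5]
    nlinarith
  · right
    refine ⟨by norm_num, fun h => ?_⟩
    exact lt_irrefl _ (hpos 0 h)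

lemma continuousOn_tail_kernel {s Q : ℝ} (hs : 0 < s) (hQ : s ≤ Q) :
    ContinuousOn (fun t => (s / t) ^ 2 * Real.exp (Real.log (t / s) / 2)) (Set.uIcc s Q) := by
  have hpos : ∀ t ∈ Set.uIcc s Q, 0 < t := fun t ht => by
    rw [Set.uIcc_of_le hQ] at ht; linarith [ht.1]
  refine ContinuousOn.mul ((continuousOn_const.div continuousOn_id
    fun t ht => (hpos t ht).ne').pow 2) (Real.continuous_exp.comp_continuousOn
    (((continuousOn_id.div_const s).log fun t ht => ?_).div_const 2))
  have := hpos t ht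
  exact (div_pos this hs).ne'

lemma abs_ell_sub_of_le (hβ : 0 < β) {s t : ℝ} (hs : 0 < s) (h : s ≤ t) :
    |ell β t - ell β s| = Real.log (t / s) ∧ 0 ≤ Real.log (t / s) := by
  have h0 : 0 ≤ Real.log (t / s) := Real.log_nonneg ((one_le_div hs).2 h)
  rw [ell_sub hβ hs (by linarith), abs_of_nonneg h0]
  exact ⟨rfl, h0⟩

lemma exists_integral_sq_mul_ell_le (hβ : 0 < β) (p : ℝ) : ∃ C : ℝ, 0 < C ∧ ∀ s Q : ℝ,
    (2 + β) ^ 2 ≤ s → s ≤ Q → ∫ t in s..Q, (s / t) ^ 2 * ell β t ^ p ≤ C * (s * ell β s ^ p) := by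
  obtain ⟨C, hC, h⟩ := exists_rpow_le_mul_exp p
  refine ⟨2 * C, by positivity, fun s Q hs hQ => ?_⟩
  have h4 := four_le_threshold hβ
  have hs0 : 0 < s := by linarith
  have hl := one_le_ell hβ hs
  have hmem : ∀ t ∈ Set.uIcc s Q, s ≤ t := fun t ht => by
    rw [Set.uIcc_of_le hQ] at ht; exact ht.1
  calc ∫ t in s..Q, (s / t) ^ 2 * ell β t ^ p
      ≤ ∫ t in s..Q, C * ell β s ^ p * ((s / t) ^ 2 * Real.exp (Real.log (t / s) / 2)) := by
        refine intervalIntegral.integral_mono_on hQ (ContinuousOn.intervalIntegrable ?_)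
          (((continuousOn_tail_kernel hs0 hQ).intervalIntegrable).const_mul _) fun t ht => ?_
        · exact ContinuousOn.mul ((continuousOn_const.div continuousOn_id
            fun t ht => (hs0.trans_le (hmem t ht)).ne').pow 2)
            ((continuousOn_ell_rpow hβ p).mono fun t ht => hs.trans (hmem t ht))
        · have h1 := h (ell β t) (ell β s) (one_le_ell hβ (hs.trans ht.1)) hl
          obtain ⟨h2, h3⟩ := abs_ell_sub_of_le hβ hs0 ht.1
          rw [h2] at h1
          have h5 : Real.exp (Real.log (t / s) / 4) ≤ Real.exp (Real.log (t / s) / 2) :=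
            Real.exp_le_exp.2 (by linarith)
          calc (s / t) ^ 2 * ell β t ^ p ≤
                (s / t) ^ 2 * (C * ell β s ^ p * Real.exp (Real.log (t / s) / 2)) := by
                gcongr
                exact h1.trans (by gcongr)
            _ = _ := by ring
    _ ≤ C * ell β s ^ p * (2 * s) := by
        rw [intervalIntegral.integral_const_mul]
        gcongr
        exact integral_tail_kernel_le hs0 hQ
    _ = _ := by ring

/-- A crude upper bound for `H`, uniform in the cases `A = 0` and `A > 0`. The factor
`log (ell β s)` is only needed for `A = 0`. -/
lemma WellBehaved.exists_harmonicSum_le (hq : WellBehaved q α β A B) (hα : 0 < α) (hβ : 0 < β)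
    (hA : 0 ≤ A) (hB : 0 < B) (hAB : A < B) : ∃ K : ℝ, 0 < K ∧ ∀ s, LargeScale β s →
      harmonicSum q s ≤ K * (ell β s ^ A * Real.log (ell β s)) := by
  obtain ⟨C, K, hK, -, h⟩ := hq.exists_harmonic_const hβ hB hAB
  have hα1 : 0 ≤ α / A := by positivity
  refine ⟨α + α / A + |C| + K, by positivity, fun s hs => ?_⟩
  have h1 := (abs_le.1 (h s hs.threshold_le_self)).2
  have hl := hs.one_le_ell hβ
  have hll := hs.one_le_log_ell
  have hp : 1 ≤ ell β s ^ A := Real.one_le_rpow hl hA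
  have hpl : 1 ≤ ell β s ^ A * Real.log (ell β s) := by nlinarith
  have h2 : ell β s ^ (A - B) ≤ 1 := Real.rpow_le_one_of_one_le_of_nonpos hl (by linarith)
  have h3 : harmonicMain α β A s ≤ (α + α / A) * (ell β s ^ A * Real.log (ell β s)) := by
    rw [harmonicMain_eq, mainFun]
    split_ifs with h0
    · subst h0
      simp
    · have : α / A * ell β s ^ A ≤ α / A * (ell β s ^ A * Real.log (ell β s)) := by
        gcongr
        nlinarith
      have : 0 ≤ α * (ell β s ^ A * Real.log (ell β s)) := by positivity
      linarith
  have h5 : K * ell β s ^ (A - B) ≤ K * (ell β s ^ A * Real.log (ell β s)) := by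
    gcongr; linarith
  have h6 : C ≤ |C| * (ell β s ^ A * Real.log (ell β s)) := by
    nlinarith [le_abs_self C, abs_nonneg C]
  nlinarith

section Pieces

variable {K₁ : ℝ}

lemma ell_rpow_two_split (hβ : 0 < β) {s : ℝ} (h : LargeScale β s) :
    ell β s ^ A * Real.log (ell β s) / ell β s ^ 2 =
      ell β s ^ (A - 1) * (Real.log (ell β s) / ell β s) := by
  have hl : 0 < ell β s := by linarith [h.one_le_ell hβ]
  rw [Real.rpow_sub_one hl.ne']
  field_simp

/-- The `q n ≤ √s` contribute little to the sum of the `g n (s / q n) - s / q n`, as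
`log (s / q n)` is at least of order `log s` there. -/
lemma WellBehaved.exists_sum_small_le (hq : WellBehaved q α β A B) (hα : 0 < α) (hβ : 0 < β)
    (hA : 0 ≤ A) (hB : 0 < B) (hAB : A < B) (hK₁ : 0 ≤ K₁) : ∃ K : ℝ, 0 < K ∧ ∀ s,
      LargeScale β s → ∀ (g : ℕ+ → ℝ → ℝ) (g₀ g₀' : ℝ → ℝ), CgfFamily K₁ g g₀ g₀' →
      |∑ n ∈ hq.upTo (√s), (g n (s / q n) - s / q n)| ≤
        K * (s * (ell β s ^ (A - 1) * (Real.log (ell β s) / ell β s))) := by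
  obtain ⟨K, hK, hH⟩ := hq.exists_harmonicSum_le hα hβ hA hB hAB
  refine ⟨K₁ * 16 * K + 1, by positivity, fun s hs g g₀ g₀' hg => ?_⟩
  have hs0 := hs.pos hβ
  have hr0 := hs.sqrt_pos hβ
  have hl := hs.one_le_ell hβ
  have hll := hs.one_le_log_ell
  have h1 : ∀ n ∈ hq.upTo (√s), |g n (s / q n) - s / q n| ≤
      K₁ * 16 / ell β s ^ 2 * s * (1 / q n) := by
    intro n hn
    have hqn := hq.pos n
    have h2 : √s ≤ s / q n := by
      rw [le_div_iff₀ hqn]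
      calc √s * q n ≤ √s * √s := by gcongr; exact hq.mem_upTo.1 hn
        _ = s := Real.mul_self_sqrt hs0.le
    have h3 : 1 ≤ s / q n := by
      linarith [hs.threshold_le, four_le_threshold hβ]
    have h5 : ell β s / 4 ≤ 1 + Real.log (s / q n) := by
      have h6 := Real.log_le_log hr0 h2
      rw [Real.log_sqrt hs0.le] at h6
      linarith [hs.half_le_log]
    calc |g n (s / q n) - s / q n| ≤ K₁ * (s / q n / (1 + Real.log (s / q n)) ^ 2) :=
          hg.large n _ h3
      _ ≤ K₁ * (s / q n / (ell β s / 4) ^ 2) := by gcongr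
      _ = _ := by field_simp; ring
  calc _ ≤ ∑ n ∈ hq.upTo (√s), |g n (s / q n) - s / q n| := Finset.abs_sum_le_sum_abs _ _
    _ ≤ ∑ n ∈ hq.upTo (√s), K₁ * 16 / ell β s ^ 2 * s * (1 / q n) := Finset.sum_le_sum h1
    _ = K₁ * 16 / ell β s ^ 2 * s * harmonicSum q (√s) := by
        rw [← Finset.mul_sum, hq.harmonicSum_eq]
    _ ≤ K₁ * 16 / ell β s ^ 2 * s * (K * (ell β s ^ A * Real.log (ell β s))) := by
        gcongr
        exact (hq.harmonicSum_mono hs.sqrt_le).trans (hH s hs)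
    _ = K₁ * 16 * K * (s * (ell β s ^ A * Real.log (ell β s) / ell β s ^ 2)) := by ring
    _ ≤ _ := by
        rw [ell_rpow_two_split hβ hs]
        gcongr
        linarith

lemma inv_log_sq_le (hβ : 0 < β) {s : ℝ} (hs : LargeScale β s) {n : ℕ+}
    (hn : Real.log s / 4 ≤ Real.log (n : ℕ)) : 1 / Real.log (n : ℕ) ^ 2 ≤ 64 / ell β s ^ 2 := by
  have hl := hs.one_le_ell hβ
  have h1 : ell β s / 8 ≤ Real.log (n : ℕ) := by linarith [hs.half_le_log]
  have h2 : 0 < ell β s / 8 := by linarith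
  calc 1 / Real.log (n : ℕ) ^ 2 ≤ 1 / (ell β s / 8) ^ 2 := by gcongr
    _ = _ := by field_simp; norm_num

/-- Replacing `Y n` by `𝕐` for `√s < q n ≤ s`: here `log n` is of order at least `log s`. -/
lemma WellBehaved.exists_sum_middle_le (hq : WellBehaved q α β A B) (hα : 0 < α) (hβ : 0 < β)
    (hA : 0 ≤ A) (hB : 0 < B) (hAB : A < B) (hK₁ : 0 ≤ K₁) : ∃ K : ℝ, 0 < K ∧ ∀ᶠ s in atTop,
      ∀ (g : ℕ+ → ℝ → ℝ) (g₀ g₀' : ℝ → ℝ), CgfFamily K₁ g g₀ g₀' →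
      |∑ n ∈ hq.between (√s) s, (g n (s / q n) - g₀ (s / q n))| ≤
        K * (s * (ell β s ^ (A - 1) * (Real.log (ell β s) / ell β s))) := by
  obtain ⟨K, hK, hH⟩ := hq.exists_harmonicSum_le hα hβ hA hB hAB
  refine ⟨K₁ * 64 * K + 1, by positivity, ?_⟩
  filter_upwards [eventually_largeScale hβ, hq.eventually_log_le_log_index hα hβ hA hB]
    with s hs hidx g g₀ g₀' hg
  have hs0 := hs.pos hβ
  have hl := hs.one_le_ell hβ
  have hll := hs.one_le_log_ell
  have h1 : ∀ n ∈ hq.between (√s) s, |g n (s / q n) - g₀ (s / q n)| ≤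
      K₁ * 64 / ell β s ^ 2 * s * (1 / q n) := by
    intro n hn
    have hqn := hq.pos n
    obtain ⟨h2, h3⟩ := hidx n (hq.mem_between.1 hn).1
    calc |g n (s / q n) - g₀ (s / q n)| ≤ K₁ * (s / q n / Real.log (n : ℕ) ^ 2) :=
          hg.close n h2 _ (by positivity)
      _ = K₁ * (s / q n * (1 / Real.log (n : ℕ) ^ 2)) := by ring
      _ ≤ K₁ * (s / q n * (64 / ell β s ^ 2)) := by
          have := inv_log_sq_le hβ hs h3
          gcongr
      _ = _ := by ring
  calc _ ≤ ∑ n ∈ hq.between (√s) s, |g n (s / q n) - g₀ (s / q n)| := Finset.abs_sum_le_sum_abs _ _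
    _ ≤ ∑ n ∈ hq.between (√s) s, K₁ * 64 / ell β s ^ 2 * s * (1 / q n) := Finset.sum_le_sum h1
    _ = K₁ * 64 / ell β s ^ 2 * s * ∑ n ∈ hq.between (√s) s, 1 / q n := by
        rw [← Finset.mul_sum]
    _ ≤ K₁ * 64 / ell β s ^ 2 * s * (K * (ell β s ^ A * Real.log (ell β s))) := by
        gcongr
        refine le_trans ?_ (hH s hs)
        rw [hq.harmonicSum_eq, hq.sum_upTo hs.sqrt_le]
        have : 0 ≤ ∑ n ∈ hq.upTo (√s), 1 / q n :=
          Finset.sum_nonneg fun n _ => by have := hq.pos n; positivity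
        linarith
    _ = K₁ * 64 * K * (s * (ell β s ^ A * Real.log (ell β s) / ell β s ^ 2)) := by ring
    _ ≤ _ := by
        rw [ell_rpow_two_split hβ hs]
        gcongr
        linarith

lemma hasDerivAt_comp_const_div {φ φ' : ℝ → ℝ} (hφ : ∀ u, HasDerivAt φ (φ' u) u) {s t : ℝ}
    (ht : t ≠ 0) : HasDerivAt (fun t => φ (s / t)) (φ' (s / t) * (-(s / t ^ 2))) t := by
  refine (hφ (s / t)).comp t (h := fun t => s / t) (((hasDerivAt_inv ht).const_mul s).congr_deriv ?_)
  field_simp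

lemma continuousOn_deriv_comp_const_div {φ' : ℝ → ℝ} (hφ' : Continuous φ') {s a b : ℝ}
    (ha : 0 < a) :
    ContinuousOn (fun t => φ' (s / t) * (-(s / t ^ 2))) (Set.Icc a b) := by
  have hpos : ∀ t ∈ Set.Icc a b, t ≠ 0 := fun t ht => by linarith [ht.1]
  exact (hφ'.comp_continuousOn (continuousOn_const.div continuousOn_id hpos)).mul
    (continuousOn_const.div (continuousOn_pow 2) fun t ht => pow_ne_zero 2 (hpos t ht)).neg

lemma abs_const_div_sq {s t : ℝ} (hs : 0 < s) (ht : 0 < t) (x : ℝ) :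
    |x * (-(s / t ^ 2))| = |x| * (s / t ^ 2) := by
  rw [abs_mul, abs_neg, abs_of_pos (div_pos hs (by positivity))]

/-- The sum of the squares `(s / q n) ^ 2` over `q n > s`. -/
lemma WellBehaved.exists_sum_sq_le (hq : WellBehaved q α β A B) (hα : 0 < α) (hβ : 0 < β)
    (hB : 0 < B) (hAB : A < B) : ∃ K : ℝ, 0 < K ∧ ∀ s Q : ℝ, 2 * (2 + β) ^ 2 ≤ s → s ≤ Q →
      ∑ n ∈ hq.between s Q, (s / q n) ^ 2 ≤ K * (s * ell β s ^ (A - 1)) := by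
  obtain ⟨K, hK, h⟩ := hq.exists_abs_sum_sub_integral_le hβ hB
  obtain ⟨C, hC, h1⟩ := exists_integral_sq_mul_ell_le hβ (A - 1)
  refine ⟨α * C + K * (2 + 2 * C), by positivity, fun s Q hs hQ => ?_⟩
  have h4 := four_le_threshold hβ
  have hs0 : 0 < s := by linarith
  have hQ0 : 0 < Q := by linarith
  have hl : 1 ≤ ell β s := one_le_ell hβ (by linarith)
  have hmem : ∀ t ∈ Set.Icc s Q, 0 < t ∧ 1 ≤ ell β t := fun t ht =>
    ⟨by linarith [ht.1], one_le_ell hβ (by linarith [ht.1])⟩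
  have h2 := h s Q (fun t => (s / t) ^ 2) (fun t => 2 * (s / t) * (-(s / t ^ 2))) hs hQ
    (fun t ht => hasDerivAt_comp_const_div (φ := fun u => u ^ 2) (φ' := fun u => 2 * u)
      (fun u => by simpa using hasDerivAt_pow 2 u) (hmem t ht).1.ne')
    (continuousOn_deriv_comp_const_div (φ' := fun u => 2 * u) (by fun_prop) hs0)
  have h3 := h1 s Q (by linarith) hQ
  have e1 : ∫ t in s..Q, t * ell β t ^ (A - 1 - B) * |2 * (s / t) * (-(s / t ^ 2))| ≤
      2 * (C * (s * ell β s ^ (A - 1))) := by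
    refine le_trans ?_ (mul_le_mul_of_nonneg_left h3 (by norm_num))
    rw [← intervalIntegral.integral_const_mul]
    refine intervalIntegral.integral_mono_on hQ (ContinuousOn.intervalIntegrable ?_)
      (ContinuousOn.intervalIntegrable ?_) fun t ht => ?_
    · rw [Set.uIcc_of_le hQ]
      exact (continuousOn_id.mul ((continuousOn_ell_rpow hβ _).mono
        fun t ht => (show (2 + β) ^ 2 ≤ t by linarith [ht.1]))).mul
        (continuousOn_deriv_comp_const_div (φ' := fun u => 2 * u) (by fun_prop) hs0).abs
    · rw [Set.uIcc_of_le hQ]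
      exact continuousOn_const.mul (((continuousOn_const.div continuousOn_id
        fun t ht => (hmem t ht).1.ne').pow 2).mul ((continuousOn_ell_rpow hβ _).mono
        fun t ht => (show (2 + β) ^ 2 ≤ t by linarith [ht.1])))
    · obtain ⟨ht0, htl⟩ := hmem t ht
      rw [abs_const_div_sq hs0 ht0, abs_of_pos (by positivity)]
      calc t * ell β t ^ (A - 1 - B) * (2 * (s / t) * (s / t ^ 2))
          = 2 * ((s / t) ^ 2 * ell β t ^ (A - 1 - B)) := by field_simp
        _ ≤ 2 * ((s / t) ^ 2 * ell β t ^ (A - 1)) := by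
            have := Real.rpow_le_rpow_of_exponent_le htl (show A - 1 - B ≤ A - 1 by linarith)
            gcongr
  have e2 : Q * ell β Q ^ (A - 1 - B) * |(s / Q) ^ 2| ≤ s * ell β s ^ (A - 1) := by
    have h5 : ell β Q ^ (A - 1 - B) ≤ ell β s ^ (A - 1) :=
      (Real.rpow_le_rpow_of_nonpos (by linarith) (ell_mono hβ hs0 hQ) (by linarith)).trans
        (Real.rpow_le_rpow_of_exponent_le hl (by linarith))
    have h6 : s / Q ≤ 1 := (div_le_one hQ0).2 hQ
    have h7 : 0 ≤ ell β Q := by linarith [ell_mono hβ hs0 hQ]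
    rw [abs_of_nonneg (by positivity)]
    calc Q * ell β Q ^ (A - 1 - B) * (s / Q) ^ 2 = s * (s / Q) * ell β Q ^ (A - 1 - B) := by
          field_simp
      _ ≤ s * 1 * ell β s ^ (A - 1) := by gcongr
      _ = _ := by ring
  have e3 : s * ell β s ^ (A - 1 - B) * |(s / s) ^ 2| ≤ s * ell β s ^ (A - 1) := by
    have h5 : ell β s ^ (A - 1 - B) ≤ ell β s ^ (A - 1) :=
      Real.rpow_le_rpow_of_exponent_le hl (by linarith)
    rw [div_self hs0.ne']; simp only [one_pow, abs_one, mul_one]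
    gcongr
  have h5 := (abs_le.1 h2).2
  have h6 := mul_le_mul_of_nonneg_left h3 hα.le
  have h7 := mul_le_mul_of_nonneg_left (add_le_add (add_le_add e2 e3) e1) hK.le
  linarith

/-- Replacing `Y n` by `𝕐` for `s < q n ≤ Q`. -/
lemma WellBehaved.exists_sum_large_le (hq : WellBehaved q α β A B) (hα : 0 < α) (hβ : 0 < β)
    (hA : 0 ≤ A) (hB : 0 < B) (hAB : A < B) (hK₁ : 0 ≤ K₁) : ∃ K : ℝ, 0 < K ∧ ∀ᶠ s in atTop,
      ∀ (g : ℕ+ → ℝ → ℝ) (g₀ g₀' : ℝ → ℝ), CgfFamily K₁ g g₀ g₀' → ∀ Q, s ≤ Q →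
      |∑ n ∈ hq.between s Q, (g n (s / q n) - g₀ (s / q n))| ≤
        K * (s * (ell β s ^ (A - 1) * (Real.log (ell β s) / ell β s))) := by
  obtain ⟨K, hK, hH⟩ := hq.exists_sum_sq_le hα hβ hB hAB
  refine ⟨K₁ * 64 * K + 1, by positivity, ?_⟩
  filter_upwards [eventually_largeScale hβ, hq.eventually_log_le_log_index hα hβ hA hB]
    with s hs hidx g g₀ g₀' hg Q hQ
  have hs0 := hs.pos hβ
  have hl := hs.one_le_ell hβ
  have hll := hs.one_le_log_ell
  have h1 : ∀ n ∈ hq.between s Q, |g n (s / q n) - g₀ (s / q n)| ≤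
      K₁ * 64 / ell β s ^ 2 * (s / q n) ^ 2 := by
    intro n hn
    have hqn := hq.pos n
    have hsn := (hq.mem_between.1 hn).1
    obtain ⟨h2, h3⟩ := hidx n (hs.sqrt_le.trans_lt hsn)
    calc |g n (s / q n) - g₀ (s / q n)| ≤ K₁ * ((s / q n) ^ 2 / Real.log (n : ℕ) ^ 2) :=
          hg.close_sq n h2 _ (by positivity) ((div_le_one hqn).2 hsn.le)
      _ = K₁ * ((s / q n) ^ 2 * (1 / Real.log (n : ℕ) ^ 2)) := by ring
      _ ≤ K₁ * ((s / q n) ^ 2 * (64 / ell β s ^ 2)) := by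
          have := inv_log_sq_le hβ hs h3
          gcongr
      _ = _ := by ring
  have h5 : 1 / ell β s ^ 2 ≤ Real.log (ell β s) / ell β s := by
    rw [div_le_div_iff₀ (by positivity) (by positivity)]
    nlinarith
  calc _ ≤ ∑ n ∈ hq.between s Q, |g n (s / q n) - g₀ (s / q n)| := Finset.abs_sum_le_sum_abs _ _
    _ ≤ ∑ n ∈ hq.between s Q, K₁ * 64 / ell β s ^ 2 * (s / q n) ^ 2 := Finset.sum_le_sum h1
    _ = K₁ * 64 / ell β s ^ 2 * ∑ n ∈ hq.between s Q, (s / q n) ^ 2 := by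
        rw [← Finset.mul_sum]
    _ ≤ K₁ * 64 / ell β s ^ 2 * (K * (s * ell β s ^ (A - 1))) := by
        gcongr
        exact hH s Q hs.threshold_le_self hQ
    _ = K₁ * 64 * K * (s * (ell β s ^ (A - 1) * (1 / ell β s ^ 2))) := by ring
    _ ≤ _ := by
        gcongr
        linarith

end Pieces

end

section

variable {β : ℝ} {q : ℕ+ → ℝ} {α A B : ℝ}

section Pieces

variable {K₁ : ℝ}

lemma CgfFamily.abs_sub_self_le {g : ℕ+ → ℝ → ℝ} {g₀ g₀' : ℝ → ℝ} (h : CgfFamily K₁ g g₀ g₀')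
    {u : ℝ} (hu : 1 ≤ u) : |g₀ u - u| ≤ K₁ * u := by
  have hK := h.const_nonneg
  refine (h.large_limit u hu).trans (mul_le_mul_of_nonneg_left ?_ hK)
  have := Real.log_nonneg hu
  exact div_le_self (by linarith) (one_le_pow₀ (by linarith))

/-- Sum against integral for `√s < q n ≤ s`. -/
lemma WellBehaved.exists_sum_sub_integral_middle_le (hq : WellBehaved q α β A B)
    (hβ : 0 < β) (hB : 0 < B) (hAB : A < B) (hK₁ : 0 ≤ K₁) : ∃ K : ℝ, 0 < K ∧ ∀ s,
      LargeScale β s → ∀ (g : ℕ+ → ℝ → ℝ) (g₀ g₀' : ℝ → ℝ), CgfFamily K₁ g g₀ g₀' →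
      |∑ n ∈ hq.between (√s) s, (g₀ (s / q n) - s / q n) -
        α * ∫ t in (√s)..s, (g₀ (s / t) - s / t) * ell β t ^ (A - 1)| ≤
        K * (s * (ell β s ^ (A - 1) * ell β s ^ (1 - B))) := by
  obtain ⟨K, hK, h⟩ := hq.exists_abs_sum_sub_integral_le hβ hB
  set M : ℝ := (1 / 4 : ℝ) ^ (A - 1 - B) with hM
  have hM0 : 0 < M := by positivity
  refine ⟨K * (K₁ + K₁ * M + (K₁ + 1) * M), by positivity, fun s hs g g₀ g₀' hg => ?_⟩
  have hs0 := hs.pos hβ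
  have hr0 := hs.sqrt_pos hβ
  have hl := hs.one_le_ell hβ
  have h4 := four_le_threshold hβ
  have hmem : ∀ t ∈ Set.Icc (√s) s, 0 < t ∧ 1 ≤ ell β t ∧ ell β t ^ (A - 1 - B) ≤
      M * ell β s ^ (A - 1 - B) := fun t ht => by
    have h1 : (2 + β) ^ 2 ≤ t := by linarith [ht.1, hs.threshold_le]
    refine ⟨by linarith, LargeDev.one_le_ell hβ h1, ?_⟩
    rw [hM, ← Real.mul_rpow (by norm_num) (by linarith)]
    exact Real.rpow_le_rpow_of_nonpos (by linarith)
      (by linarith [hs.quarter_le, ell_mono hβ hr0 ht.1]) (by linarith)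
  have h2 := h (√s) s (fun t => g₀ (s / t) - s / t)
    (fun t => (g₀' (s / t) - 1) * (-(s / t ^ 2))) hs.threshold_le hs.sqrt_le
    (fun t ht => hasDerivAt_comp_const_div (φ := fun u => g₀ u - u) (φ' := fun u => g₀' u - 1)
      (fun u => (hg.hasDerivAt u).sub (hasDerivAt_id u)) (hmem t ht).1.ne')
    (continuousOn_deriv_comp_const_div (φ' := fun u => g₀' u - 1)
      (hg.continuous_deriv.sub continuous_const) hr0)
  refine h2.trans ?_
  have hsplit : ell β s ^ (A - 1) * ell β s ^ (1 - B) = ell β s ^ (A - 1 - B) * ell β s := by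
    rw [← Real.rpow_add (by linarith), ← Real.rpow_add_one (by linarith)]; congr 1; ring
  have hP : 0 < ell β s ^ (A - 1 - B) := by positivity
  have e1 : s * ell β s ^ (A - 1 - B) * |g₀ (s / s) - s / s| ≤
      K₁ * (s * (ell β s ^ (A - 1 - B) * ell β s)) := by
    rw [div_self hs0.ne']
    have := hg.abs_sub_self_le le_rfl
    calc s * ell β s ^ (A - 1 - B) * |g₀ 1 - 1| ≤ s * ell β s ^ (A - 1 - B) * (K₁ * 1) := by gcongr
      _ = K₁ * (s * (ell β s ^ (A - 1 - B) * 1)) := by ring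
      _ ≤ _ := by gcongr
  have hsr : s / √s = √s := Real.div_sqrt
  have e2 : √s * ell β (√s) ^ (A - 1 - B) * |g₀ (s / √s) - s / √s| ≤
      K₁ * M * (s * (ell β s ^ (A - 1 - B) * ell β s)) := by
    rw [hsr]
    have h5 := hg.abs_sub_self_le (show 1 ≤ √s by linarith [hs.threshold_le])
    have h6 := (hmem (√s) ⟨le_rfl, hs.sqrt_le⟩).2.2
    calc √s * ell β (√s) ^ (A - 1 - B) * |g₀ (√s) - √s| ≤
          √s * (M * ell β s ^ (A - 1 - B)) * (K₁ * √s) := by gcongr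
      _ = K₁ * M * ((√s * √s) * (ell β s ^ (A - 1 - B) * 1)) := by ring
      _ ≤ K₁ * M * (s * (ell β s ^ (A - 1 - B) * ell β s)) := by
          rw [Real.mul_self_sqrt hs0.le]; gcongr
  have e3 : ∫ t in (√s)..s, t * ell β t ^ (A - 1 - B) * |(g₀' (s / t) - 1) * (-(s / t ^ 2))| ≤
      (K₁ + 1) * M * (s * (ell β s ^ (A - 1 - B) * ell β s)) := by
    have h5 : ∫ t in (√s)..s,
        t * ell β t ^ (A - 1 - B) * |(g₀' (s / t) - 1) * (-(s / t ^ 2))| ≤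
        ∫ t in (√s)..s, (K₁ + 1) * M * s * ell β s ^ (A - 1 - B) * t⁻¹ := by
      refine intervalIntegral.integral_mono_on hs.sqrt_le (ContinuousOn.intervalIntegrable ?_)
        (ContinuousOn.intervalIntegrable ?_) fun t ht => ?_
      · rw [Set.uIcc_of_le hs.sqrt_le]
        exact (continuousOn_id.mul ((continuousOn_ell_rpow hβ _).mono
          fun t ht => (show (2 + β) ^ 2 ≤ t by linarith [ht.1, hs.threshold_le]))).mul
          (continuousOn_deriv_comp_const_div (φ' := fun u => g₀' u - 1)
            (hg.continuous_deriv.sub continuous_const) hr0).abs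
      · rw [Set.uIcc_of_le hs.sqrt_le]
        exact continuousOn_const.mul (continuousOn_id.inv₀ fun t ht => (hmem t ht).1.ne')
      · obtain ⟨ht0, htl, htp⟩ := hmem t ht
        rw [abs_const_div_sq hs0 ht0]
        have h6 : |g₀' (s / t) - 1| ≤ K₁ + 1 := by
          have := abs_sub (g₀' (s / t)) 1
          rw [abs_one] at this
          linarith [hg.abs_deriv_le (s / t)]
        calc t * ell β t ^ (A - 1 - B) * (|g₀' (s / t) - 1| * (s / t ^ 2)) ≤
              t * (M * ell β s ^ (A - 1 - B)) * ((K₁ + 1) * (s / t ^ 2)) := by gcongr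
          _ = _ := by field_simp
    have h6 : ∫ t in (√s)..s, t⁻¹ ≤ ell β s := by
      rw [integral_inv_of_pos hr0 hs0, hsr, Real.log_sqrt hs0.le]
      linarith [hs.log_le]
    rw [intervalIntegral.integral_const_mul] at h5
    refine h5.trans ?_
    calc _ ≤ (K₁ + 1) * M * s * ell β s ^ (A - 1 - B) * ell β s := by gcongr
      _ = _ := by ring
  rw [hsplit, mul_assoc K]
  refine mul_le_mul_of_nonneg_left ?_ hK.le
  rw [add_mul, add_mul]
  exact add_le_add (add_le_add e1 e2) e3

/-- Sum against integral for `s < q n ≤ Q`. -/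
lemma WellBehaved.exists_sum_sub_integral_large_le (hq : WellBehaved q α β A B)
    (hβ : 0 < β) (hB : 0 < B) (hAB : A < B) (hK₁ : 0 ≤ K₁) : ∃ K : ℝ, 0 < K ∧ ∀ s,
      LargeScale β s → ∀ (g : ℕ+ → ℝ → ℝ) (g₀ g₀' : ℝ → ℝ), CgfFamily K₁ g g₀ g₀' →
      ∀ Q, s ≤ Q →
      |∑ n ∈ hq.between s Q, g₀ (s / q n) - α * ∫ t in s..Q, g₀ (s / t) * ell β t ^ (A - 1)| ≤
        K * (s * (ell β s ^ (A - 1) * ell β s ^ (1 - B))) := by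
  obtain ⟨K, hK, h⟩ := hq.exists_abs_sum_sub_integral_le hβ hB
  obtain ⟨C, hC, h1⟩ := exists_integral_sq_mul_ell_le hβ (A - 1 - B)
  refine ⟨K * (K₁ * (2 + C)) + 1, by positivity, fun s hs g g₀ g₀' hg Q hQ => ?_⟩
  have hs0 := hs.pos hβ
  have hQ0 : 0 < Q := by linarith
  have hl := hs.one_le_ell hβ
  have h4 := four_le_threshold hβ
  have hss := hs.threshold_le_self
  have hmem : ∀ t ∈ Set.Icc s Q, 0 < t ∧ 1 ≤ ell β t ∧ 0 ≤ s / t ∧ s / t ≤ 1 := fun t ht =>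
    ⟨by linarith [ht.1], LargeDev.one_le_ell hβ (by linarith [ht.1]),
      div_nonneg hs0.le (by linarith [ht.1]), (div_le_one (by linarith [ht.1])).2 ht.1⟩
  have h2 := h s Q (fun t => g₀ (s / t)) (fun t => g₀' (s / t) * (-(s / t ^ 2))) hss hQ
    (fun t ht => hasDerivAt_comp_const_div hg.hasDerivAt (hmem t ht).1.ne')
    (continuousOn_deriv_comp_const_div hg.continuous_deriv hs0)
  refine h2.trans ?_
  set P := s * ell β s ^ (A - 1 - B) with hP
  have hP0 : 0 < P := by positivity
  have e1 : Q * ell β Q ^ (A - 1 - B) * |g₀ (s / Q)| ≤ K₁ * P := by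
    obtain ⟨-, h5, h6, h7⟩ := hmem Q ⟨hQ, le_rfl⟩
    have h8 : ell β Q ^ (A - 1 - B) ≤ ell β s ^ (A - 1 - B) :=
      Real.rpow_le_rpow_of_nonpos (by linarith) (ell_mono hβ hs0 hQ) (by linarith)
    calc Q * ell β Q ^ (A - 1 - B) * |g₀ (s / Q)| ≤
          Q * ell β s ^ (A - 1 - B) * (K₁ * (s / Q) ^ 2) := by
          gcongr
          exact hg.small_limit _ h6 h7
      _ = K₁ * (s * (s / Q) * ell β s ^ (A - 1 - B)) := by field_simp
      _ ≤ K₁ * (s * 1 * ell β s ^ (A - 1 - B)) := by gcongr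
      _ = _ := by rw [hP]; ring
  have e2 : s * ell β s ^ (A - 1 - B) * |g₀ (s / s)| ≤ K₁ * P := by
    rw [div_self hs0.ne', mul_comm K₁]
    have := hg.small_limit 1 zero_le_one le_rfl
    simp only [one_pow, mul_one] at this
    gcongr
  have e3 : ∫ t in s..Q, t * ell β t ^ (A - 1 - B) * |g₀' (s / t) * (-(s / t ^ 2))| ≤
      K₁ * C * P := by
    have h3 := mul_le_mul_of_nonneg_left (h1 s Q (by linarith) hQ) hK₁
    rw [mul_assoc]
    refine le_trans ?_ h3
    rw [← intervalIntegral.integral_const_mul]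
    refine intervalIntegral.integral_mono_on hQ (ContinuousOn.intervalIntegrable ?_)
      (ContinuousOn.intervalIntegrable ?_) fun t ht => ?_
    · rw [Set.uIcc_of_le hQ]
      exact (continuousOn_id.mul ((continuousOn_ell_rpow hβ _).mono
        fun t ht => (show (2 + β) ^ 2 ≤ t by linarith [ht.1]))).mul
        (continuousOn_deriv_comp_const_div hg.continuous_deriv hs0).abs
    · rw [Set.uIcc_of_le hQ]
      exact continuousOn_const.mul (((continuousOn_const.div continuousOn_id
        fun t ht => (hmem t ht).1.ne').pow 2).mul ((continuousOn_ell_rpow hβ _).mono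
        fun t ht => (show (2 + β) ^ 2 ≤ t by linarith [ht.1])))
    · obtain ⟨ht0, htl, h6, h7⟩ := hmem t ht
      rw [abs_const_div_sq hs0 ht0]
      calc t * ell β t ^ (A - 1 - B) * (|g₀' (s / t)| * (s / t ^ 2)) ≤
            t * ell β t ^ (A - 1 - B) * ((K₁ * (s / t)) * (s / t ^ 2)) := by
            gcongr
            exact hg.abs_deriv_le_mul _ h6 h7
        _ = K₁ * ((s / t) ^ 2 * ell β t ^ (A - 1 - B)) := by field_simp
  have hsplit : P ≤ s * (ell β s ^ (A - 1) * ell β s ^ (1 - B)) := by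
    rw [hP, ← Real.rpow_add (by linarith)]
    gcongr
    linarith
  calc _ ≤ K * (K₁ * P + K₁ * P + K₁ * C * P) := by gcongr
    _ = K * (K₁ * (2 + C)) * P := by ring
    _ ≤ (K * (K₁ * (2 + C)) + 1) * (s * (ell β s ^ (A - 1) * ell β s ^ (1 - B))) := by
        gcongr
        linarith

/-- Increments of powers on a bounded logarithmic range. -/
lemma exists_abs_rpow_sub_rpow_le_of_quarter (p : ℝ) : ∃ C : ℝ, 0 < C ∧ ∀ x y : ℝ, 0 < x →
    x / 4 ≤ y → y ≤ x → |y ^ p - x ^ p| ≤ C * (x ^ (p - 1) * |y - x|) := by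
  obtain ⟨C, hC, h⟩ := exists_abs_rpow_sub_rpow_le p
  refine ⟨(1 / 4) ^ p * (C * 4 ^ (p - 1) * 4 * Real.exp (3 / 4)), by positivity,
    fun x y hx h1 h2 => ?_⟩
  have hz1 : 1 ≤ 4 * (y / x) := by rw [← mul_div_assoc, le_div_iff₀ hx]; linarith
  have hz2 : y / x ≤ 1 := (div_le_one hx).2 h2
  have hy0 : 0 < y := by linarith
  have h3 := h (4 * (y / x)) 4 hz1 (by norm_num)
  have h4 : |4 * (y / x) - 4| = 4 * (|y - x| / x) := by
    rw [show 4 * (y / x) - 4 = 4 * ((y - x) / x) by field_simp, abs_mul, abs_div, abs_of_pos hx]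
    norm_num
  have h5 : |4 * (y / x) - 4| ≤ 3 := by rw [abs_le]; constructor <;> linarith
  have e1 : ∀ w : ℝ, 0 < w → w ^ p = (1 / 4) ^ p * x ^ p * (4 * (w / x)) ^ p := by
    intro w hw
    rw [← Real.mul_rpow (by norm_num) hx.le, ← Real.mul_rpow (by positivity) (by positivity)]
    congr 1; field_simp
  have e2 := e1 x hx
  rw [div_self hx.ne', mul_one] at e2
  have e3 : y ^ p - x ^ p = (1 / 4) ^ p * x ^ p * ((4 * (y / x)) ^ p - 4 ^ p) := by
    rw [mul_sub, ← e1 y hy0, ← e2]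
  rw [e3, abs_mul, abs_of_pos (by positivity)]
  calc _ ≤ (1 / 4) ^ p * x ^ p * (C * 4 ^ (p - 1) * |4 * (y / x) - 4| *
        Real.exp (|4 * (y / x) - 4| / 4)) := by gcongr
    _ ≤ (1 / 4) ^ p * x ^ p * (C * 4 ^ (p - 1) * |4 * (y / x) - 4| * Real.exp (3 / 4)) := by
        gcongr
    _ = _ := by
        rw [h4, Real.rpow_sub_one hx.ne']; field_simp

lemma hasDerivAt_log_one_add_log {s t : ℝ} (hs : 0 < s) (ht : 0 < t) (hts : t ≤ s) :
    HasDerivAt (fun t => -(s * Real.log (1 + Real.log (s / t))))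
      (s / t * (1 / (1 + Real.log (s / t)))) t := by
  have hl : 0 ≤ Real.log (s / t) := Real.log_nonneg ((one_le_div ht).2 hts)
  have h1 : HasDerivAt (fun t => Real.log (s / t)) ((s / t)⁻¹ * (-(s / t ^ 2))) t :=
    hasDerivAt_comp_const_div' hs ht
  refine (((h1.const_add 1).log (by positivity)).const_mul s).fun_neg.congr_deriv ?_
  field_simp
where
  hasDerivAt_comp_const_div' {s t : ℝ} (hs : 0 < s) (ht : 0 < t) :
      HasDerivAt (fun t => Real.log (s / t)) ((s / t)⁻¹ * (-(s / t ^ 2))) t := by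
    refine (Real.hasDerivAt_log (div_pos hs ht).ne').comp t (h := fun t => s / t)
      (((hasDerivAt_inv ht.ne').const_mul s).congr_deriv ?_)
    field_simp

/-- On `[√s, s]` the density may be replaced by its value at `s`. -/
lemma exists_integral_middle_sub_le (hβ : 0 < β) (hK₁ : 0 ≤ K₁) (A : ℝ) : ∃ K : ℝ, 0 < K ∧ ∀ s,
      LargeScale β s → ∀ (g : ℕ+ → ℝ → ℝ) (g₀ g₀' : ℝ → ℝ), CgfFamily K₁ g g₀ g₀' →
      |(∫ t in (√s)..s, (g₀ (s / t) - s / t) * ell β t ^ (A - 1)) -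
        ell β s ^ (A - 1) * ∫ t in (√s)..s, (g₀ (s / t) - s / t)| ≤
        K * (s * (ell β s ^ (A - 1) * (Real.log (ell β s) / ell β s))) := by
  obtain ⟨C, hC, h⟩ := exists_abs_rpow_sub_rpow_le_of_quarter (A - 1)
  refine ⟨K₁ * C * 2 + 1, by positivity, fun s hs g g₀ g₀' hg => ?_⟩
  have hs0 := hs.pos hβ
  have hr0 := hs.sqrt_pos hβ
  have hl := hs.one_le_ell hβ
  have h4 := four_le_threshold hβ
  have hmem : ∀ t ∈ Set.Icc (√s) s, 0 < t ∧ 1 ≤ s / t ∧ 0 ≤ Real.log (s / t) := fun t ht => by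
    have h0 : 0 < t := by linarith [ht.1]
    have h1 := (one_le_div h0).2 ht.2
    exact ⟨h0, h1, Real.log_nonneg h1⟩
  have hF : ContinuousOn (fun t => g₀ (s / t) - s / t) (Set.uIcc (√s) s) := by
    rw [Set.uIcc_of_le hs.sqrt_le]
    have : ContinuousOn (fun t => s / t) (Set.Icc (√s) s) :=
      continuousOn_const.div continuousOn_id fun t ht => (hmem t ht).1.ne'
    exact (hg.continuous.comp_continuousOn this).sub this
  have hlam : ContinuousOn (fun t => ell β t ^ (A - 1)) (Set.uIcc (√s) s) := by
    rw [Set.uIcc_of_le hs.sqrt_le]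
    exact (continuousOn_ell_rpow hβ _).mono
      fun t ht => (show (2 + β) ^ 2 ≤ t by linarith [ht.1, hs.threshold_le])
  have hi : IntervalIntegrable (fun t => (g₀ (s / t) - s / t) * ell β t ^ (A - 1)) volume (√s) s :=
    (hF.mul hlam).intervalIntegrable
  rw [← intervalIntegral.integral_const_mul, ← intervalIntegral.integral_sub hi
    (hF.intervalIntegrable.const_mul _)]
  have hcont2 : ContinuousOn (fun t => s / t * (1 / (1 + Real.log (s / t)))) (Set.uIcc (√s) s) := by
    rw [Set.uIcc_of_le hs.sqrt_le]
    have : ContinuousOn (fun t => s / t) (Set.Icc (√s) s) :=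
      continuousOn_const.div continuousOn_id fun t ht => (hmem t ht).1.ne'
    refine this.mul (continuousOn_const.div (continuousOn_const.add (this.log fun t ht => ?_))
      fun t ht => ?_)
    · linarith [(hmem t ht).2.1]
    · linarith [(hmem t ht).2.2]
  have h1 : ‖∫ t in (√s)..s, ((g₀ (s / t) - s / t) * ell β t ^ (A - 1) -
      ell β s ^ (A - 1) * (g₀ (s / t) - s / t))‖ ≤
      ∫ t in (√s)..s, K₁ * C * ell β s ^ (A - 1 - 1) * (s / t * (1 / (1 + Real.log (s / t)))) := by
    refine intervalIntegral.norm_integral_le_of_norm_le hs.sqrt_le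
      (Eventually.of_forall fun t ht => ?_) (hcont2.intervalIntegrable.const_mul _)
    obtain ⟨h0, h1, h2⟩ := hmem t ⟨ht.1.le, ht.2⟩
    have h5 := h (ell β s) (ell β t) (by linarith)
      (hs.quarter_le.trans (ell_mono hβ hr0 ht.1.le)) (ell_mono hβ h0 ht.2)
    have h6 : |ell β t - ell β s| = Real.log (s / t) := by
      rw [abs_sub_comm]
      exact (abs_ell_sub_of_le hβ h0 ht.2).1
    rw [h6] at h5
    have h7 := hg.large_limit _ h1
    have h8 : (g₀ (s / t) - s / t) * ell β t ^ (A - 1) -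
        ell β s ^ (A - 1) * (g₀ (s / t) - s / t) =
        (g₀ (s / t) - s / t) * (ell β t ^ (A - 1) - ell β s ^ (A - 1)) := by ring
    rw [h8, norm_mul, Real.norm_eq_abs, Real.norm_eq_abs]
    have h9 : Real.log (s / t) / (1 + Real.log (s / t)) ^ 2 ≤ 1 / (1 + Real.log (s / t)) := by
      rw [div_le_div_iff₀ (by positivity) (by positivity)]
      nlinarith
    calc _ ≤ K₁ * (s / t / (1 + Real.log (s / t)) ^ 2) *
          (C * (ell β s ^ (A - 1 - 1) * Real.log (s / t))) := by gcongr
      _ = K₁ * C * ell β s ^ (A - 1 - 1) *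
          (s / t * (Real.log (s / t) / (1 + Real.log (s / t)) ^ 2)) := by ring
      _ ≤ _ := by gcongr
  rw [Real.norm_eq_abs] at h1
  refine h1.trans ?_
  have h2 : ∫ t in (√s)..s, s / t * (1 / (1 + Real.log (s / t))) = s * Real.log (1 + Real.log (√s)) := by
    rw [intervalIntegral.integral_eq_sub_of_hasDerivAt
      (f := fun t => -(s * Real.log (1 + Real.log (s / t)))) (fun t ht => ?_)
      hcont2.intervalIntegrable]
    · simp only [Real.div_sqrt]
      rw [div_self hs0.ne']; simp
    · rw [Set.uIcc_of_le hs.sqrt_le] at ht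
      exact hasDerivAt_log_one_add_log hs0 (hmem t ht).1 ht.2
  have h3 : Real.log (1 + Real.log (√s)) ≤ 2 * Real.log (ell β s) := by
    have h5 : Real.log (√s) ≤ ell β s := by
      rw [Real.log_sqrt hs0.le]; linarith [hs.log_le]
    have h6 : 0 ≤ Real.log (√s) := Real.log_nonneg (by linarith [hs.threshold_le])
    have h7 : 2 ≤ ell β s := by
      have := Real.exp_le_exp.2 hs.one_le_log_ell
      rw [Real.exp_log (by linarith)] at this
      linarith [Real.add_one_le_exp 1]
    calc Real.log (1 + Real.log (√s)) ≤ Real.log (ell β s ^ 2) :=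
          Real.log_le_log (by linarith) (by nlinarith)
      _ = _ := by rw [Real.log_pow]; norm_num
  rw [intervalIntegral.integral_const_mul, h2]
  have hP : 0 < ell β s ^ (A - 1 - 1) := by positivity
  have hll := hs.one_le_log_ell
  calc _ ≤ K₁ * C * ell β s ^ (A - 1 - 1) * (s * (2 * Real.log (ell β s))) := by gcongr
    _ = K₁ * C * 2 * (s * (ell β s ^ (A - 1 - 1) * Real.log (ell β s))) := by ring
    _ = K₁ * C * 2 * (s * (ell β s ^ (A - 1) * (Real.log (ell β s) / ell β s))) := by
        rw [Real.rpow_sub_one (by linarith : ell β s ≠ 0)]; ring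
    _ ≤ _ := by
        gcongr
        linarith

/-- On `[s, Q]` the density may be replaced by its value at `s`. -/
lemma exists_integral_large_sub_le (hβ : 0 < β) (hK₁ : 0 ≤ K₁) (A : ℝ) : ∃ K : ℝ, 0 < K ∧ ∀ s,
      LargeScale β s → ∀ (g : ℕ+ → ℝ → ℝ) (g₀ g₀' : ℝ → ℝ), CgfFamily K₁ g g₀ g₀' → ∀ Q, s ≤ Q →
      |(∫ t in s..Q, g₀ (s / t) * ell β t ^ (A - 1)) -
        ell β s ^ (A - 1) * ∫ t in s..Q, g₀ (s / t)| ≤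
        K * (s * (ell β s ^ (A - 1) * (Real.log (ell β s) / ell β s))) := by
  obtain ⟨C, hC, h⟩ := exists_abs_rpow_sub_rpow_le (A - 1)
  refine ⟨K₁ * C * 4 * 2 + 1, by positivity, fun s hs g g₀ g₀' hg Q hQ => ?_⟩
  have hs0 := hs.pos hβ
  have hl := hs.one_le_ell hβ
  have h4 := four_le_threshold hβ
  have hss := hs.threshold_le_self
  have hmem : ∀ t ∈ Set.Icc s Q, 0 < t ∧ 1 ≤ ell β t ∧ 0 ≤ s / t ∧ s / t ≤ 1 := fun t ht =>
    ⟨by linarith [ht.1], LargeDev.one_le_ell hβ (by linarith [ht.1]),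
      div_nonneg hs0.le (by linarith [ht.1]), (div_le_one (by linarith [ht.1])).2 ht.1⟩
  have hF : ContinuousOn (fun t => g₀ (s / t)) (Set.uIcc s Q) := by
    rw [Set.uIcc_of_le hQ]
    exact hg.continuous.comp_continuousOn
      (continuousOn_const.div continuousOn_id fun t ht => (hmem t ht).1.ne')
  have hlam : ContinuousOn (fun t => ell β t ^ (A - 1)) (Set.uIcc s Q) := by
    rw [Set.uIcc_of_le hQ]
    exact (continuousOn_ell_rpow hβ _).mono
      fun t ht => (show (2 + β) ^ 2 ≤ t by linarith [ht.1])
  have hi : IntervalIntegrable (fun t => g₀ (s / t) * ell β t ^ (A - 1)) volume s Q :=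
    (hF.mul hlam).intervalIntegrable
  rw [← intervalIntegral.integral_const_mul, ← intervalIntegral.integral_sub hi
    (hF.intervalIntegrable.const_mul _)]
  have h1 : ‖∫ t in s..Q, (g₀ (s / t) * ell β t ^ (A - 1) - ell β s ^ (A - 1) * g₀ (s / t))‖ ≤
      ∫ t in s..Q, K₁ * C * 4 * ell β s ^ (A - 1 - 1) *
        ((s / t) ^ 2 * Real.exp (Real.log (t / s) / 2)) := by
    refine intervalIntegral.norm_integral_le_of_norm_le hQ
      (Eventually.of_forall fun t ht => ?_)
      ((continuousOn_tail_kernel hs0 hQ).intervalIntegrable.const_mul _)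
    obtain ⟨h0, h1, h2, h3⟩ := hmem t ⟨ht.1.le, ht.2⟩
    have h5 := h (ell β t) (ell β s) h1 hl
    obtain ⟨h6, h7⟩ := abs_ell_sub_of_le hβ hs0 ht.1.le
    rw [h6] at h5
    have h8 : g₀ (s / t) * ell β t ^ (A - 1) - ell β s ^ (A - 1) * g₀ (s / t) =
        g₀ (s / t) * (ell β t ^ (A - 1) - ell β s ^ (A - 1)) := by ring
    rw [h8, norm_mul, Real.norm_eq_abs, Real.norm_eq_abs]
    have h9 : Real.log (t / s) * Real.exp (Real.log (t / s) / 4) ≤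
        4 * Real.exp (Real.log (t / s) / 2) := by
      have h10 := Real.add_one_le_exp (Real.log (t / s) / 4)
      have h11 : Real.exp (Real.log (t / s) / 2) =
          Real.exp (Real.log (t / s) / 4) * Real.exp (Real.log (t / s) / 4) := by
        rw [← Real.exp_add]; congr 1; ring
      rw [h11]
      nlinarith [Real.exp_pos (Real.log (t / s) / 4)]
    calc _ ≤ K₁ * (s / t) ^ 2 * (C * ell β s ^ (A - 1 - 1) * Real.log (t / s) *
          Real.exp (Real.log (t / s) / 4)) := by
          gcongr
          exact hg.small_limit _ h2 h3
      _ = K₁ * C * ell β s ^ (A - 1 - 1) * (s / t) ^ 2 *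
          (Real.log (t / s) * Real.exp (Real.log (t / s) / 4)) := by ring
      _ ≤ K₁ * C * ell β s ^ (A - 1 - 1) * (s / t) ^ 2 * (4 * Real.exp (Real.log (t / s) / 2)) := by
          gcongr
      _ = _ := by ring
  rw [Real.norm_eq_abs] at h1
  refine h1.trans ?_
  rw [intervalIntegral.integral_const_mul]
  have h2 := integral_tail_kernel_le hs0 hQ
  have hll := hs.one_le_log_ell
  have hP : 0 < ell β s ^ (A - 1 - 1) := by positivity
  calc _ ≤ K₁ * C * 4 * ell β s ^ (A - 1 - 1) * (2 * s) := by gcongr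
    _ = K₁ * C * 4 * 2 * (s * (ell β s ^ (A - 1 - 1) * 1)) := by ring
    _ ≤ (K₁ * C * 4 * 2 + 1) * (s * (ell β s ^ (A - 1 - 1) * Real.log (ell β s))) := by
        gcongr
        linarith
    _ = _ := by rw [Real.rpow_sub_one (by linarith : ell β s ≠ 0)]; ring

end Pieces

/-- The logarithm `∑ g n (s / q n)` of the moment generating function of the weighted sum, for `s`
somewhat smaller than `Q`. Writing `g n u = u + (g n u - u)` for `q n ≤ s` splits off `s H(s)`. In the
rest the `q n ≤ √s` are negligible, `g n` may be replaced by `g₀` for `q n > √s`, and then the sum by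
an integral over `t`, in which the density is nearly constant on the scale of `t = s`. The
substitution `u = s / t` turns this integral into `s η`. -/
theorem WellBehaved.exists_sum_cgf_sub_le (hq : WellBehaved q α β A B) (hα : 0 < α) (hβ : 0 < β)
    (hA : 0 ≤ A) (hB : 0 < B) (hAB : A < B) {C K₀ : ℝ} (hK₀ : 0 < K₀)
    (hH : ∀ y : ℝ, 2 * (2 + β) ^ 2 ≤ y →
      |harmonicSum q y - harmonicMain α β A y - C| ≤ K₀ * ell β y ^ (A - B))
    {K₁ D : ℝ} (hK₁ : 0 ≤ K₁) (hD : 0 < D) : ∃ K : ℝ, 0 < K ∧ ∀ᶠ s in atTop,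
      ∀ (g : ℕ+ → ℝ → ℝ) (g₀ g₀' : ℝ → ℝ), CgfFamily K₁ g g₀ g₀' →
      ∀ Q, s * ell β s ≤ D * Q →
      |∑ n ∈ hq.upTo Q, g n (s / q n) -
        s * (harmonicMain α β A s + C + α * etaOf g₀ * ell β s ^ (A - 1))| ≤
        K * (s * (ell β s ^ (A - 1) * (Real.log (ell β s) / ell β s + ell β s ^ (1 - B)))) := by
  obtain ⟨Ka, hKa, ha⟩ := hq.exists_sum_small_le hα hβ hA hB hAB hK₁
  obtain ⟨Kb, hKb, hb⟩ := hq.exists_sum_middle_le hα hβ hA hB hAB hK₁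
  obtain ⟨Kc, hKc, hc⟩ := hq.exists_sum_large_le hα hβ hA hB hAB hK₁
  obtain ⟨Kd, hKd, hd⟩ := hq.exists_sum_sub_integral_middle_le hβ hB hAB hK₁
  obtain ⟨Ke, hKe, he⟩ := hq.exists_sum_sub_integral_large_le hβ hB hAB hK₁
  obtain ⟨Kf, hKf, hf⟩ := exists_integral_middle_sub_le hβ hK₁ A
  obtain ⟨Kg, hKg, hg⟩ := exists_integral_large_sub_le hβ hK₁ A
  refine ⟨K₀ + Ka + Kb + Kc + Kd + Ke + α * Kf + α * Kg + α * (K₁ * (4 + D)), by positivity, ?_⟩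
  filter_upwards [eventually_largeScale hβ, hb, hc, (tendsto_ell hβ).eventually_ge_atTop D]
    with s hs hb hc hDs g g₀ g₀' hfam Q hQ
  have hs0 := hs.pos hβ
  have hr0 := hs.sqrt_pos hβ
  have hl := hs.one_le_ell hβ
  have hl0 : 0 < ell β s := by linarith
  have hll := hs.one_le_log_ell
  have hQ0 : 0 < Q := by
    have : 0 < D * Q := lt_of_lt_of_le (by positivity) hQ
    exact (mul_pos_iff_of_pos_left hD).1 this
  have hsQ : s ≤ Q := by
    have : s * ell β s ≤ Q * ell β s := by nlinarith
    exact le_of_mul_le_mul_right this hl0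
  set x := ell β s with hx
  set R₁ := s * (x ^ (A - 1) * (Real.log x / x)) with hR₁
  set R₂ := s * (x ^ (A - 1) * x ^ (1 - B)) with hR₂
  have hR₁0 : 0 < R₁ := by positivity
  have hR₂0 : 0 < R₂ := by positivity
  have ha := ha s hs g g₀ g₀' hfam
  have hb := hb g g₀ g₀' hfam
  have hc := hc g g₀ g₀' hfam Q hsQ
  have hd := hd s hs g g₀ g₀' hfam
  have he := he s hs g g₀ g₀' hfam Q hsQ
  have hf := hf s hs g g₀ g₀' hfam
  have hg := hg s hs g g₀ g₀' hfam Q hsQ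
  have hη := hfam.abs_integrals_sub_eta_le (by linarith [hs.threshold_le, hs.sqrt_le, four_le_threshold hβ]) hsQ
  have hHs : s * |harmonicSum q s - harmonicMain α β A s - C| ≤ K₀ * R₂ := by
    have h1 := hH s hs.threshold_le_self
    have h2 : x ^ (A - 1) * x ^ (1 - B) = x ^ (A - B) := by
      rw [← Real.rpow_add hl0]; congr 1; ring
    rw [hR₂, h2]
    calc _ ≤ s * (K₀ * x ^ (A - B)) := by gcongr
      _ = _ := by ring
  -- the error in `η`
  have hη' : x ^ (A - 1) * |(∫ t in (√s)..s, (g₀ (s / t) - s / t)) + (∫ t in s..Q, g₀ (s / t)) -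
      s * etaOf g₀| ≤ K₁ * (4 + D) * R₁ := by
    have h1 : (1 + Real.log (√s))⁻¹ ≤ 4 * (Real.log x / x) := by
      have h2 : x / 4 ≤ 1 + Real.log (√s) := by
        rw [Real.log_sqrt hs0.le]; linarith [hs.half_le_log]
      calc (1 + Real.log (√s))⁻¹ ≤ (x / 4)⁻¹ := by gcongr
        _ = 4 * (1 / x) := by field_simp
        _ ≤ _ := by gcongr
    have h2 : s / Q ≤ D * (Real.log x / x) := by
      calc s / Q ≤ D * (1 / x) := by
            rw [div_le_iff₀ hQ0, mul_one_div, div_mul_eq_mul_div, le_div_iff₀ hl0]; exact hQ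
        _ ≤ _ := by gcongr
    calc _ ≤ x ^ (A - 1) * (K₁ * (s * (1 + Real.log (√s))⁻¹ + s * (s / Q))) := by gcongr
      _ ≤ x ^ (A - 1) * (K₁ * (s * (4 * (Real.log x / x)) + s * (D * (Real.log x / x)))) := by
          gcongr
      _ = _ := by rw [hR₁]; ring
  set S₁ := ∑ n ∈ hq.upTo (√s), (g n (s / q n) - s / q n) with hS₁
  set S₂ := ∑ n ∈ hq.between (√s) s, (g n (s / q n) - g₀ (s / q n)) with hS₂
  set S₃ := ∑ n ∈ hq.between s Q, (g n (s / q n) - g₀ (s / q n)) with hS₃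
  set S₄ := ∑ n ∈ hq.between (√s) s, (g₀ (s / q n) - s / q n) with hS₄
  set S₅ := ∑ n ∈ hq.between s Q, g₀ (s / q n) with hS₅
  have hdecomp : ∑ n ∈ hq.upTo Q, g n (s / q n) = s * harmonicSum q s + S₁ + S₂ + S₃ + S₄ + S₅ := by
    rw [hq.sum_upTo hsQ, hq.sum_upTo hs.sqrt_le, hq.harmonicSum_eq, hq.sum_upTo hs.sqrt_le,
      hS₁, hS₂, hS₃, hS₄, hS₅]
    simp only [Finset.sum_sub_distrib, mul_add, Finset.mul_sum, mul_one_div]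
    ring
  set I₁ := ∫ t in (√s)..s, (g₀ (s / t) - s / t) * ell β t ^ (A - 1) with hI₁
  set I₂ := ∫ t in s..Q, g₀ (s / t) * ell β t ^ (A - 1) with hI₂
  set J₁ := ∫ t in (√s)..s, (g₀ (s / t) - s / t) with hJ₁
  set J₂ := ∫ t in s..Q, g₀ (s / t) with hJ₂
  rw [hdecomp]
  have htotal : s * harmonicSum q s + S₁ + S₂ + S₃ + S₄ + S₅ -
      s * (harmonicMain α β A s + C + α * etaOf g₀ * x ^ (A - 1)) =
      s * (harmonicSum q s - harmonicMain α β A s - C) + S₁ + S₂ + S₃ + (S₄ - α * I₁) +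
        (S₅ - α * I₂) + α * (I₁ - x ^ (A - 1) * J₁) + α * (I₂ - x ^ (A - 1) * J₂) +
        α * (x ^ (A - 1) * (J₁ + J₂ - s * etaOf g₀)) := by ring
  rw [htotal]
  have hsum : s * (x ^ (A - 1) * (Real.log x / x + x ^ (1 - B))) = R₁ + R₂ := by
    rw [hR₁, hR₂]; ring
  rw [hsum]
  have t1 : |s * (harmonicSum q s - harmonicMain α β A s - C)| ≤ K₀ * R₂ := by
    rwa [abs_mul, abs_of_pos hs0]
  have t7 : |α * (I₁ - x ^ (A - 1) * J₁)| ≤ α * Kf * R₁ := by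
    rw [abs_mul, abs_of_pos hα, mul_assoc]; gcongr
  have t8 : |α * (I₂ - x ^ (A - 1) * J₂)| ≤ α * Kg * R₁ := by
    rw [abs_mul, abs_of_pos hα, mul_assoc]; gcongr
  have t9 : |α * (x ^ (A - 1) * (J₁ + J₂ - s * etaOf g₀))| ≤ α * (K₁ * (4 + D)) * R₁ := by
    rw [abs_mul, abs_of_pos hα, mul_assoc α, abs_mul, abs_of_pos (by positivity : 0 < x ^ (A - 1))]
    gcongr
  rw [abs_le] at *
  have p1 : 0 ≤ (Ka + Kb + Kc + α * Kf + α * Kg + α * (K₁ * (4 + D))) * R₂ := by positivity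
  have p2 : 0 ≤ (K₀ + Kd + Ke) * R₁ := by positivity
  constructor <;> nlinarith only [p1, p2, t1, t7, t8, t9, ha, hb, hc, hd, he]

end

/-! ### Truncated exponentials -/

/-- The Taylor polynomial of degree `N` of the exponential function. -/
def truncExp (N : ℕ) (y : ℝ) : ℝ := ∑ k ∈ Finset.range (N + 1), y ^ k / (k.factorial : ℝ)

lemma truncExp_succ (N : ℕ) (y : ℝ) :
    truncExp (N + 1) y = truncExp N y + y ^ (N + 1) / ((N + 1).factorial : ℝ) :=
  Finset.sum_range_succ _ _

lemma truncExp_le_exp (N : ℕ) {y : ℝ} (hy : 0 ≤ y) : truncExp N y ≤ Real.exp y :=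
  Real.sum_le_exp_of_nonneg hy _

lemma truncExp_mono (N : ℕ) {x y : ℝ} (hx : 0 ≤ x) (hxy : x ≤ y) : truncExp N x ≤ truncExp N y :=
  Finset.sum_le_sum fun k _ => by gcongr

lemma one_le_truncExp (N : ℕ) {y : ℝ} (hy : 0 ≤ y) : 1 ≤ truncExp N y := by
  have h := truncExp_mono N le_rfl hy
  have h0 : truncExp N 0 = 1 := by
    rw [truncExp, Finset.sum_range_succ']; simp
  linarith

lemma hasSum_exp (y : ℝ) : HasSum (fun k : ℕ => y ^ k / (k.factorial : ℝ)) (Real.exp y) := by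
  rw [Real.exp_eq_exp_ℝ]
  exact NormedSpace.expSeries_div_hasSum_exp y

/-- Rankin's trick with the factor `e`. -/
lemma abs_exp_sub_truncExp_le (N : ℕ) (y : ℝ) :
    |Real.exp y - truncExp N y| ≤ Real.exp (3 * |y| - N) := by
  have h1 : HasSum (fun k : ℕ => y ^ (k + (N + 1)) / ((k + (N + 1)).factorial : ℝ))
      (Real.exp y - truncExp N y) := (hasSum_nat_add_iff' (N + 1)).2 (hasSum_exp y)
  have h2 : HasSum (fun k : ℕ => Real.exp (-N) * ((Real.exp 1 * |y|) ^ (k + (N + 1)) /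
      ((k + (N + 1)).factorial : ℝ)))
      (Real.exp (-N) * (Real.exp (Real.exp 1 * |y|) - truncExp N (Real.exp 1 * |y|))) :=
    ((hasSum_nat_add_iff' (N + 1)).2 (hasSum_exp _)).mul_left _
  have h3 : |Real.exp y - truncExp N y| ≤
      Real.exp (-N) * (Real.exp (Real.exp 1 * |y|) - truncExp N (Real.exp 1 * |y|)) := by
    rw [← h1.tsum_eq, ← Real.norm_eq_abs]
    refine tsum_of_norm_bounded h2 fun k => ?_
    have h4 : 1 ≤ Real.exp (-N) * Real.exp 1 ^ (k + (N + 1)) := by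
      rw [← Real.exp_nat_mul, ← Real.exp_add]
      refine Real.one_le_exp ?_
      push_cast; linarith [Nat.cast_nonneg (α := ℝ) k]
    rw [norm_div, norm_pow, Real.norm_eq_abs, Real.norm_natCast, mul_pow, ← mul_div_assoc,
      ← mul_assoc]
    gcongr
    exact le_mul_of_one_le_left (by positivity) h4
  have h5 := one_le_truncExp N (show 0 ≤ Real.exp 1 * |y| by positivity)
  calc _ ≤ Real.exp (-N) * (Real.exp (Real.exp 1 * |y|) - truncExp N (Real.exp 1 * |y|)) := h3
    _ ≤ Real.exp (-N) * Real.exp (3 * |y|) := by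
        gcongr
        have : Real.exp (Real.exp 1 * |y|) ≤ Real.exp (3 * |y|) := by
          gcongr; linarith [Real.exp_one_lt_d9]
        linarith
    _ = _ := by rw [← Real.exp_add]; congr 1; ring

lemma pow_div_factorial_le (N : ℕ) {y : ℝ} (hy : 0 ≤ y) :
    y ^ N / (N.factorial : ℝ) ≤ Real.exp (3 * y - N) := by
  have h1 := Real.pow_div_factorial_le_exp (Real.exp 1 * y) (by positivity) N
  rw [mul_pow, ← Real.exp_nat_mul, mul_one, mul_div_assoc, mul_comm, ← le_div_iff₀ (Real.exp_pos _),
    ← Real.exp_sub] at h1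
  refine h1.trans (Real.exp_le_exp.2 ?_)
  nlinarith [Real.exp_one_lt_d9]

lemma hasDerivAt_truncExp_succ (N : ℕ) (y : ℝ) :
    HasDerivAt (truncExp (N + 1)) (truncExp N y) y := by
  have h1 : ∀ k : ℕ, HasDerivAt (fun y : ℝ => y ^ (k + 1) / ((k + 1).factorial : ℝ))
      (y ^ k / (k.factorial : ℝ)) y := by
    intro k
    refine ((hasDerivAt_pow (k + 1) y).div_const _).congr_deriv ?_
    rw [Nat.factorial_succ]; push_cast
    have : (k.factorial : ℝ) ≠ 0 := by positivity
    have h2 : (k : ℝ) + 1 ≠ 0 := by positivity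
    field_simp
  have h2 : truncExp (N + 1) =
      fun y => (∑ k ∈ Finset.range (N + 1), y ^ (k + 1) / ((k + 1).factorial : ℝ)) + 1 := by
    ext z
    rw [truncExp, Finset.sum_range_succ']; simp
  rw [h2]
  exact (HasDerivAt.fun_sum fun k _ => h1 k).add_const 1

/-- For `y ≤ 0` the Taylor polynomials of the exponential alternate around it. -/
lemma truncExp_alternating (N : ℕ) : ∀ y : ℝ, y ≤ 0 →
    0 ≤ (-1) ^ N * (truncExp N y - Real.exp y) := by
  induction N with
  | zero =>
    intro y hy
    have : Real.exp y ≤ 1 := Real.exp_le_one_iff.2 hy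
    simp [truncExp, this]
  | succ N ih =>
    intro y hy
    have hd : ∀ z, HasDerivAt (fun z => (-1) ^ (N + 1) * (truncExp (N + 1) z - Real.exp z))
        ((-1) ^ (N + 1) * (truncExp N z - Real.exp z)) z := fun z =>
      ((hasDerivAt_truncExp_succ N z).sub (Real.hasDerivAt_exp z)).const_mul _
    have hanti : AntitoneOn (fun z => (-1) ^ (N + 1) * (truncExp (N + 1) z - Real.exp z))
        (Set.Iic 0) := by
      refine antitoneOn_of_deriv_nonpos (convex_Iic 0)
        (fun z _ => (hd z).continuousAt.continuousWithinAt)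
        (fun z _ => (hd z).differentiableAt.differentiableWithinAt) fun z hz => ?_
      rw [interior_Iic] at hz
      rw [(hd z).deriv, pow_succ]
      have := ih z hz.le
      linarith
    have h1 := hanti (Set.mem_Iic.2 hy) (Set.mem_Iic.2 le_rfl) hy
    have h0 : truncExp (N + 1) 0 = 1 := by
      rw [truncExp, Finset.sum_range_succ']; simp
    simp only [h0, Real.exp_zero, sub_self, mul_zero] at h1
    exact h1

lemma truncExp_nonneg {N : ℕ} (hN : Even N) (y : ℝ) : 0 ≤ truncExp N y := by
  rcases le_total 0 y with hy | hy
  · linarith [one_le_truncExp N hy]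
  · have := truncExp_alternating N y hy
    rw [hN.neg_one_pow, one_mul] at this
    linarith [Real.exp_pos y]

lemma truncExp_le_of_nonpos {N : ℕ} (hN : Even N) (hN0 : N ≠ 0) {y : ℝ} (hy : y ≤ 0) :
    truncExp N y ≤ 1 + y ^ N / (N.factorial : ℝ) := by
  obtain ⟨M, rfl⟩ := Nat.exists_eq_succ_of_ne_zero hN0
  have hM : Odd M := by
    rcases Nat.even_or_odd M with h | h
    · exact absurd hN (by simpa using h.add_one)
    · exact h
  have := truncExp_alternating M y hy
  rw [hM.neg_one_pow] at this
  have h1 : Real.exp y ≤ 1 := Real.exp_le_one_iff.2 hy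
  rw [Nat.succ_eq_add_one, truncExp_succ]
  linarith

/-- The ratio `truncExp N (s' x) / truncExp N (s x)` is nondecreasing in `x ≥ 0` for `s ≤ s'`. -/
lemma truncExp_mul_le (N : ℕ) {s s' a x : ℝ} (hs : 0 ≤ s) (hss : s ≤ s') (ha : 0 ≤ a)
    (hax : a ≤ x) :
    truncExp N (s * x) * truncExp N (s' * a) ≤ truncExp N (s' * x) * truncExp N (s * a) := by
  -- symmetrize the double sum over the two expansion indices
  have key : ∀ j k : ℕ, 0 ≤ (s' ^ j * s ^ k - s ^ j * s' ^ k) * (x ^ j * a ^ k - x ^ k * a ^ j) := by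
    have aux : ∀ j k : ℕ, k ≤ j → ∀ b c : ℝ, 0 ≤ b → b ≤ c → b ^ j * c ^ k ≤ c ^ j * b ^ k := by
      intro j k hkj b c hb hbc
      obtain ⟨d, rfl⟩ := Nat.exists_eq_add_of_le hkj
      have h1 : b ^ d ≤ c ^ d := pow_le_pow_left₀ hb hbc d
      have h2 : 0 ≤ b ^ k * c ^ k := by
        have : 0 ≤ c := hb.trans hbc
        positivity
      rw [pow_add, pow_add]
      nlinarith
    intro j k
    rcases le_total k j with h | h
    · have h1 := aux j k h s s' hs hss
      have h2 := aux j k h a x ha hax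
      exact mul_nonneg (by linarith) (by linarith)
    · have h1 := aux k j h s s' hs hss
      have h2 := aux k j h a x ha hax
      exact mul_nonneg_of_nonpos_of_nonpos (by linarith) (by linarith)
  set R := Finset.range (N + 1) with hR
  have e1 : truncExp N (s' * x) * truncExp N (s * a) - truncExp N (s * x) * truncExp N (s' * a) =
      ∑ j ∈ R, ∑ k ∈ R, ((s' ^ j * s ^ k - s ^ j * s' ^ k) * (x ^ j * a ^ k)) /
        ((j.factorial : ℝ) * k.factorial) := by
    unfold truncExp
    rw [Finset.sum_mul_sum, Finset.sum_mul_sum, ← Finset.sum_sub_distrib]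
    refine Finset.sum_congr rfl fun j _ => ?_
    rw [← Finset.sum_sub_distrib]
    refine Finset.sum_congr rfl fun k _ => ?_
    simp only [mul_pow]
    field_simp
  have e2 : truncExp N (s' * x) * truncExp N (s * a) - truncExp N (s * x) * truncExp N (s' * a) =
      ∑ j ∈ R, ∑ k ∈ R, -((s' ^ j * s ^ k - s ^ j * s' ^ k) * (x ^ k * a ^ j)) /
        ((j.factorial : ℝ) * k.factorial) := by
    rw [e1, Finset.sum_comm]
    refine Finset.sum_congr rfl fun j _ => Finset.sum_congr rfl fun k _ => ?_
    rw [mul_comm (k.factorial : ℝ)]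
    congr 1; ring
  have e3 : 0 ≤ ∑ j ∈ R, ∑ k ∈ R, ((s' ^ j * s ^ k - s ^ j * s' ^ k) *
      (x ^ j * a ^ k - x ^ k * a ^ j)) / ((j.factorial : ℝ) * k.factorial) :=
    Finset.sum_nonneg fun j _ => Finset.sum_nonneg fun k _ => div_nonneg (key j k) (by positivity)
  have e4 : ∑ j ∈ R, ∑ k ∈ R, ((s' ^ j * s ^ k - s ^ j * s' ^ k) *
      (x ^ j * a ^ k - x ^ k * a ^ j)) / ((j.factorial : ℝ) * k.factorial) =
      2 * (truncExp N (s' * x) * truncExp N (s * a) -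
        truncExp N (s * x) * truncExp N (s' * a)) := by
    rw [two_mul]
    nth_rewrite 1 [e1]
    rw [e2, ← Finset.sum_add_distrib]
    refine Finset.sum_congr rfl fun j _ => ?_
    rw [← Finset.sum_add_distrib]
    refine Finset.sum_congr rfl fun k _ => ?_
    ring
  linarith

/-! ### Tail bounds from truncated exponential moments -/

section Tail

variable {Ω : Type*} [MeasurableSpace Ω] {P : Measure Ω} {H : Ω → ℝ}
  {N : ℕ}

lemma integrable_truncExp (hi : ∀ k ≤ N, Integrable (fun ω => H ω ^ k) P) (s : ℝ) :
    Integrable (fun ω => truncExp N (s * H ω)) P := by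
  unfold truncExp
  refine integrable_finsetSum _ fun k hk => ?_
  have h1 := (hi k (Nat.lt_succ_iff.1 (Finset.mem_range.1 hk))).const_mul (s ^ k / k.factorial)
  refine h1.congr (Eventually.of_forall fun ω => ?_)
  simp only [mul_pow]; ring

lemma integral_truncExp (hi : ∀ k ≤ N, Integrable (fun ω => H ω ^ k) P) (s : ℝ) :
    ∫ ω, truncExp N (s * H ω) ∂P =
      ∑ k ∈ Finset.range (N + 1), s ^ k / k.factorial * ∫ ω, H ω ^ k ∂P := by
  unfold truncExp
  rw [integral_finsetSum]
  · refine Finset.sum_congr rfl fun k _ => ?_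
    rw [← integral_const_mul]
    refine integral_congr_ae (Eventually.of_forall fun ω => ?_)
    simp only [mul_pow]; ring
  · intro k hk
    have h1 := (hi k (Nat.lt_succ_iff.1 (Finset.mem_range.1 hk))).const_mul (s ^ k / k.factorial)
    refine h1.congr (Eventually.of_forall fun ω => ?_)
    simp only [mul_pow]; ring

/-- Markov's inequality for the truncated exponential. -/
lemma prob_mul_truncExp_le [IsProbabilityMeasure P] (hH : Measurable H) (hN : Even N)
    (hi : ∀ k ≤ N, Integrable (fun ω => H ω ^ k) P) {s V : ℝ} (hs : 0 ≤ s) (hV : 0 ≤ V) :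
    P.real {ω | V < H ω} * truncExp N (s * V) ≤ ∫ ω, truncExp N (s * H ω) ∂P := by
  have hm : MeasurableSet {ω | V < H ω} := measurableSet_lt measurable_const hH
  have h1 : P.real {ω | V < H ω} * truncExp N (s * V) =
      ∫ ω, Set.indicator {ω | V < H ω} (fun _ => truncExp N (s * V)) ω ∂P := by
    rw [integral_indicator_const _ hm, smul_eq_mul]
  rw [h1]
  refine integral_mono ((integrable_const _).indicator hm) (integrable_truncExp hi s) fun ω => ?_
  by_cases h : V < H ω
  · rw [Set.indicator_of_mem (by exact h)]
    exact truncExp_mono N (by positivity) (by gcongr)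
  · rw [Set.indicator_of_notMem (by exact h)]
    exact truncExp_nonneg hN _

/-- The mass of the (truncated) exponentially tilted measure outside the window `(a, b]` is bounded
by the moments at the neighbouring parameters `s₁ ≤ s ≤ s₂`. -/
lemma integral_truncExp_le_of_window [IsProbabilityMeasure P] (hH : Measurable H)
    (hN : Even N) (hN0 : N ≠ 0)
    (hi : ∀ k ≤ N, Integrable (fun ω => H ω ^ k) P) {s₁ s s₂ a b : ℝ} (hs₁ : 0 ≤ s₁)
    (h1 : s₁ ≤ s) (h2 : s ≤ s₂) (ha : 0 ≤ a) (hab : a ≤ b) :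
    ∫ ω, truncExp N (s * H ω) ∂P ≤
      1 + s ^ N / N.factorial * ∫ ω, H ω ^ N ∂P + truncExp N (s * b) * P.real {ω | a < H ω} +
        truncExp N (s * b) / truncExp N (s₂ * b) * ∫ ω, truncExp N (s₂ * H ω) ∂P +
        truncExp N (s * a) / truncExp N (s₁ * a) * ∫ ω, truncExp N (s₁ * H ω) ∂P := by
  have hm : MeasurableSet {ω | a < H ω} := measurableSet_lt measurable_const hH
  have hs : 0 ≤ s := hs₁.trans h1
  have hb : 0 ≤ b := ha.trans hab
  have hT : ∀ y, 0 ≤ truncExp N y := truncExp_nonneg hN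
  have hTb : 0 < truncExp N (s₂ * b) := by
    linarith [one_le_truncExp N (mul_nonneg (hs.trans h2) hb)]
  have hTa : 0 < truncExp N (s₁ * a) := by linarith [one_le_truncExp N (mul_nonneg hs₁ ha)]
  have i2 : Integrable (fun ω => s ^ N / N.factorial * H ω ^ N) P := (hi N le_rfl).const_mul _
  have i3 : Integrable (Set.indicator {ω | a < H ω} fun _ => truncExp N (s * b)) P :=
    (integrable_const _).indicator hm
  have i4 := (integrable_truncExp hi s₂).const_mul (truncExp N (s * b) / truncExp N (s₂ * b))
  have i5 := (integrable_truncExp hi s₁).const_mul (truncExp N (s * a) / truncExp N (s₁ * a))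
  have i12 : Integrable (fun ω => 1 + s ^ N / N.factorial * H ω ^ N) P :=
    (integrable_const _).add i2
  have i123 : Integrable (fun ω => 1 + s ^ N / N.factorial * H ω ^ N +
      Set.indicator {ω | a < H ω} (fun _ => truncExp N (s * b)) ω) P := i12.add i3
  have i1234 : Integrable (fun ω => 1 + s ^ N / N.factorial * H ω ^ N +
      Set.indicator {ω | a < H ω} (fun _ => truncExp N (s * b)) ω +
      truncExp N (s * b) / truncExp N (s₂ * b) * truncExp N (s₂ * H ω)) P := i123.add i4
  have e : 1 + s ^ N / N.factorial * ∫ ω, H ω ^ N ∂P + truncExp N (s * b) * P.real {ω | a < H ω} +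
        truncExp N (s * b) / truncExp N (s₂ * b) * ∫ ω, truncExp N (s₂ * H ω) ∂P +
        truncExp N (s * a) / truncExp N (s₁ * a) * ∫ ω, truncExp N (s₁ * H ω) ∂P =
      ∫ ω, (1 + s ^ N / N.factorial * H ω ^ N +
        Set.indicator {ω | a < H ω} (fun _ => truncExp N (s * b)) ω +
        truncExp N (s * b) / truncExp N (s₂ * b) * truncExp N (s₂ * H ω) +
        truncExp N (s * a) / truncExp N (s₁ * a) * truncExp N (s₁ * H ω)) ∂P := by
    rw [integral_add i1234 i5, integral_add i123 i4, integral_add i12 i3,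
      integral_add (integrable_const _) i2, integral_indicator_const _ hm, integral_const_mul,
      integral_const_mul, integral_const_mul]
    simp [mul_comm]
  rw [e]
  refine integral_mono (integrable_truncExp hi s) (i1234.add i5) fun ω => ?_
  show truncExp N (s * H ω) ≤ 1 + s ^ N / N.factorial * H ω ^ N +
        Set.indicator {ω | a < H ω} (fun _ => truncExp N (s * b)) ω +
        truncExp N (s * b) / truncExp N (s₂ * b) * truncExp N (s₂ * H ω) +
        truncExp N (s * a) / truncExp N (s₁ * a) * truncExp N (s₁ * H ω)
  have p2 : 0 ≤ s ^ N / N.factorial * H ω ^ N := by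
    have := hN.pow_nonneg (H ω)
    positivity
  have p3 : 0 ≤ Set.indicator {ω | a < H ω} (fun _ => truncExp N (s * b)) ω :=
    Set.indicator_nonneg (fun _ _ => hT _) _
  have p4 : 0 ≤ truncExp N (s * b) / truncExp N (s₂ * b) * truncExp N (s₂ * H ω) :=
    mul_nonneg (div_nonneg (hT _) (hT _)) (hT _)
  have p5 : 0 ≤ truncExp N (s * a) / truncExp N (s₁ * a) * truncExp N (s₁ * H ω) :=
    mul_nonneg (div_nonneg (hT _) (hT _)) (hT _)
  -- the four ranges `H ≤ 0`, `0 < H ≤ a`, `a < H ≤ b` and `b < H` account for the summands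
  rcases le_or_gt (H ω) 0 with h0 | h0
  · have := truncExp_le_of_nonpos hN hN0 (mul_nonpos_of_nonneg_of_nonpos hs h0)
    rw [mul_pow] at this
    have e2 : s ^ N * H ω ^ N / N.factorial = s ^ N / N.factorial * H ω ^ N := by ring
    linarith
  rcases le_or_gt (H ω) a with h3 | h3
  · have h4 := truncExp_mul_le N hs₁ h1 h0.le h3
    have h5 : truncExp N (s * H ω) ≤
        truncExp N (s * a) / truncExp N (s₁ * a) * truncExp N (s₁ * H ω) := by
      rw [div_mul_eq_mul_div, le_div_iff₀ hTa]
      linarith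
    linarith
  rcases le_or_gt (H ω) b with h4 | h4
  · rw [Set.indicator_of_mem (by exact h3)] at p3 ⊢
    have := truncExp_mono N (mul_nonneg hs h0.le) (mul_le_mul_of_nonneg_left h4 hs)
    linarith
  · have h5 := truncExp_mul_le N hs h2 hb h4.le
    have h6 : truncExp N (s * H ω) ≤
        truncExp N (s * b) / truncExp N (s₂ * b) * truncExp N (s₂ * H ω) := by
      rw [div_mul_eq_mul_div, le_div_iff₀ hTb]
      linarith
    linarith

end Tail

section

variable {β : ℝ} {q : ℕ+ → ℝ} {α A B : ℝ}

/-! ### Transfer of truncated exponential moments under `AIH` -/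

lemma WellBehaved.weightedSum_eq (hq : WellBehaved q α β A B) {Ω : Type*} (X : ℕ+ → Ω → ℝ)
    (Q : ℝ) (ω : Ω) : weightedSum q X Q ω = ∑ n ∈ hq.upTo Q, X n ω / q n :=
  finsum_mem_eq_finite_toFinset_sum _ _

lemma WellBehaved.weightedSum_pow (hq : WellBehaved q α β A B) {Ω : Type*} (X : ℕ+ → Ω → ℝ) (Q : ℝ)
    (k : ℕ) (ω : Ω) : weightedSum q X Q ω ^ k =
      ∑ p ∈ Fintype.piFinset fun _ : Fin k => hq.upTo Q, (∏ i, 1 / q (p i)) * ∏ i, X (p i) ω := by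
  rw [hq.weightedSum_eq, Finset.sum_pow']
  refine Finset.sum_congr rfl fun p _ => ?_
  rw [← Finset.prod_mul_distrib]
  exact Finset.prod_congr rfl fun i _ => by ring

section Moments

variable {Ω : Type*} [MeasurableSpace Ω] {P : Measure Ω}

lemma WellBehaved.integrable_weightedSum_pow (hq : WellBehaved q α β A B) {X : ℕ+ → Ω → ℝ}
    {Q : ℝ} {k : ℕ} (hX : ∀ n : Fin k → ℕ+, (∀ i, n i ∈ idx q Q) →
      Integrable (fun ω => ∏ i, X (n i) ω) P) :
    Integrable (fun ω => weightedSum q X Q ω ^ k) P := by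
  simp_rw [hq.weightedSum_pow]
  refine integrable_finsetSum _ fun p hp => (hX p fun i => ?_).const_mul _
  exact hq.mem_upTo.1 (Fintype.mem_piFinset.1 hp i)

lemma WellBehaved.integral_weightedSum_pow (hq : WellBehaved q α β A B) {X : ℕ+ → Ω → ℝ}
    {Q : ℝ} {k : ℕ} (hX : ∀ n : Fin k → ℕ+, (∀ i, n i ∈ idx q Q) →
      Integrable (fun ω => ∏ i, X (n i) ω) P) :
    ∫ ω, weightedSum q X Q ω ^ k ∂P = ∑ p ∈ Fintype.piFinset fun _ : Fin k => hq.upTo Q,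
      (∏ i, 1 / q (p i)) * ∫ ω, ∏ i, X (p i) ω ∂P := by
  simp_rw [hq.weightedSum_pow]
  rw [integral_finsetSum]
  · exact Finset.sum_congr rfl fun p _ => integral_const_mul _ _
  · exact fun p hp => (hX p fun i => hq.mem_upTo.1 (Fintype.mem_piFinset.1 hp i)).const_mul _

lemma WellBehaved.measurable_weightedSum (hq : WellBehaved q α β A B) {X : ℕ+ → Ω → ℝ} {Q : ℝ}
    (hX : ∀ n ∈ idx q Q, Measurable (X n)) : Measurable (weightedSum q X Q) := by
  have h : weightedSum q X Q = fun ω => ∑ n ∈ hq.upTo Q, X n ω / q n :=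
    funext fun ω => hq.weightedSum_eq X Q ω
  rw [h]
  exact Finset.measurable_sum _ fun n hn => (hX n (hq.mem_upTo.1 hn)).div_const _

lemma WellBehaved.abs_weightedSum_le (hq : WellBehaved q α β A B) {Y : ℕ+ → Ω → ℝ} {Q : ℝ}
    (hY : ∀ n, ∀ᵐ ω ∂P, Y n ω ∈ Set.Icc (-1 : ℝ) 1) :
    ∀ᵐ ω ∂P, |weightedSum q Y Q ω| ≤ harmonicSum q Q := by
  filter_upwards [ae_all_iff.2 hY] with ω h
  rw [hq.weightedSum_eq, hq.harmonicSum_eq]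
  refine (Finset.abs_sum_le_sum_abs _ _).trans (Finset.sum_le_sum fun n _ => ?_)
  have := hq.pos n
  rw [abs_div, abs_of_pos this]
  gcongr
  exact abs_le.2 (h n)

/-- Under independence the moment generating function of the weighted sum is a product. -/
lemma WellBehaved.mgf_weightedSum (hq : WellBehaved q α β A B) [IsProbabilityMeasure P]
    {Y : ℕ+ → Ω → ℝ} (hm : ∀ n, Measurable (Y n)) (hi : iIndepFun Y P)
    (hY : ∀ n, ∀ᵐ ω ∂P, Y n ω ∈ Set.Icc (-1 : ℝ) 1) (Q σ : ℝ) :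
    ∫ ω, Real.exp (σ * weightedSum q Y Q ω) ∂P =
      Real.exp (∑ n ∈ hq.upTo Q, cgf (Y n) P (σ / q n)) := by
  have hi' : iIndepFun (fun n ω => (q n)⁻¹ * Y n ω) P :=
    hi.comp (fun n x => (q n)⁻¹ * x) fun n => measurable_const_mul _
  have h1 := hi'.mgf_sum (t := σ) (fun n => (hm n).const_mul _) (hq.upTo Q)
  have h2 : mgf (∑ n ∈ hq.upTo Q, fun ω => (q n)⁻¹ * Y n ω) P σ =
      ∫ ω, Real.exp (σ * weightedSum q Y Q ω) ∂P := by
    rw [mgf]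
    refine integral_congr_ae (Eventually.of_forall fun ω => ?_)
    simp only [Finset.sum_apply]
    rw [hq.weightedSum_eq]
    congr 2
    exact Finset.sum_congr rfl fun n _ => by ring
  rw [← h2, h1, Real.exp_sum]
  refine Finset.prod_congr rfl fun n _ => ?_
  rw [mgf_const_mul, cgf, Real.exp_log, inv_mul_eq_div]
  exact mgf_pos (integrable_exp_mul_of_abs_le_one (hm n).aemeasurable
    ((hY n).mono fun ω h => abs_le.2 h) _)

end Moments

section Transfer

variable {Ω Ω' : Type*} [MeasurableSpace Ω] [MeasurableSpace Ω'] {P : Measure Ω}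
  {P' : Measure Ω'} {X : ℕ+ → Ω → ℝ} {Y : ℕ+ → Ω' → ℝ} {L Q K : ℝ}

lemma AIH.abs_integral_pow_sub_le (hq : WellBehaved q α β A B) (h : AIH q L Q K P X P' Y)
    {k : ℕ} (hk : (k : ℝ) ≤ L) :
    |∫ ω, weightedSum q X Q ω ^ k ∂P - ∫ ω, weightedSum q Y Q ω ^ k ∂P'| ≤
      K * Real.exp (-L) * harmonicSum q Q ^ k := by
  rw [hq.integral_weightedSum_pow (h.integrable_left k hk),
    hq.integral_weightedSum_pow (h.integrable_right k hk), ← Finset.sum_sub_distrib,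
    hq.harmonicSum_eq, Finset.sum_pow', Finset.mul_sum]
  refine (Finset.abs_sum_le_sum_abs _ _).trans (Finset.sum_le_sum fun p hp => ?_)
  have h1 : 0 ≤ ∏ i, 1 / q (p i) :=
    Finset.prod_nonneg fun i _ => by have := hq.pos (p i); positivity
  rw [← mul_sub, abs_mul, abs_of_nonneg h1, mul_comm]
  exact mul_le_mul_of_nonneg_right
    (h.approx k hk p fun i => hq.mem_upTo.1 (Fintype.mem_piFinset.1 hp i)) h1

variable [IsProbabilityMeasure P'] {N : ℕ} {σ : ℝ}

lemma AIH.abs_truncExp_moment_sub_le (hq : WellBehaved q α β A B) (h : AIH q L Q K P X P' Y)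
    (hK : 0 ≤ K) (hm : ∀ n, Measurable (Y n)) (hi : iIndepFun Y P')
    (hY : ∀ n, ∀ᵐ ω ∂P', Y n ω ∈ Set.Icc (-1 : ℝ) 1) (hN : (N : ℝ) ≤ L) (hσ : 0 ≤ σ)
    (hσN : 6 * (σ * harmonicSum q Q) ≤ N) :
    |∫ ω, truncExp N (σ * weightedSum q X Q ω) ∂P -
      Real.exp (∑ n ∈ hq.upTo Q, cgf (Y n) P' (σ / q n))| ≤ (K + 1) * Real.exp (-(N / 2)) := by
  have hkL : ∀ k ≤ N, (k : ℝ) ≤ L := fun k hk => le_trans (by exact_mod_cast hk) hN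
  have hH := hq.harmonicSum_nonneg Q
  have hiX : ∀ k ≤ N, Integrable (fun ω => weightedSum q X Q ω ^ k) P := fun k hk =>
    hq.integrable_weightedSum_pow (h.integrable_left k (hkL k hk))
  have hiY : ∀ k ≤ N, Integrable (fun ω => weightedSum q Y Q ω ^ k) P' := fun k hk =>
    hq.integrable_weightedSum_pow (h.integrable_right k (hkL k hk))
  have h1 : |∫ ω, truncExp N (σ * weightedSum q X Q ω) ∂P -
      ∫ ω, truncExp N (σ * weightedSum q Y Q ω) ∂P'| ≤ K * Real.exp (-(N / 2)) := by
    rw [integral_truncExp hiX, integral_truncExp hiY, ← Finset.sum_sub_distrib]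
    calc _ ≤ ∑ k ∈ Finset.range (N + 1), K * Real.exp (-L) *
          ((σ * harmonicSum q Q) ^ k / k.factorial) := by
          refine (Finset.abs_sum_le_sum_abs _ _).trans (Finset.sum_le_sum fun k hk => ?_)
          have hk' := hkL k (Nat.lt_succ_iff.1 (Finset.mem_range.1 hk))
          rw [← mul_sub, abs_mul, abs_of_nonneg (by positivity), mul_pow]
          calc _ ≤ σ ^ k / k.factorial * (K * Real.exp (-L) * harmonicSum q Q ^ k) := by
                gcongr
                exact h.abs_integral_pow_sub_le hq hk'
            _ = _ := by ring
      _ = K * Real.exp (-L) * truncExp N (σ * harmonicSum q Q) := by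
          rw [← Finset.mul_sum]; rfl
      _ ≤ K * Real.exp (-L) * Real.exp (σ * harmonicSum q Q) := by
          gcongr
          exact truncExp_le_exp N (by positivity)
      _ = K * Real.exp (-L + σ * harmonicSum q Q) := by rw [mul_assoc, ← Real.exp_add]
      _ ≤ _ := by
          gcongr
          have : 0 ≤ σ * harmonicSum q Q := by positivity
          linarith
  have h2 : |∫ ω, truncExp N (σ * weightedSum q Y Q ω) ∂P' -
      ∫ ω, Real.exp (σ * weightedSum q Y Q ω) ∂P'| ≤ Real.exp (-(N / 2)) := by
    have hb := hq.abs_weightedSum_le (Q := Q) hY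
    have hmW : Measurable (weightedSum q Y Q) := hq.measurable_weightedSum fun n _ => hm n
    have hie : Integrable (fun ω => Real.exp (σ * weightedSum q Y Q ω)) P' :=
      integrable_exp_mul_of_mem_Icc hmW.aemeasurable
        (hb.mono fun ω h => abs_le.1 h)
    rw [← integral_sub (integrable_truncExp hiY σ) hie, ← Real.norm_eq_abs]
    refine (norm_integral_le_of_norm_le (integrable_const (Real.exp (-(N / 2)))) ?_).trans
      (by simp)
    filter_upwards [hb] with ω hω
    rw [Real.norm_eq_abs, abs_sub_comm]
    refine (abs_exp_sub_truncExp_le N _).trans (Real.exp_le_exp.2 ?_)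
    rw [abs_mul, abs_of_nonneg hσ]
    have : σ * |weightedSum q Y Q ω| ≤ σ * harmonicSum q Q := by gcongr
    linarith
  rw [hq.mgf_weightedSum hm hi hY Q σ] at h2
  calc _ ≤ _ := abs_sub_le _ (∫ ω, truncExp N (σ * weightedSum q Y Q ω) ∂P') _
    _ ≤ K * Real.exp (-(N / 2)) + Real.exp (-(N / 2)) := add_le_add h1 h2
    _ = _ := by ring

lemma AIH.top_moment_le (hq : WellBehaved q α β A B) (h : AIH q L Q K P X P' Y)
    (hK : 0 ≤ K) (hY : ∀ n, ∀ᵐ ω ∂P', Y n ω ∈ Set.Icc (-1 : ℝ) 1) (hN : (N : ℝ) ≤ L)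
    (hσ : 0 ≤ σ) (hσN : 6 * (σ * harmonicSum q Q) ≤ N) :
    σ ^ N / N.factorial * ∫ ω, weightedSum q X Q ω ^ N ∂P ≤ (K + 1) * Real.exp (-(N / 2)) := by
  have hH := hq.harmonicSum_nonneg Q
  have h1 := (abs_le.1 (h.abs_integral_pow_sub_le hq hN)).2
  have h2 : ∫ ω, weightedSum q Y Q ω ^ N ∂P' ≤ harmonicSum q Q ^ N := by
    calc _ ≤ ∫ _, harmonicSum q Q ^ N ∂P' := by
          refine integral_mono_ae (hq.integrable_weightedSum_pow (h.integrable_right N hN))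
            (integrable_const _) ?_
          filter_upwards [hq.abs_weightedSum_le (Q := Q) hY] with ω hω
          calc weightedSum q Y Q ω ^ N ≤ |weightedSum q Y Q ω ^ N| := le_abs_self _
            _ = |weightedSum q Y Q ω| ^ N := abs_pow _ _
            _ ≤ _ := by gcongr
      _ = _ := by simp
  have h3 : Real.exp (-L) ≤ 1 := Real.exp_le_one_iff.2 (by
    have : (0 : ℝ) ≤ N := Nat.cast_nonneg N
    linarith)
  have h4 : ∫ ω, weightedSum q X Q ω ^ N ∂P ≤ (K + 1) * harmonicSum q Q ^ N := by
    have : K * Real.exp (-L) * harmonicSum q Q ^ N ≤ K * 1 * harmonicSum q Q ^ N := by gcongr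
    linarith
  calc _ ≤ σ ^ N / N.factorial * ((K + 1) * harmonicSum q Q ^ N) := by gcongr
    _ = (K + 1) * ((σ * harmonicSum q Q) ^ N / N.factorial) := by rw [mul_pow]; ring
    _ ≤ (K + 1) * Real.exp (3 * (σ * harmonicSum q Q) - N) := by
        gcongr
        exact pow_div_factorial_le N (by positivity)
    _ ≤ _ := by
        gcongr
        linarith

end Transfer

end

section

variable {β : ℝ} {q : ℕ+ → ℝ} {α A B : ℝ}

/-! ### The saddle point -/

/-- The relative error in the theorem. -/
def relErr (B W : ℝ) : ℝ := √(Real.log W) / W ^ (1 / 2 : ℝ) + 1 / W ^ ((B - 1) / 2)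

lemma relErr_pos {B W : ℝ} (hW : 0 < W) : 0 < relErr B W := by
  unfold relErr; positivity

lemma le_relErr_sq {B W : ℝ} (hW : 1 ≤ W) :
    Real.log W / W + W ^ (1 - B) ≤ relErr B W ^ 2 := by
  have hW0 : 0 < W := by linarith
  have hl : 0 ≤ Real.log W := Real.log_nonneg hW
  have e1 : (√(Real.log W) / W ^ (1 / 2 : ℝ)) ^ 2 = Real.log W / W := by
    rw [div_pow, Real.sq_sqrt hl, ← Real.sqrt_eq_rpow, Real.sq_sqrt hW0.le]
  have e2 : (1 / W ^ ((B - 1) / 2)) ^ 2 = W ^ (1 - B) := by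
    rw [one_div, ← Real.rpow_neg hW0.le, ← Real.rpow_natCast, ← Real.rpow_mul hW0.le]
    congr 1; push_cast; ring
  have h1 : 0 ≤ √(Real.log W) / W ^ (1 / 2 : ℝ) := by positivity
  have h2 : 0 ≤ 1 / W ^ ((B - 1) / 2) := by positivity
  rw [relErr, add_sq, e1, e2]
  nlinarith [mul_nonneg h1 h2]

lemma tendsto_relErr {B : ℝ} (hB : 1 < B) : Tendsto (relErr B) atTop (𝓝 0) := by
  have h1 : Tendsto (fun W : ℝ => √(Real.log W) / W ^ (1 / 2 : ℝ)) atTop (𝓝 0) := by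
    have h := (Real.isLittleO_log_id_atTop.tendsto_div_nhds_zero).sqrt
    rw [Real.sqrt_zero] at h
    refine h.congr' ?_
    filter_upwards [eventually_ge_atTop 1] with W hW
    rw [Real.sqrt_div (Real.log_nonneg hW), id, Real.sqrt_eq_rpow W]
  have h2 : Tendsto (fun W : ℝ => 1 / W ^ ((B - 1) / 2)) atTop (𝓝 0) := by
    refine (tendsto_rpow_neg_atTop (show 0 < (B - 1) / 2 by linarith)).congr' ?_
    filter_upwards [eventually_ge_atTop 0] with W hW
    rw [Real.rpow_neg hW, one_div]
  have h := h1.add h2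
  rw [add_zero] at h
  exact h

/-- The logarithm of the moment generating function at `s = β e ^ y`, linearized around
`y = W`. -/
theorem WellBehaved.exists_sum_cgf_sub_linear_le (hq : WellBehaved q α β A B) (hα : 0 < α)
    (hβ : 0 < β) (hA : 0 ≤ A) (hB : 0 < B) (hAB : A < B) {C K₀ : ℝ} (hK₀ : 0 < K₀)
    (hH : ∀ y : ℝ, 2 * (2 + β) ^ 2 ≤ y →
      |harmonicSum q y - harmonicMain α β A y - C| ≤ K₀ * ell β y ^ (A - B))
    {K₁ D E : ℝ} (hK₁ : 0 ≤ K₁) (hD : 0 < D) (hE : 0 ≤ E) : ∃ K : ℝ, 0 < K ∧ ∀ᶠ W in atTop,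
      ∀ (g : ℕ+ → ℝ → ℝ) (g₀ g₀' : ℝ → ℝ), CgfFamily K₁ g g₀ g₀' →
      ∀ y Q, |y - W| ≤ E → β * Real.exp y * y ≤ D * Q →
      |∑ n ∈ hq.upTo Q, g n (β * Real.exp y / q n) -
        β * Real.exp y * (C + mainFun α A W + α * W ^ (A - 1) * (y - W + etaOf g₀))| ≤
        K * (β * Real.exp y * (α * W ^ (A - 1)) * relErr B W ^ 2) := by
  obtain ⟨K, hK, hest⟩ := hq.exists_sum_cgf_sub_le hα hβ hA hB hAB hK₀ hH hK₁ hD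
  obtain ⟨C₁, hC₁, h₁⟩ := exists_rpow_le_mul_exp (A - 1)
  obtain ⟨C₂, hC₂, h₂⟩ := exists_rpow_le_mul_exp (-1)
  obtain ⟨C₃, hC₃, h₃⟩ := exists_rpow_le_mul_exp (1 - B)
  obtain ⟨C₄, hC₄, h₄⟩ := exists_abs_rpow_sub_rpow_le (A - 1)
  set M := Real.exp (E / 4) with hM
  have hM0 : 0 < M := Real.exp_pos _
  set F := C₄ * E * M with hF
  have hF0 : 0 ≤ F := by positivity
  refine ⟨K * (C₁ * M * (2 * C₂ * M + C₃ * M)) / α + F * E + 2 * K₁ * F + 1, by positivity, ?_⟩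
  have hexp : Tendsto (fun W => β * Real.exp (W - E)) atTop atTop :=
    (Real.tendsto_exp_atTop.comp (tendsto_atTop_add_const_right _ (-E) tendsto_id)).const_mul_atTop hβ
  obtain ⟨s₀, hs₀⟩ := eventually_atTop.1 hest
  filter_upwards [hexp.eventually_ge_atTop s₀, eventually_ge_atTop (E + 2 + Real.exp 1)]
    with W hW1 hW2 g g₀ g₀' hfam y Q hy hyQ
  have hy' := abs_le.1 hy
  have he1 : 2 ≤ Real.exp 1 := by linarith [Real.add_one_le_exp 1]
  have hW : 1 ≤ W := by linarith
  have hW0 : 0 < W := by linarith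
  have hy1 : 1 ≤ y := by linarith
  have hlogW : 1 ≤ Real.log W := by
    rw [Real.le_log_iff_exp_le hW0]; linarith
  set s := β * Real.exp y with hs
  have hspos : 0 < s := by positivity
  have hell : ell β s = y := by
    rw [ell, hs, mul_div_cancel_left₀ _ hβ.ne', Real.log_exp]
  have hss : s₀ ≤ s := hW1.trans (by rw [hs]; gcongr; linarith)
  have hmain := hs₀ s hss g g₀ g₀' hfam Q (by rw [hell]; exact hyQ)
  rw [hell, harmonicMain_eq, hell] at hmain
  have hη := hfam.abs_etaOf_le
  set P := W ^ (A - 1) with hP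
  have hP0 : 0 < P := by positivity
  have hexpE : Real.exp (|y - W| / 4) ≤ M := by rw [hM]; gcongr
  have b1 : y ^ (A - 1) ≤ C₁ * P * M := (h₁ y W hy1 hW).trans (by gcongr)
  have b2 : y⁻¹ ≤ C₂ * W⁻¹ * M := by
    have := (h₂ y W hy1 hW)
    rw [Real.rpow_neg_one, Real.rpow_neg_one] at this
    exact this.trans (by gcongr)
  have b3 : y ^ (1 - B) ≤ C₃ * W ^ (1 - B) * M := (h₃ y W hy1 hW).trans (by gcongr)
  have b4 : ∀ z, |z - W| ≤ E → 1 ≤ z → |z ^ (A - 1) - P| ≤ F * (P / W) := by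
    intro z hz hz1
    calc |z ^ (A - 1) - P| ≤ C₄ * W ^ (A - 1 - 1) * |z - W| * Real.exp (|z - W| / 4) :=
          h₄ z W hz1 hW
      _ ≤ C₄ * W ^ (A - 1 - 1) * E * M := by
          rw [hM]; gcongr
      _ = _ := by rw [Real.rpow_sub_one hW0.ne', hF]; ring
  have b5 : Real.log y ≤ 2 * Real.log W := by
    calc Real.log y ≤ Real.log (W ^ 2) := Real.log_le_log (by linarith) (by nlinarith)
      _ = _ := by rw [Real.log_pow]; norm_num
  set R := relErr B W ^ 2 with hR
  have hRle := le_relErr_sq (B := B) hW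
  have hWB : 0 < W ^ (1 - B) := by positivity
  have hlW : 0 < Real.log W / W := by positivity
  have hR0 : 0 < R := by rw [hR]; linarith
  have hWR : 1 / W ≤ R := by
    have : 1 / W ≤ Real.log W / W := by gcongr
    linarith
  -- the error of the estimate at `y`
  have c1 : K * (s * (y ^ (A - 1) * (Real.log y / y + y ^ (1 - B)))) ≤
      K * (C₁ * M * (2 * C₂ * M + C₃ * M)) * (s * P * R) := by
    have hly : 0 ≤ Real.log y := Real.log_nonneg hy1
    have d1 : Real.log y / y ≤ 2 * C₂ * M * R := by
      calc Real.log y / y = Real.log y * y⁻¹ := div_eq_mul_inv _ _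
        _ ≤ (2 * Real.log W) * (C₂ * W⁻¹ * M) := by gcongr
        _ = 2 * C₂ * M * (Real.log W / W) := by ring
        _ ≤ _ := by gcongr; linarith
    have d2 : y ^ (1 - B) ≤ C₃ * M * R := by
      calc y ^ (1 - B) ≤ C₃ * W ^ (1 - B) * M := b3
        _ = C₃ * M * W ^ (1 - B) := by ring
        _ ≤ _ := by gcongr; linarith
    have d3 : 0 ≤ Real.log y / y + y ^ (1 - B) := by positivity
    calc _ ≤ K * (s * ((C₁ * P * M) * (2 * C₂ * M * R + C₃ * M * R))) := by gcongr
      _ = _ := by ring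
  -- linearization of the main term
  have c2 : |mainFun α A y - mainFun α A W - α * P * (y - W)| ≤ α * F * E * (P * R) := by
    have hsub : ∀ z ∈ Set.uIcc W y, 1 ≤ z ∧ |z - W| ≤ E := fun z hz =>
      ⟨(le_min hW hy1).trans hz.1, (Set.abs_sub_left_of_mem_uIcc hz).trans hy⟩
    have hd : ∀ z ∈ Set.uIcc W y, HasDerivWithinAt (fun z => mainFun α A z - α * P * z)
        (α * z ^ (A - 1) - α * P) (Set.uIcc W y) z := fun z hz => by
      have hz0 : 0 < z := by linarith [(hsub z hz).1]
      refine ((hasDerivAt_mainFun α A hz0).sub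
        (((hasDerivAt_id z).const_mul (α * P)).congr_deriv (mul_one _))).hasDerivWithinAt
    have hb : ∀ z ∈ Set.uIcc W y, ‖α * z ^ (A - 1) - α * P‖ ≤ α * (F * (P / W)) := fun z hz => by
      rw [← mul_sub, norm_mul, Real.norm_eq_abs, Real.norm_eq_abs, abs_of_pos hα]
      exact mul_le_mul_of_nonneg_left (b4 z (hsub z hz).2 (hsub z hz).1) hα.le
    have h := (convex_uIcc W y).norm_image_sub_le_of_norm_hasDerivWithin_le hd hb
      Set.left_mem_uIcc Set.right_mem_uIcc
    rw [Real.norm_eq_abs, Real.norm_eq_abs] at h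
    have e : mainFun α A y - α * P * y - (mainFun α A W - α * P * W) =
      mainFun α A y - mainFun α A W - α * P * (y - W) := by ring
    rw [e] at h
    calc _ ≤ α * (F * (P / W)) * |y - W| := h
      _ ≤ α * (F * (P / W)) * E := by gcongr
      _ = α * F * E * (P * (1 / W)) := by ring
      _ ≤ _ := by gcongr
  have c3 : |α * etaOf g₀ * (y ^ (A - 1) - P)| ≤ α * (2 * K₁ * F) * (P * R) := by
    rw [abs_mul, abs_mul, abs_of_pos hα]
    calc _ ≤ α * (2 * K₁) * (F * (P / W)) := by
          gcongr
          exact b4 y hy hy1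
      _ = α * (2 * K₁ * F) * (P * (1 / W)) := by ring
      _ ≤ _ := by gcongr
  have hsplit : ∑ n ∈ hq.upTo Q, g n (s / q n) -
      s * (C + mainFun α A W + α * P * (y - W + etaOf g₀)) =
      (∑ n ∈ hq.upTo Q, g n (s / q n) -
        s * (mainFun α A y + C + α * etaOf g₀ * y ^ (A - 1))) +
      s * (mainFun α A y - mainFun α A W - α * P * (y - W)) +
      s * (α * etaOf g₀ * (y ^ (A - 1) - P)) := by ring
  rw [hsplit]
  have c2' : |s * (mainFun α A y - mainFun α A W - α * P * (y - W))| ≤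
      s * (α * F * E * (P * R)) := by
    rw [abs_mul, abs_of_pos hspos]; gcongr
  have c3' : |s * (α * etaOf g₀ * (y ^ (A - 1) - P))| ≤ s * (α * (2 * K₁ * F) * (P * R)) := by
    rw [abs_mul, abs_of_pos hspos]; gcongr
  have c4 := abs_add_three (∑ n ∈ hq.upTo Q, g n (s / q n) -
        s * (mainFun α A y + C + α * etaOf g₀ * y ^ (A - 1)))
      (s * (mainFun α A y - mainFun α A W - α * P * (y - W)))
      (s * (α * etaOf g₀ * (y ^ (A - 1) - P)))
  have c5 : (K * (C₁ * M * (2 * C₂ * M + C₃ * M)) / α + F * E + 2 * K₁ * F + 1) *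
      (s * (α * P) * R) = K * (C₁ * M * (2 * C₂ * M + C₃ * M)) * (s * P * R) +
        s * (α * F * E * (P * R)) + s * (α * (2 * K₁ * F) * (P * R)) + s * (α * P) * R := by
    field_simp
  have c6 : 0 ≤ s * (α * P) * R := by positivity
  rw [c5]
  linarith

section Saddle

variable {Ω : Type*} [MeasurableSpace Ω] {P : Measure Ω} [IsProbabilityMeasure P] {H : Ω → ℝ}
  {N : ℕ} {Λ : ℝ → ℝ} {s₁ s s₂ a b V : ℝ}

lemma half_exp_le_truncExp {y : ℝ} (hy : 0 ≤ y) (h : 3 * y + 1 ≤ N) :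
    Real.exp y / 2 ≤ truncExp N y := by
  have h1 := (abs_le.1 (abs_exp_sub_truncExp_le N y)).2
  rw [abs_of_nonneg hy] at h1
  have h2 : Real.exp (3 * y - N) ≤ 1 / 2 := by
    calc Real.exp (3 * y - N) ≤ Real.exp (-1) := Real.exp_le_exp.2 (by linarith)
      _ ≤ 1 / 2 := by
          rw [Real.exp_neg, inv_le_comm₀ (Real.exp_pos _) (by norm_num)]
          linarith [Real.add_one_le_exp 1]
  linarith [Real.one_le_exp hy]

/-- If the logarithm `Λ` of the moment generating function drops by a definite amount, relative to
its tangent with slope in `[a, b]`, at neighbouring points `s₁ < s < s₂`, then the tail probability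
of `H` at `V ≤ a` is determined up to the factor `exp (s (b - V))`. -/
lemma tail_bounds_of_saddle (hH : Measurable H) (hN : Even N) (hN0 : N ≠ 0)
    (hi : ∀ k ≤ N, Integrable (fun ω => H ω ^ k) P) (hs₁ : 0 ≤ s₁) (h1 : s₁ ≤ s) (h2 : s ≤ s₂)
    (hV : 0 ≤ V) (hVa : V ≤ a) (hab : a ≤ b) (hNb : 3 * (s₂ * b) + 1 ≤ N)
    (hm₁ : |∫ ω, truncExp N (s₁ * H ω) ∂P - Real.exp (Λ s₁)| ≤ 1 / 2)
    (hm : |∫ ω, truncExp N (s * H ω) ∂P - Real.exp (Λ s)| ≤ 1 / 2)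
    (hm₂ : |∫ ω, truncExp N (s₂ * H ω) ∂P - Real.exp (Λ s₂)| ≤ 1 / 2)
    (htop : s ^ N / N.factorial * ∫ ω, H ω ^ N ∂P ≤ 1)
    (hΛ₁ : 0 ≤ Λ s₁) (hΛ : 0 ≤ Λ s) (hΛ₂ : 0 ≤ Λ s₂)
    (hdrop₁ : Λ s₁ + (s - s₁) * a + 5 ≤ Λ s) (hdrop₂ : Λ s₂ + 5 ≤ Λ s + (s₂ - s) * b) :
    Real.exp (Λ s - s * b - 3) ≤ P.real {ω | V < H ω} ∧
      P.real {ω | V < H ω} ≤ Real.exp (Λ s - s * V + 3) := by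
  have ha : 0 ≤ a := hV.trans hVa
  have hb : 0 ≤ b := ha.trans hab
  have hs : 0 ≤ s := hs₁.trans h1
  have hs₂ : 0 ≤ s₂ := hs.trans h2
  have e5 : 64 ≤ Real.exp 5 := by
    have : Real.exp 5 = Real.exp 1 ^ 5 := by rw [← Real.exp_nat_mul]; norm_num
    rw [this]
    calc (64 : ℝ) ≤ 2.7 ^ 5 := by norm_num
      _ ≤ _ := by gcongr; linarith [Real.exp_one_gt_d9]
  have e3 : 8 ≤ Real.exp 3 := by
    have : Real.exp 3 = Real.exp 1 ^ 3 := by rw [← Real.exp_nat_mul]; norm_num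
    rw [this]
    calc (8 : ℝ) ≤ 2 ^ 3 := by norm_num
      _ ≤ _ := by gcongr; linarith [Real.exp_one_gt_d9]
  have u1 : ∫ ω, truncExp N (s₁ * H ω) ∂P ≤ 3 / 2 * Real.exp (Λ s₁) := by
    linarith [(abs_le.1 hm₁).2, Real.one_le_exp hΛ₁]
  have u2 : ∫ ω, truncExp N (s₂ * H ω) ∂P ≤ 3 / 2 * Real.exp (Λ s₂) := by
    linarith [(abs_le.1 hm₂).2, Real.one_le_exp hΛ₂]
  have u3 : ∫ ω, truncExp N (s * H ω) ∂P ≤ 3 / 2 * Real.exp (Λ s) := by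
    linarith [(abs_le.1 hm).2, Real.one_le_exp hΛ]
  have u4 : 1 / 2 * Real.exp (Λ s) ≤ ∫ ω, truncExp N (s * H ω) ∂P := by
    linarith [(abs_le.1 hm).1, Real.one_le_exp hΛ]
  have hle : ∀ σ x, 0 ≤ σ → σ ≤ s₂ → 0 ≤ x → x ≤ b → 3 * (σ * x) + 1 ≤ N := by
    intro σ x hσ hσ2 hx hxb
    have : σ * x ≤ s₂ * b := by gcongr
    linarith
  have t2 := half_exp_le_truncExp (mul_nonneg hs₂ hb) (hle s₂ b hs₂ le_rfl hb le_rfl)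
  have t1 := half_exp_le_truncExp (mul_nonneg hs₁ ha) (hle s₁ a hs₁ (h1.trans h2) ha hab)
  have tV := half_exp_le_truncExp (mul_nonneg hs hV) (hle s V hs h2 hV (hVa.trans hab))
  constructor
  · have hw := integral_truncExp_le_of_window hH hN hN0 hi hs₁ h1 h2 ha hab
    have hPm : P.real {ω | a < H ω} ≤ P.real {ω | V < H ω} :=
      measureReal_mono fun ω (h : a < H ω) => hVa.trans_lt h
    have w2 : truncExp N (s * b) / truncExp N (s₂ * b) * ∫ ω, truncExp N (s₂ * H ω) ∂P ≤
        3 / 64 * Real.exp (Λ s) := by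
      have hpos : 0 < Real.exp (s₂ * b) := Real.exp_pos _
      calc _ ≤ Real.exp (s * b) / (Real.exp (s₂ * b) / 2) * (3 / 2 * Real.exp (Λ s₂)) := by
            refine mul_le_mul (div_le_div₀ (Real.exp_pos _).le
              (truncExp_le_exp N (mul_nonneg hs hb)) (by positivity) t2) u2
              (integral_nonneg fun _ => truncExp_nonneg hN _) (by positivity)
        _ = 3 * (Real.exp (s * b) / Real.exp (s₂ * b) * Real.exp (Λ s₂)) := by
            field_simp
        _ = 3 * Real.exp (s * b - s₂ * b + Λ s₂) := by rw [Real.exp_add, Real.exp_sub]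
        _ ≤ 3 * Real.exp (Λ s - 5) := by gcongr; linarith
        _ = 3 * (Real.exp (Λ s) / Real.exp 5) := by rw [Real.exp_sub]
        _ ≤ 3 * (Real.exp (Λ s) / 64) := by gcongr
        _ = _ := by ring
    have w1 : truncExp N (s * a) / truncExp N (s₁ * a) * ∫ ω, truncExp N (s₁ * H ω) ∂P ≤
        3 / 64 * Real.exp (Λ s) := by
      have hpos : 0 < Real.exp (s₁ * a) := Real.exp_pos _
      calc _ ≤ Real.exp (s * a) / (Real.exp (s₁ * a) / 2) * (3 / 2 * Real.exp (Λ s₁)) := by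
            refine mul_le_mul (div_le_div₀ (Real.exp_pos _).le
              (truncExp_le_exp N (mul_nonneg hs ha)) (by positivity) t1) u1
              (integral_nonneg fun _ => truncExp_nonneg hN _) (by positivity)
        _ = 3 * (Real.exp (s * a) / Real.exp (s₁ * a) * Real.exp (Λ s₁)) := by
            field_simp
        _ = 3 * Real.exp (s * a - s₁ * a + Λ s₁) := by rw [Real.exp_add, Real.exp_sub]
        _ ≤ 3 * Real.exp (Λ s - 5) := by gcongr; linarith
        _ = 3 * (Real.exp (Λ s) / Real.exp 5) := by rw [Real.exp_sub]
        _ ≤ 3 * (Real.exp (Λ s) / 64) := by gcongr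
        _ = _ := by ring
    have hΛ5 : 64 ≤ Real.exp (Λ s) := by
      refine e5.trans (Real.exp_le_exp.2 ?_)
      have : 0 ≤ (s - s₁) * a := mul_nonneg (by linarith) ha
      linarith
    have w3 : truncExp N (s * b) * P.real {ω | a < H ω} ≤
        Real.exp (s * b) * P.real {ω | V < H ω} := by
      gcongr
      exact truncExp_le_exp N (mul_nonneg hs hb)
    have w4 : Real.exp (Λ s) / 8 ≤ Real.exp (s * b) * P.real {ω | V < H ω} := by linarith
    have w5 : Real.exp (Λ s - s * b - 3) = Real.exp (Λ s) / Real.exp 3 / Real.exp (s * b) := by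
      rw [Real.exp_sub, Real.exp_sub]; ring
    rw [w5, div_le_iff₀ (Real.exp_pos _), mul_comm (P.real _)]
    refine le_trans ?_ w4
    gcongr
  · have hmk := prob_mul_truncExp_le hH hN hi hs hV
    have p0 : 0 ≤ P.real {ω | V < H ω} := measureReal_nonneg
    have k1 : P.real {ω | V < H ω} * (Real.exp (s * V) / 2) ≤ 3 / 2 * Real.exp (Λ s) :=
      (mul_le_mul_of_nonneg_left tV p0).trans (hmk.trans u3)
    have k2 : Real.exp (Λ s - s * V + 3) = Real.exp (Λ s) * Real.exp 3 / Real.exp (s * V) := by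
      rw [Real.exp_add, Real.exp_sub]; ring
    rw [k2, le_div_iff₀ (Real.exp_pos _)]
    nlinarith [Real.exp_pos (Λ s)]

end Saddle

end

section

variable {β : ℝ} {q : ℕ+ → ℝ} {α A B : ℝ}

/-! ### The range of the parameters -/

/-- `W(V)` is the solution of `C + mainFun α A W = V`. -/
lemma mainFun_paramW (hα : 0 < α) (hA : 0 ≤ A) {C V : ℝ} (hV : C ≤ V) :
    mainFun α A (paramW α A C V) = V - C := by
  unfold mainFun paramW
  split_ifs with h
  · rw [Real.log_exp]; field_simp
  · have h0 : 0 ≤ V - C := by linarith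
    rw [← Real.rpow_mul (by positivity), one_div_mul_cancel h, Real.rpow_one]
    field_simp

lemma tendsto_mainFun (hα : 0 < α) (hA : 0 ≤ A) : Tendsto (mainFun α A) atTop atTop := by
  unfold mainFun
  split_ifs with h
  · exact Real.tendsto_log_atTop.const_mul_atTop hα
  · have hA : 0 < A := lt_of_le_of_ne hA (Ne.symm h)
    exact (tendsto_rpow_atTop hA).const_mul_atTop (by positivity)

/-- The order of magnitude of `H(Q)`: the power `(log Q) ^ A`, times `log log Q` if `A = 0`. -/
def growth (A Q : ℝ) : ℝ := Real.log Q ^ A * if A = 0 then Real.log (Real.log Q) else 1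

lemma mainFun_le_growth (hα : 0 < α) (hA : 0 ≤ A) {m z Q : ℝ} (hm : 1 ≤ m)
    (hz : 1 ≤ z) (hz' : z ≤ m * Real.log Q) (hQ : 1 ≤ Real.log (Real.log Q))
    (hQ1 : 1 ≤ Real.log Q) :
    mainFun α A z ≤ (if A = 0 then α * (Real.log m + 1) else α / A * m ^ A) * growth A Q := by
  unfold mainFun growth
  split_ifs with h
  · have h1 : Real.log z ≤ Real.log m + Real.log (Real.log Q) := by
      rw [← Real.log_mul (by linarith) (by linarith)]
      exact Real.log_le_log (by linarith) hz'
    have h2 : 0 ≤ Real.log m := Real.log_nonneg hm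
    rw [h, Real.rpow_zero, one_mul, mul_assoc]
    refine mul_le_mul_of_nonneg_left ?_ hα.le
    nlinarith
  · rw [mul_one, mul_assoc, ← Real.mul_rpow (by linarith) (by linarith)]
    gcongr

lemma WellBehaved.exists_growth_bounds (hq : WellBehaved q α β A B) (hα : 0 < α) (hβ : 0 < β)
    (hA : 0 ≤ A) (hB : 0 < B) {C : ℝ}
    (hC : Tendsto (fun y => harmonicSum q y - harmonicMain α β A y) atTop (𝓝 C)) :
    ∃ M : ℝ, 1 ≤ M ∧ ∀ᶠ Q in atTop, M ≤ Real.log Q ∧ 1 ≤ Real.log (Real.log Q) ∧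
      1 ≤ growth A Q ∧ harmonicSum q Q ≤ M * growth A Q ∧
      (count q Q : ℝ) ≤ M * (Q * (growth A Q / Real.log Q)) ∧
      ∀ W, 1 ≤ W → W ≤ Real.log Q →
        mainFun α A W ≤ M * growth A Q ∧ α * W ^ (A - 1) ≤ M * growth A Q := by
  obtain ⟨K, hK, hcount⟩ := hq.exists_count_le hα hβ hB
  obtain ⟨C₁, hC₁, h₁⟩ := exists_rpow_le_mul_exp (A - 1)
  set m := 1 + |Real.log β| with hm
  have hm1 : 1 ≤ m := by rw [hm]; linarith [abs_nonneg (Real.log β)]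
  set M₁ := (if A = 0 then α * (Real.log m + 1) else α / A * m ^ A) with hM₁
  set M₂ := (if A = 0 then α * (Real.log 1 + 1) else α / A * 1 ^ A) with hM₂
  have hlm : 0 ≤ Real.log m := Real.log_nonneg hm1
  have hM₁0 : 0 ≤ M₁ := by rw [hM₁]; split_ifs <;> positivity
  have hM₂0 : 0 ≤ M₂ := by rw [hM₂]; split_ifs <;> simp <;> positivity
  set M₃ := K * (C₁ * Real.exp (|Real.log β| / 4)) with hM₃
  have hM₃0 : 0 ≤ M₃ := by positivity
  refine ⟨1 + M₁ + (|C| + 1) + M₂ + M₃ + α, by linarith [abs_nonneg C], ?_⟩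
  set M := 1 + M₁ + (|C| + 1) + M₂ + M₃ + α with hM
  have hll : Tendsto (fun Q => Real.log (Real.log Q)) atTop atTop :=
    Real.tendsto_log_atTop.comp Real.tendsto_log_atTop
  filter_upwards [hC.eventually_le_const (lt_add_one C), Real.tendsto_log_atTop.eventually_ge_atTop M,
    hll.eventually_ge_atTop 1, eventually_ge_atTop (2 * (2 + β) ^ 2),
    Real.tendsto_log_atTop.eventually_ge_atTop 1] with Q h1 h2 h3 h4 h5
  have h4' := four_le_threshold hβ
  have hQ0 : 0 < Q := by linarith
  have hQt : (2 + β) ^ 2 ≤ Q := by linarith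
  have hpow : Real.log Q ^ A ≤ growth A Q := by
    have : 0 < Real.log Q ^ A := by positivity
    unfold growth
    split_ifs <;> nlinarith
  have hG : 1 ≤ growth A Q := (Real.one_le_rpow h5 hA).trans hpow
  refine ⟨h2, h3, hG, ?_, ?_, fun W hW hW' => ⟨?_, ?_⟩⟩
  · have e1 := mainFun_le_growth hα hA hm1 (one_le_ell hβ hQt) (ell_le_mul_log hβ hQt) h3 h5
    rw [harmonicMain_eq] at h1
    have : |C| + 1 ≤ (|C| + 1) * growth A Q := by nlinarith [abs_nonneg C]
    calc harmonicSum q Q ≤ M₁ * growth A Q + (|C| + 1) * growth A Q := by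
          linarith [le_abs_self C]
      _ = (M₁ + (|C| + 1)) * growth A Q := by ring
      _ ≤ _ := by gcongr; rw [hM]; linarith
  · have e1 := h₁ (ell β Q) (Real.log Q) (one_le_ell hβ hQt) h5
    rw [ell_eq hβ hQ0, show Real.log Q - Real.log β - Real.log Q = -Real.log β by ring,
      abs_neg, ← ell_eq hβ hQ0] at e1
    calc (count q Q : ℝ) ≤ K * (Q * ell β Q ^ (A - 1)) := hcount Q h4
      _ ≤ K * (Q * (C₁ * Real.log Q ^ (A - 1) * Real.exp (|Real.log β| / 4))) := by gcongr
      _ = M₃ * (Q * (Real.log Q ^ A / Real.log Q)) := by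
          rw [Real.rpow_sub_one (by linarith), hM₃]; ring
      _ ≤ _ := by
          gcongr
          rw [hM]; linarith [abs_nonneg C]
  · refine (mainFun_le_growth hα hA le_rfl hW (by linarith) h3 h5).trans ?_
    rw [← hM₂]
    gcongr
    rw [hM]; linarith [abs_nonneg C]
  · calc α * W ^ (A - 1) ≤ α * W ^ A := by
          gcongr
          linarith
      _ ≤ α * Real.log Q ^ A := by gcongr
      _ ≤ α * growth A Q := by gcongr
      _ ≤ _ := by gcongr; rw [hM]; linarith [abs_nonneg C]

/-- The upper limit for `W` in multiplicative form. -/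
lemma exp_mul_growth_le {W L Q Θ : ℝ} (hL : 0 < L) (hQ : 0 < Real.log Q)
    (hQ' : 0 < Real.log (Real.log Q))
    (hW : W ≤ Real.log L - A * Real.log (Real.log Q)
      - (if A = 0 then Real.log (Real.log (Real.log Q)) else 0) - Θ) :
    Real.exp Θ * (Real.exp W * growth A Q) ≤ L := by
  have hg : growth A Q = Real.exp (A * Real.log (Real.log Q) +
      if A = 0 then Real.log (Real.log (Real.log Q)) else 0) := by
    unfold growth
    rw [Real.exp_add, Real.rpow_def_of_pos hQ, mul_comm A]
    split_ifs
    · rw [Real.exp_log hQ']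
    · rw [Real.exp_zero]
  rw [hg, ← Real.exp_add, ← Real.exp_add, ← Real.exp_log hL, Real.exp_le_exp]
  linarith

/-! ### Numerical conclusion of the saddle point argument -/

section Numerics

variable {Λ : ℝ → ℝ} {s ω V τ r K : ℝ}

lemma exp_quarter_le {τ : ℝ} (hτ : τ ≤ 1 / 4) : Real.exp (3 * τ) ≤ 3 := by
  calc Real.exp (3 * τ) ≤ Real.exp 1 := Real.exp_le_exp.2 (by linarith)
    _ ≤ 3 := by linarith [Real.exp_one_lt_d9]

/-- The drops required by `tail_bounds_of_saddle`, for points at logarithmic distance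
`τ = (4 K + 1) r` from the saddle point: the second-order gain `s ω τ ^ 2` beats the error
`K s ω r ^ 2` of the linearization. -/
lemma drops_of_linear (hs : 0 < s) (hω : 0 < ω) (hK : 0 ≤ K) (hτ : τ = (4 * K + 1) * r)
    (hr : 0 ≤ r) (hτ4 : τ ≤ 1 / 4) (hbig : 5 ≤ s * ω * r ^ 2)
    (h₁ : |Λ (s * Real.exp (-τ)) - s * Real.exp (-τ) * (V + ω * (-1 + 2 * τ))| ≤
      K * (s * Real.exp (-τ) * ω * r ^ 2))
    (h : |Λ s - s * (V + ω * (-1 + 3 * τ))| ≤ K * (s * ω * r ^ 2))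
    (h₂ : |Λ (s * Real.exp τ) - s * Real.exp τ * (V + ω * (-1 + 4 * τ))| ≤
      K * (s * Real.exp τ * ω * r ^ 2)) :
    Λ (s * Real.exp (-τ)) + (s - s * Real.exp (-τ)) * (V + ω * τ) + 5 ≤ Λ s ∧
    Λ (s * Real.exp τ) + 5 ≤ Λ s + (s * Real.exp τ - s) * (V + 5 * ω * τ) := by
  have hτ0 : 0 ≤ τ := by rw [hτ]; positivity
  set R := s * ω * r ^ 2 with hR
  have hR0 : 0 ≤ R := by positivity
  have hgain : (4 * K + 1) * R ≤ s * ω * τ ^ 2 := by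
    have : s * ω * τ ^ 2 = (4 * K + 1) ^ 2 * R := by rw [hτ, hR]; ring
    rw [this]
    have : (4 * K + 1) ≤ (4 * K + 1) ^ 2 := by nlinarith
    gcongr
  have e1 := Real.add_one_le_exp τ
  have e2 := Real.add_one_le_exp (-τ)
  have e3 : Real.exp τ ≤ 3 :=
    (Real.exp_le_exp.2 (by linarith)).trans (exp_quarter_le hτ4)
  have e4 : Real.exp (-τ) ≤ 1 := Real.exp_le_one_iff.2 (by linarith)
  have k1 := (abs_le.1 h₁).2
  have k := (abs_le.1 h).1
  have k2 := (abs_le.1 h₂).2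
  have hKR : 0 ≤ K * R := by positivity
  have r1 : K * (s * Real.exp (-τ) * ω * r ^ 2) ≤ K * R := by
    calc _ = K * R * Real.exp (-τ) := by rw [hR]; ring
      _ ≤ K * R * 1 := by gcongr
      _ = _ := by ring
  have r2 : K * (s * Real.exp τ * ω * r ^ 2) ≤ 3 * (K * R) := by
    calc _ = K * R * Real.exp τ := by rw [hR]; ring
      _ ≤ K * R * 3 := by gcongr
      _ = _ := by ring
  have hsω : 0 < s * ω := by positivity
  constructor
  · have m : s * ω * (1 - τ) * (1 - τ) ≤ s * ω * (1 - τ) * Real.exp (-τ) :=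
      mul_le_mul_of_nonneg_left (by linarith) (mul_nonneg hsω.le (by linarith))
    nlinarith
  · have m : s * ω * (1 + τ) * (1 + τ) ≤ s * ω * (1 + τ) * Real.exp τ :=
      mul_le_mul_of_nonneg_left (by linarith) (mul_nonneg hsω.le (by linarith))
    nlinarith

/-- Bounds for a probability `p` in terms of the saddle point, written as a relative error for
`-log p`. -/
lemma exists_relative_error {p x : ℝ} (hs : 0 < s) (hω : 0 < ω) (hK : 0 ≤ K)
    (hτ : τ = (4 * K + 1) * r) (hr : 0 ≤ r) (hr1 : r ≤ 1) (hτ4 : τ ≤ 1 / 4)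
    (hbig : 5 ≤ s * ω * r ^ 2)
    (h : |x - s * (V + ω * (-1 + 3 * τ))| ≤ K * (s * ω * r ^ 2))
    (hlow : Real.exp (x - s * (V + 5 * ω * τ) - 3) ≤ p) (hup : p ≤ Real.exp (x - s * V + 3)) :
    ∃ ε : ℝ, |ε| ≤ (15 * (4 * K + 1) + 3 * (K + 1)) * r ∧
      p = Real.exp (-(s * ω * Real.exp (-(3 * τ)) * (1 + ε))) := by
  have hτ0 : 0 ≤ τ := by rw [hτ]; positivity
  have hp : 0 < p := (Real.exp_pos _).trans_le hlow
  have hsω : 0 < s * ω := by positivity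
  have hk := abs_le.1 h
  set e := Real.exp (3 * τ) with he
  have he0 : 0 < e := Real.exp_pos _
  have he3 : e ≤ 3 := exp_quarter_le hτ4
  have he1 : 1 + 3 * τ ≤ e := by rw [he]; linarith [Real.add_one_le_exp (3 * τ)]
  have he2 : e ≤ 1 + 9 * τ := by
    have h1 := Real.add_one_le_exp (-(3 * τ))
    have h2 : e * Real.exp (-(3 * τ)) = 1 := by rw [he, ← Real.exp_add]; simp
    nlinarith
  -- `z = -log p / (s ω)`
  set z := -Real.log p / (s * ω) with hz
  have hlp : -Real.log p = s * ω * z := by rw [hz]; field_simp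
  set y := (K + 1) * r ^ 2 with hy
  have hy0 : 0 ≤ y := by positivity
  have hsy : s * ω * y = (K + 1) * (s * ω * r ^ 2) := by rw [hy]; ring
  have hz1 : 1 - 3 * τ - y ≤ z := by
    have h1 := (Real.log_le_iff_le_exp hp).2 hup
    refine le_of_mul_le_mul_left ?_ hsω
    rw [← hlp]
    nlinarith
  have hz2 : z ≤ 1 + 2 * τ + y := by
    have h1 := (Real.le_log_iff_exp_le hp).2 hlow
    refine le_of_mul_le_mul_left ?_ hsω
    rw [← hlp]
    nlinarith
  have hyr : y ≤ (K + 1) * r := by rw [hy]; gcongr; nlinarith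
  refine ⟨e * z - 1, ?_, ?_⟩
  · have hb : (15 * (4 * K + 1) + 3 * (K + 1)) * r = 15 * τ + 3 * ((K + 1) * r) := by
      rw [hτ]; ring
    have hey : e * y ≤ 3 * y := by gcongr
    have heτ : e * τ ≤ 3 * τ := by gcongr
    have hl : e * (1 - 3 * τ - y) ≤ e * z := by gcongr
    have hu : e * z ≤ e * (1 + 2 * τ + y) := by gcongr
    have hl2 : (1 + 3 * τ) * (1 - 3 * τ) ≤ e * (1 - 3 * τ) :=
      mul_le_mul_of_nonneg_right he1 (by linarith)
    rw [hb, abs_le]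
    constructor <;> nlinarith
  · have : s * ω * Real.exp (-(3 * τ)) * (1 + (e * z - 1)) = -Real.log p := by
      rw [hlp, Real.exp_neg, ← he]; field_simp; ring
    rw [this, neg_neg, Real.exp_log hp]

end Numerics

end

section

variable {β : ℝ} {q : ℕ+ → ℝ} {α A B : ℝ}

/-! ### The tail probability -/

/-- At height `W` the saddle point gains at least a constant: `s ω r ^ 2` is large for every
`s = β e ^ x` with `x ≥ W - E`. -/
lemma tendsto_saddle_gain (hα : 0 < α) (hβ : 0 < β) (A B E : ℝ) :
    Tendsto (fun W => β * Real.exp (W - E) * (α * W ^ (A - 1)) * relErr B W ^ 2) atTop atTop := by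
  have h := (tendsto_exp_div_rpow_atTop (2 - A)).const_mul_atTop
    (show 0 < β * Real.exp (-E) * α by positivity)
  refine tendsto_atTop_mono' _ ?_ h
  filter_upwards [eventually_ge_atTop 3] with W hW
  have hW0 : 0 < W := by linarith
  have hl := one_le_log hW
  have h1 : 1 / W ≤ relErr B W ^ 2 := by
    have h2 : 0 < W ^ (1 - B) := by positivity
    have h3 : 1 / W ≤ Real.log W / W := by gcongr
    linarith [le_relErr_sq (B := B) (show 1 ≤ W by linarith)]
  have h2 : W ^ (2 - A) = W / W ^ (A - 1) := by
    rw [show 2 - A = 1 - (A - 1) by ring, Real.rpow_sub hW0, Real.rpow_one]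
  calc β * Real.exp (-E) * α * (Real.exp W / W ^ (2 - A))
      = β * Real.exp (W - E) * (α * W ^ (A - 1)) * (1 / W) := by
        rw [h2, sub_eq_add_neg W E, Real.exp_add]
        have : 0 < W ^ (A - 1) := by positivity
        field_simp
    _ ≤ _ := by gcongr

set_option maxHeartbeats 400000 in
/-- The asymptotic formula for the tail probability, with a threshold `c` for `W` and a loss `Θ` in
the upper end of the range of `W` that depend only on the sequence and on the implied constants. -/
theorem WellBehaved.exists_tailProb_eq (hq : WellBehaved q α β A B) (hα : 0 < α)
    (hβ : 0 < β) (hA : 0 ≤ A) (hB : 1 < B) (hAB : A < B) {C K₀ : ℝ} (hK₀ : 0 < K₀)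
    (hC : Tendsto (fun y => harmonicSum q y - harmonicMain α β A y) atTop (𝓝 C))
    (hH : ∀ y : ℝ, 2 * (2 + β) ^ 2 ≤ y →
      |harmonicSum q y - harmonicMain α β A y - C| ≤ K₀ * ell β y ^ (A - B))
    {c₀ κ K₁ K₂ : ℝ} (hc₀ : 0 < c₀) (hκ : 0 < κ) (hK₁ : 0 < K₁) (hK₂ : 0 < K₂) :
    ∃ Q₀ c Θ K : ℝ, 1 ≤ c ∧ 0 < Θ ∧ 0 < K ∧
      ∀ {Ω Ω' Ω'' : Type*} [MeasurableSpace Ω] [MeasurableSpace Ω'] [MeasurableSpace Ω'']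
        {P : Measure Ω} {P' : Measure Ω'} {P'' : Measure Ω''}
        [IsProbabilityMeasure P] [IsProbabilityMeasure P'] [IsProbabilityMeasure P'']
        {X : ℕ+ → Ω → ℝ} {Y : ℕ+ → Ω' → ℝ} {𝕐 : Ω'' → ℝ} {Q L : ℝ},
        Q₀ ≤ Q → AIH q L Q K₂ P X P' Y → 0 < L → L ≤ (count q Q : ℝ) →
        CRVH c₀ κ K₁ P' Y P'' 𝕐 →
        ∀ {W : ℝ}, c ≤ W →
          W ≤ Real.log L - A * Real.log (Real.log Q)
            - (if A = 0 then Real.log (Real.log (Real.log Q)) else 0) - Θ →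
          ∃ ε : ℝ, |ε| ≤ K * relErr B W ∧ tailProb P q X Q (C + mainFun α A W) =
            Real.exp (-(α * β * Real.exp (-eta P'' 𝕐 - 1) * W ^ (A - 1)
              * Real.exp W * (1 + ε))) := by
  obtain ⟨M, hM, hgrowth⟩ := hq.exists_growth_bounds hα hβ hA (by linarith) hC
  set k := max (cgfConst c₀ κ K₁) 0 with hk
  have hk0 : 0 ≤ k := le_max_right _ _
  set E := 2 * k + 2 with hE
  set Z := β * Real.exp E with hZ
  have hZ0 : 0 < Z := by positivity
  -- `Z e ^ W` bounds all the parameters `s` in use, whence the choice of `D`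
  obtain ⟨K, hK, hlin⟩ := hq.exists_sum_cgf_sub_linear_le hα hβ hA (by linarith) hAB hK₀ hH
    (K₁ := max (cgfConst c₀ κ K₁) 0) hk0 (D := 2 * Z * M) (by positivity) (E := E) (by positivity)
  set T := 4 * K + 1 with hT
  have hT0 : 0 < T := by positivity
  have hr0 := tendsto_relErr hB
  have hexp : Tendsto (fun W : ℝ => (K₂ + 1) * Real.exp (-(W / 2))) atTop (𝓝 0) := by
    have h1 : Tendsto (fun W : ℝ => -(W / 2)) atTop atBot :=
      tendsto_neg_atTop_atBot.comp (tendsto_id.atTop_div_const two_pos)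
    simpa using (Real.tendsto_exp_atBot.comp h1).const_mul (K₂ + 1)
  have hev : ∀ᶠ W in atTop, (1 ≤ W ∧ E ≤ W ∧ relErr B W ≤ 1 ∧ T * relErr B W ≤ 1 / 4 ∧
      5 ≤ β * Real.exp (W - E) * (α * W ^ (A - 1)) * relErr B W ^ 2 ∧
      -C ≤ mainFun α A W ∧ (K₂ + 1) * Real.exp (-(W / 2)) ≤ 1 / 2) ∧
      ∀ (g : ℕ+ → ℝ → ℝ) (g₀ g₀' : ℝ → ℝ), CgfFamily k g g₀ g₀' →
      ∀ y Q, |y - W| ≤ E → β * Real.exp y * y ≤ 2 * Z * M * Q →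
      |∑ n ∈ hq.upTo Q, g n (β * Real.exp y / q n) -
        β * Real.exp y * (C + mainFun α A W + α * W ^ (A - 1) * (y - W + etaOf g₀))| ≤
        K * (β * Real.exp y * (α * W ^ (A - 1)) * relErr B W ^ 2) := by
    have hrT : Tendsto (fun W => T * relErr B W) atTop (𝓝 0) := by
      simpa using hr0.const_mul T
    filter_upwards [hlin, eventually_ge_atTop 1, eventually_ge_atTop E,
      hr0.eventually_le_const one_pos, hrT.eventually_le_const (by norm_num : (0 : ℝ) < 1 / 4),
      (tendsto_saddle_gain hα hβ A B E).eventually_ge_atTop 5,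
      (tendsto_mainFun hα hA).eventually_ge_atTop (-C),
      hexp.eventually_le_const (by norm_num : (0 : ℝ) < 1 / 2)] with W a1 a2 a3 a4 a5 a6 a7 a8
    exact ⟨⟨a2, a3, a4, a5, a6, a7, a8⟩, a1⟩
  obtain ⟨c, hc⟩ := eventually_atTop.1 hev
  obtain ⟨Q₀, hQ₀⟩ := eventually_atTop.1 hgrowth
  -- `e ^ Θ = U` is chosen such that `N > L - 2` exceeds both `6 s H(Q)` and `3 s b + 1`
  set U := 6 * Z * M + 3 * Z * (|C| + 3 * M) + 3 with hU
  have hU3 : 3 < U := by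
    have : 0 < 6 * Z * M + 3 * Z * (|C| + 3 * M) := by positivity
    linarith
  refine ⟨max Q₀ 1, max c 1, Real.log U, 15 * T + 3 * (K + 1), le_max_right _ _,
    Real.log_pos (by linarith), by positivity, ?_⟩
  intro Ω Ω' Ω'' _ _ _ P P' P'' _ _ _ X Y 𝕐 Q L hQ hAIH hL0 hLc hCRVH W hcW hW
  obtain ⟨⟨hW1, hWE, hr1, hτ4, hbig, hV0, hsmall⟩, hlinW⟩ := hc W ((le_max_left _ _).trans hcW)
  obtain ⟨hMQ, hllQ, hG, hHQ, hcQ, hWQ⟩ := hQ₀ Q ((le_max_left _ _).trans hQ)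
  have hQ1 : 1 ≤ Q := (le_max_right _ _).trans hQ
  have hlQ : 1 ≤ Real.log Q := hM.trans hMQ
  have hW0 : 0 < W := by linarith
  set G := growth A Q with hGdef
  have hG0 : 0 < G := by linarith
  have hLW : U * (Real.exp W * G) ≤ L := by
    have := exp_mul_growth_le (A := A) hL0 (by linarith) (by linarith) hW
    rwa [Real.exp_log (by linarith)] at this
  have heW : Real.exp W ≤ M * (Q / Real.log Q) := by
    have h1 : Real.exp W * G ≤ U * (Real.exp W * G) :=
      le_mul_of_one_le_left (by positivity) (by linarith only [hU3])
    refine le_of_mul_le_mul_right ?_ hG0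
    calc Real.exp W * G ≤ M * (Q * (G / Real.log Q)) := h1.trans (hLW.trans (hLc.trans hcQ))
      _ = _ := by ring
  have hWlog : W ≤ Real.log Q := by
    rw [Real.le_log_iff_exp_le (by linarith)]
    refine heW.trans ?_
    rw [← mul_div_assoc, div_le_iff₀ (by linarith only [hlQ]), mul_comm]
    exact mul_le_mul_of_nonneg_left hMQ (by linarith only [hQ1])
  obtain ⟨hmain, hω⟩ := hWQ W hW1 hWlog
  have hfam := hCRVH.cgfFamily hc₀ hκ hK₁
  have hkk : k = cgfConst c₀ κ K₁ := max_eq_left hfam.const_nonneg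
  rw [← hkk] at hfam
  have hη := abs_le.1 hfam.abs_etaOf_le
  set η := etaOf (cgf 𝕐 P'') with hηdef
  have hηeq : eta P'' 𝕐 = η := rfl
  set ω := α * W ^ (A - 1) with hωdef
  have hω0 : 0 < ω := by positivity
  set r := relErr B W with hr
  have hr0' : 0 < r := relErr_pos hW0
  set τ := T * r with hτ
  have hτ0 : 0 < τ := by positivity
  set V := C + mainFun α A W with hV
  -- the logarithm `x` of `s / β`: the minimum of `Λ(s) - s V` is near `W - η - 1`; the shift by
  -- `3 τ` moves the tilted mean above `V`, into the middle of the window `[V + ω τ, V + 5 ω τ]`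
  set x := W - η - 1 + 3 * τ with hx
  set s := β * Real.exp x with hs
  have hs0 : 0 < s := by positivity
  set Λ : ℝ → ℝ := fun σ => ∑ n ∈ hq.upTo Q, cgf (Y n) P' (σ / q n) with hΛ
  have hΛ0 : ∀ σ, 0 ≤ Λ σ := fun σ => Finset.sum_nonneg fun n _ =>
    cgf_nonneg_of_centered (hCRVH.measurable n).aemeasurable
      ((hCRVH.support n).mono fun ω hω => abs_le.2 hω) (hCRVH.mean_zero n) _
  have hexpy : ∀ y, |y - W| ≤ E → β * Real.exp y ≤ Z * Real.exp W := by
    intro y hy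
    rw [hZ, mul_assoc, ← Real.exp_add]
    gcongr
    linarith [(abs_le.1 hy).2]
  have hlinear : ∀ y, |y - W| ≤ E → |Λ (β * Real.exp y) - β * Real.exp y *
      (V + ω * (y - W + η))| ≤ K * (β * Real.exp y * ω * r ^ 2) := by
    intro y hy
    refine hlinW _ _ _ hfam y Q hy ?_
    have hy2 : y ≤ 2 * Real.log Q := by linarith [(abs_le.1 hy).2]
    calc β * Real.exp y * y ≤ β * Real.exp y * (2 * Real.log Q) := by gcongr
      _ ≤ Z * Real.exp W * (2 * Real.log Q) := by
          gcongr ?_ * _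
          exact hexpy y hy
      _ ≤ Z * (M * (Q / Real.log Q)) * (2 * Real.log Q) := by gcongr
      _ = 2 * Z * M * Q := by field_simp
  have hy0 : |x - W| ≤ E := abs_le.2 ⟨by rw [hx, hE]; linarith, by rw [hx, hE]; linarith⟩
  have hy1 : |x - τ - W| ≤ E := abs_le.2 ⟨by rw [hx, hE]; linarith, by rw [hx, hE]; linarith⟩
  have hy2 : |x + τ - W| ≤ E := abs_le.2 ⟨by rw [hx, hE]; linarith, by rw [hx, hE]; linarith⟩
  have e1 : β * Real.exp (x - τ) = s * Real.exp (-τ) := by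
    rw [hs, sub_eq_add_neg, Real.exp_add]; ring
  have e2 : β * Real.exp (x + τ) = s * Real.exp τ := by
    rw [hs, Real.exp_add]; ring
  have l := hlinear x hy0
  have l₁ := hlinear (x - τ) hy1
  have l₂ := hlinear (x + τ) hy2
  rw [show x - W + η = -1 + 3 * τ by rw [hx]; ring, ← hs] at l
  rw [show x - τ - W + η = -1 + 2 * τ by rw [hx]; ring, e1] at l₁
  rw [show x + τ - W + η = -1 + 4 * τ by rw [hx]; ring, e2] at l₂
  have hbig' : 5 ≤ s * ω * r ^ 2 := by
    refine hbig.trans ?_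
    rw [hs]
    gcongr
    linarith [(abs_le.1 hy0).1]
  obtain ⟨hdrop₁, hdrop₂⟩ := drops_of_linear hs0 hω0 hK.le hτ hr0'.le hτ4 hbig' l₁ l l₂
  -- the largest even `N ≤ L`
  set N := 2 * ⌊L / 2⌋₊ with hN
  have hNL : (N : ℝ) ≤ L := by
    have := Nat.floor_le (show 0 ≤ L / 2 by linarith)
    rw [hN]; push_cast; linarith
  have hNL' : L - 2 ≤ N := by
    have := Nat.lt_floor_add_one (L / 2)
    rw [hN]; push_cast; linarith
  have heG : 1 ≤ Real.exp W * G :=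
    one_le_mul_of_one_le_of_one_le (Real.one_le_exp hW0.le) hG
  have hNU : (U - 2) * (Real.exp W * G) ≤ N := by
    have h1 : (U - 2) * (Real.exp W * G) = U * (Real.exp W * G) - 2 * (Real.exp W * G) := by ring
    linarith only [h1, hLW, heG, hNL']
  have hNW : W ≤ N := by
    have h1 : W ≤ Real.exp W := by linarith [Real.add_one_le_exp W]
    have h2 : Real.exp W ≤ Real.exp W * G := le_mul_of_one_le_right (Real.exp_pos _).le hG
    have h3 : Real.exp W * G ≤ (U - 2) * (Real.exp W * G) :=
      le_mul_of_one_le_left (by positivity) (by linarith only [hU3])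
    linarith only [h1, h2, h3, hNU]
  have hNsmall : (K₂ + 1) * Real.exp (-((N : ℝ) / 2)) ≤ 1 / 2 := by
    refine le_trans ?_ hsmall
    gcongr
  have hs₂ : s * Real.exp τ ≤ Z * Real.exp W := by rw [← e2]; exact hexpy _ hy2
  have hs₁s : s * Real.exp (-τ) ≤ s :=
    mul_le_of_le_one_right hs0.le (Real.exp_le_one_iff.2 (by linarith))
  have hss₂ : s ≤ s * Real.exp τ := le_mul_of_one_le_right hs0.le (Real.one_le_exp hτ0.le)
  have hUeq : (U - 2) * (Real.exp W * G) = 6 * ((Z * Real.exp W) * (M * G)) +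
      3 * ((Z * Real.exp W) * ((|C| + 3 * M) * G)) + Real.exp W * G := by rw [hU]; ring
  have hσN : ∀ σ, 0 ≤ σ → σ ≤ s * Real.exp τ → 6 * (σ * harmonicSum q Q) ≤ N := by
    intro σ hσ hσ'
    have h0 : 0 ≤ 3 * ((Z * Real.exp W) * ((|C| + 3 * M) * G)) := by positivity
    calc 6 * (σ * harmonicSum q Q) ≤ 6 * ((Z * Real.exp W) * (M * G)) := by
          gcongr
          · exact hq.harmonicSum_nonneg Q
          · exact hσ'.trans hs₂
      _ ≤ (U - 2) * (Real.exp W * G) := by rw [hUeq]; linarith only [h0, heG]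
      _ ≤ N := hNU
  have hb : V + 5 * ω * τ ≤ (|C| + 3 * M) * G := by
    have h1 : |C| ≤ |C| * G := le_mul_of_one_le_right (abs_nonneg _) hG
    have h2 : 5 * ω * τ ≤ 5 * ω * (1 / 4) := by gcongr
    linarith [le_abs_self C]
  have hNb : 3 * (s * Real.exp τ * (V + 5 * ω * τ)) + 1 ≤ N := by
    have h0 : 0 ≤ 6 * ((Z * Real.exp W) * (M * G)) := by positivity
    have h1 : 0 ≤ V + 5 * ω * τ := by
      have : 0 ≤ 5 * ω * τ := by positivity
      linarith
    calc 3 * (s * Real.exp τ * (V + 5 * ω * τ)) + 1 ≤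
          3 * ((Z * Real.exp W) * ((|C| + 3 * M) * G)) + 1 := by gcongr
      _ ≤ (U - 2) * (Real.exp W * G) := by rw [hUeq]; linarith only [h0, heG]
      _ ≤ N := hNU
  have hmom : ∀ σ, 0 ≤ σ → σ ≤ s * Real.exp τ →
      |∫ ω, truncExp N (σ * weightedSum q X Q ω) ∂P - Real.exp (Λ σ)| ≤ 1 / 2 := fun σ hσ hσ' =>
    (hAIH.abs_truncExp_moment_sub_le hq hK₂.le hCRVH.measurable hCRVH.indep hCRVH.support hNL hσ
      (hσN σ hσ hσ')).trans hNsmall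
  have htop := (hAIH.top_moment_le hq hK₂.le hCRVH.support hNL hs0.le
    (hσN s hs0.le hss₂)).trans (hNsmall.trans (by norm_num : (1 / 2 : ℝ) ≤ 1))
  have hN0 : N ≠ 0 := by
    rintro h
    rw [h, Nat.cast_zero] at hNW
    linarith
  have hs₁0 : 0 ≤ s * Real.exp (-τ) := by positivity
  have hωτ : 0 ≤ ω * τ := by positivity
  obtain ⟨hlow, hup⟩ := tail_bounds_of_saddle (hq.measurable_weightedSum hAIH.measurable_left)
    (even_two_mul _) hN0 (fun j hj => hq.integrable_weightedSum_pow
      (hAIH.integrable_left j ((Nat.cast_le.2 hj).trans hNL)))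
    hs₁0 hs₁s hss₂ (by linarith : 0 ≤ V)
    (le_add_of_nonneg_right (by positivity)) (by linarith only [hωτ]) hNb
    (hmom _ hs₁0 (hs₁s.trans hss₂)) (hmom _ hs0.le hss₂) (hmom _ (by positivity) le_rfl) htop
    (hΛ0 _) (hΛ0 _) (hΛ0 _) hdrop₁ hdrop₂
  obtain ⟨ε, hε, hp⟩ := exists_relative_error hs0 hω0 hK.le hτ hr0'.le hr1 hτ4 hbig' l hlow hup
  refine ⟨ε, hε, ?_⟩
  have hmainterm : α * β * Real.exp (-eta P'' 𝕐 - 1) * W ^ (A - 1) * Real.exp W =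
      s * ω * Real.exp (-(3 * τ)) := by
    have : Real.exp x = Real.exp (-η - 1) * Real.exp W * Real.exp (3 * τ) := by
      rw [← Real.exp_add, ← Real.exp_add, hx]; congr 1; ring
    rw [hs, this, hηeq, hωdef, Real.exp_neg (3 * τ)]
    field_simp
  rw [hmainterm]
  exact hp

end

end LargeDev

end

theorem theorem1p2 (q : ℕ+ → ℝ) (α β A B : ℝ) (hα : 0 < α) (hβ : 0 < β) (hA : 0 ≤ A)
    (hB : max A 1 < B) (hq : LargeDev.WellBehaved q α β A B) :
    ∃ C𝒜 : ℝ,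
      Tendsto (fun y => LargeDev.harmonicSum q y - LargeDev.harmonicMain α β A y)
        atTop (𝓝 C𝒜) ∧
      ∀ c₀ κ K₁ K₂ : ℝ, 0 < c₀ → 0 < κ → 0 < K₁ → 0 < K₂ →
      ∃ Q₀ c Θ K : ℝ, 1 ≤ c ∧ 0 < Θ ∧ 0 < K ∧
        ∀ (Ω Ω' Ω'' : Type*) [MeasurableSpace Ω] [MeasurableSpace Ω'] [MeasurableSpace Ω'']
          (P : Measure Ω) (P' : Measure Ω') (P'' : Measure Ω'')
          [IsProbabilityMeasure P] [IsProbabilityMeasure P'] [IsProbabilityMeasure P'']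
          (X : ℕ+ → Ω → ℝ) (Y : ℕ+ → Ω' → ℝ) (𝕐 : Ω'' → ℝ) (Q L : ℝ),
          Q₀ ≤ Q →
          LargeDev.AIH q L Q K₂ P X P' Y →
          (Real.log Q) ^ (2 * A ^ 2) ≤ L → L ≤ (LargeDev.count q Q : ℝ) →
          LargeDev.CRVH c₀ κ K₁ P' Y P'' 𝕐 →
          IntegrableOn (fun u : ℝ => LargeDev.fFun P'' 𝕐 u / u ^ 2) (Set.Ioi 0) ∧
          ∀ V W : ℝ, 1 + C𝒜 ≤ V → W = LargeDev.paramW α A C𝒜 V →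
            c ≤ W →
            W ≤ Real.log L - A * Real.log (Real.log Q)
              - (if A = 0 then Real.log (Real.log (Real.log Q)) else 0) - Θ →
            ∃ ε : ℝ, |ε| ≤ K * (√(Real.log W) / W ^ (1 / 2 : ℝ) + 1 / W ^ ((B - 1) / 2)) ∧
              LargeDev.tailProb P q X Q V =
                Real.exp (-(α * β * Real.exp (-LargeDev.eta P'' 𝕐 - 1) * W ^ (A - 1)
                  * Real.exp W * (1 + ε))) := by
  obtain ⟨C, K₀, hK₀, hC, hH⟩ := hq.exists_harmonic_const hβ
    (one_pos.trans ((le_max_right _ _).trans_lt hB)) ((le_max_left _ _).trans_lt hB)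
  refine ⟨C, hC, fun c₀ κ K₁ K₂ hc₀ hκ hK₁ hK₂ => ?_⟩
  obtain ⟨Q₀, c, Θ, K, hc, hΘ, hK, h⟩ := hq.exists_tailProb_eq hα hβ hA
    ((le_max_right _ _).trans_lt hB) ((le_max_left _ _).trans_lt hB) hK₀ hC hH hc₀ hκ hK₁ hK₂
  refine ⟨max Q₀ 2, c, Θ, K, hc, hΘ, hK, ?_⟩
  intro Ω Ω' Ω'' _ _ _ P P' P'' _ _ _ X Y 𝕐 Q L hQ hAIH hL hLc hCRVH
  refine ⟨(hCRVH.cgfFamily hc₀ hκ hK₁).integrableOn, fun V W hV hVW hcW hW => ?_⟩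
  have hlog : 0 < Real.log Q :=
    Real.log_pos (one_lt_two.trans_le ((le_max_right _ _).trans hQ))
  have hL0 : 0 < L := (Real.rpow_pos_of_pos hlog _).trans_le hL
  obtain ⟨ε, hε, hp⟩ := h ((le_max_left _ _).trans hQ) hAIH hL0 hLc hCRVH hcW hW
  refine ⟨ε, hε, ?_⟩
  rw [← hp, hVW, LargeDev.mainFun_paramW hα hA (by linarith), add_sub_cancel]
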